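/- Let $\mathbb{T}=\mathbb{R}/\mathbb{Z}$. Consider smooth ($C^\infty$) skew products $F(y,x)=(g(y),f_y(x))$ on $\mathbb{T}^2$, where $g:\mathbb{T}\to\mathbb{T}$ is expanding ($|g'|>1$) and each $f_y:\mathbb{T}\to\mathbb{T}$ is a smooth circle diffeomorphism; write $F^n(y,x)=(g^n(y),f^n_y(x))$. Let $\mathcal{S}=\{\mathbf{y}=(\ldots,y_{-1},y_0)\in\mathbb{T}^{-\mathbb{N}} : g(y_{-n-1})=y_{-n}\text{ for all } n\ge 0\}$ be the solenoid of $g$ with the product topology. The map $F$ induces the bijection $F(\mathbf{y},x)=((\ldots,y_{-1},y_0,g(y_0)),\,f_{y_0}(x))$ of $\mathcal{S}\times\mathbb{T}$. Put on $\mathcal{S}\times\mathbb{T}$ the distance $d((\mathbf{y},x),(\mathbf{z},w))=\sum_{n\ge0}2^{-n}|y_{-n}-z_{-n}|+|x-w|$, where $|\cdot|$ is the distance on $\mathbb{T}$. For $p\in\mathcal{S}\times\mathbb{T}$, the strong stable manifold $W^{ss}(p)$ is the set of $q$ for which there are $C$ and $\rho>0$ with $\rho<|f_y'(x)|$ for all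 $y,x$ and $d(F^np,F^nq)\le C\rho^n$ for all $n\ge 0$. The strong unstable manifold $W^{uu}(p)$ is the set of $q$ for which there are $C$ and $\rho>0$ with $\rho<1/|f_y'(x)|$ for all $y,x$ and $d(F^{-n}p,F^{-n}q)\le C\rho^n$ for all $n\ge0$. A map $H$ is topologically mixing if for all nonempty open $U,V$, $H^n(U)\cap V\neq\emptyset$ for all large enough $n$. **Theorem.** Let $i>1$ and $r\ge 2$ be integers and let $F_{i,0}(y,x)=(iy,x)$. For every $\varepsilon>0$ there is a smooth skew product $F(y,x)=(g(y),f_y(x))$ as above that is $\varepsilon$-close to $F_{i,0}$ in the $C^r$ topology and has the following properties. 1. $F$ is robustly topologically mixing, on $\mathbb{T}^2$ and on $\mathcal{S}\times\mathbb{T}$: there is $\delta>0$ such that every smooth skew product $G$ as above that is $\delta$-close to $F$ in the $C^r$ topology is topologically mixing on $\mathbb{T}^2$, and the map it induces on $\mathcal{S}_G\times\mathbb{T}$, with $\mathcal{S}_G$ the solenoid of the base map of $G$, is topologically mixing. 2. There are $k\ge1$ and $\hat y\in\mathbb{T}$ with $g^k(\hat y)=\hat y$ such that $f^k_{\hat y}$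 has exactly two fixed points, one hyperbolic attracting ($|(f^k_{\hat y})'|<1$) and one hyperbolic repelling ($|(f^k_{\hat y})'|>1$). 3. $F$ is partially hyperbolic on $\mathcal{S}\times\mathbb{T}$, in the sense that $\tfrac12<|f_y'(x)|<|g'(z)|$ for all $x,y,z\in\mathbb{T}$, and for every $p\in\mathcal{S}\times\mathbb{T}$ both $W^{ss}(p)$ and $W^{uu}(p)$ are dense in $\mathcal{S}\times\mathbb{T}$. -/

import Mathlib

open scoped ContDiff

/-! ### Smooth maps of the circle `𝕋 = ℝ/ℤ` and of the torus `𝕋²`, through lifts -/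

/-- `Φ : ℝ → ℝ` is a lift of the circle map `h`. -/
def IsCircleLift (Φ : ℝ → ℝ) (h : UnitAddCircle → UnitAddCircle) : Prop :=
  ∀ t : ℝ, (Φ t : UnitAddCircle) = h (t : UnitAddCircle)

/-- A smooth circle map: it has a smooth lift to the universal cover. -/
def IsSmoothCircleMap (h : UnitAddCircle → UnitAddCircle) : Prop :=
  ∃ Φ : ℝ → ℝ, IsCircleLift Φ h ∧ ContDiff ℝ ∞ Φ

/-- A smooth circle diffeomorphism. -/
def IsCircleDiffeo (h : UnitAddCircle → UnitAddCircle) : Prop :=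
  IsSmoothCircleMap h ∧ ∃ h' : UnitAddCircle → UnitAddCircle,
    IsSmoothCircleMap h' ∧ Function.LeftInverse h' h ∧ Function.RightInverse h' h

/-- The representative in `(-1/2, 1/2]` of a point of the circle. -/
noncomputable def signedRep (z : UnitAddCircle) : ℝ :=
  (AddCircle.equivIoc (1 : ℝ) (-1 / 2) z : ℝ)

/-- The derivative `h'(x)` of a circle map, computed in the charts of `𝕋` given by translations
of the representative in `(-1/2, 1/2]`. -/
noncomputable def circleDeriv (h : UnitAddCircle → UnitAddCircle) (x : UnitAddCircle) : ℝ :=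
  deriv (fun t : ℝ => signedRep (h (x + (t : UnitAddCircle)) - h x)) 0

/-- `Φ : ℝ² → ℝ²` is a lift of the torus map `F`. -/
def IsTorusLift (Φ : ℝ × ℝ → ℝ × ℝ)
    (F : UnitAddCircle × UnitAddCircle → UnitAddCircle × UnitAddCircle) : Prop :=
  ∀ s t : ℝ, (((Φ (s, t)).1 : UnitAddCircle), ((Φ (s, t)).2 : UnitAddCircle)) =
    F ((s : UnitAddCircle), (t : UnitAddCircle))

/-- A smooth endomorphism of the torus. -/
def IsSmoothTorusMap (F : UnitAddCircle × UnitAddCircle → UnitAddCircle × UnitAddCircle) : Prop :=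
  ∃ Φ : ℝ × ℝ → ℝ × ℝ, IsTorusLift Φ F ∧ ContDiff ℝ ∞ Φ

/-- `F` and `G` are `ε`-close in the `C^k` topology: they have lifts whose Fréchet
derivatives of every order `j ≤ k` (order `0` included) differ everywhere by less than `ε`. -/
def CkClose (k : ℕ) (ε : ℝ)
    (F G : UnitAddCircle × UnitAddCircle → UnitAddCircle × UnitAddCircle) : Prop :=
  ∃ Φ Ψ : ℝ × ℝ → ℝ × ℝ, IsTorusLift Φ F ∧ IsTorusLift Ψ G ∧
    ContDiff ℝ k Φ ∧ ContDiff ℝ k Ψ ∧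
    ∀ j ≤ k, ∀ z : ℝ × ℝ, ‖iteratedFDeriv ℝ j (fun w => Φ w - Ψ w) z‖ < ε

/-- The linear map `F_{i,j}(y, x) = (i y, x + j y)` of the torus. -/
def linearSkew (i j : ℤ) (p : UnitAddCircle × UnitAddCircle) : UnitAddCircle × UnitAddCircle :=
  (i • p.1, p.2 + j • p.1)

/-! ### Topological mixing -/

/-- `F` is topologically mixing: for nonempty open `U`, `V`, the set `Fⁿ(U)` meets `V` for all
large enough `n`. -/
def IsTopMixing {X : Type*} [TopologicalSpace X] (F : X → X) : Prop :=
  ∀ U V : Set X, IsOpen U → IsOpen V → U.Nonempty → V.Nonempty →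
    ∃ N : ℕ, ∀ n ≥ N, ((F^[n] '' U) ∩ V).Nonempty

/-! ### The solenoid -/

/-- The inverse limit of `g : 𝕋 → 𝕋`, with the topology induced by the product topology.
The point `(…, y₋₂, y₋₁, y₀)` is written as the sequence `n ↦ y₋ₙ`. -/
abbrev Solenoid (g : UnitAddCircle → UnitAddCircle) : Type :=
  {y : ℕ → UnitAddCircle // ∀ n, g (y (n + 1)) = y n}

/-- The bijection `(…, y₋₁, y₀) ↦ (…, y₋₁, y₀, g(y₀))` of the solenoid, with inverse
`(…, y₋₁, y₀) ↦ (…, y₋₂, y₋₁)`. -/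
def solenoidMap (g : UnitAddCircle → UnitAddCircle) : Solenoid g ≃ Solenoid g where
  toFun y := ⟨fun n => Nat.casesOn n (g (y.1 0)) y.1, by
    intro n
    cases n with
    | zero => rfl
    | succ n => exact y.2 n⟩
  invFun y := ⟨fun n => y.1 (n + 1), fun n => y.2 (n + 1)⟩
  left_inv y := by
    apply Subtype.ext
    rfl
  right_inv y := by
    apply Subtype.ext
    funext n
    cases n with
    | zero => exact y.2 0
    | succ n => rfl

/-- The distance `∑ₙ 2⁻ⁿ |y₋ₙ - z₋ₙ|` on the solenoid. It induces the product topology, and `g`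
contracts it by the factor `1/2` along each set `{y | y₀ = const}`. -/
noncomputable def solenoidDist {g : UnitAddCircle → UnitAddCircle} (y z : Solenoid g) : ℝ :=
  ∑' n : ℕ, (1 / 2 : ℝ) ^ n * dist (y.1 n) (z.1 n)

/-! ### Circle diffeomorphisms forced by expanding circle maps -/

/-- A smooth skew product `(y, x) ↦ (g(y), f_y(x))` on `𝕋²`, where the circle diffeomorphisms
`f_y` are forced by an expanding circle map `g`. -/
structure ForcedCircleDiffeo where
  /-- the base map `g` -/
  base : UnitAddCircle → UnitAddCircle
  /-- the fiber maps `f_y` -/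
  fiber : UnitAddCircle → UnitAddCircle → UnitAddCircle
  smooth : IsSmoothTorusMap (fun p => (base p.1, fiber p.1 p.2))
  expanding : ∀ y, 1 < |circleDeriv base y|
  fiber_diffeo : ∀ y, IsCircleDiffeo (fiber y)

namespace ForcedCircleDiffeo

/-- The skew product map `F(y, x) = (g(y), f_y(x))` on `𝕋²`. -/
def map (F : ForcedCircleDiffeo) (p : UnitAddCircle × UnitAddCircle) :
    UnitAddCircle × UnitAddCircle :=
  (F.base p.1, F.fiber p.1 p.2)

/-- The iterated fiber map `f^n_y = f_{g^{n-1}(y)} ∘ ⋯ ∘ f_y`, that is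
`F^n(y, x) = (g^n(y), f^n_y(x))`. -/
def fiberIter (F : ForcedCircleDiffeo) (n : ℕ) (y x : UnitAddCircle) : UnitAddCircle :=
  (F.map^[n] (y, x)).2

/-- The fiber map `f_y` with its inverse. -/
noncomputable def fiberEquiv (F : ForcedCircleDiffeo) (y : UnitAddCircle) :
    UnitAddCircle ≃ UnitAddCircle :=
  Equiv.ofBijective (F.fiber y) (by
    obtain ⟨-, h', -, hl, hr⟩ := F.fiber_diffeo y
    exact ⟨hl.injective, hr.surjective⟩)

/-- The natural extension `F(𝐲, x) = (g(𝐲), f_{y₀}(x))` on `𝒮 × 𝕋`, with inverse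
`F⁻¹(𝐲, x) = (g⁻¹(𝐲), (f_{y₋₁})⁻¹(x))`. -/
noncomputable def ext (F : ForcedCircleDiffeo) :
    Solenoid F.base × UnitAddCircle ≃ Solenoid F.base × UnitAddCircle where
  toFun p := (solenoidMap F.base p.1, F.fiberEquiv (p.1.1 0) p.2)
  invFun p := ((solenoidMap F.base).symm p.1, (F.fiberEquiv (p.1.1 1)).symm p.2)
  left_inv p := by
    refine Prod.ext ?_ ?_
    · exact (solenoidMap F.base).symm_apply_apply p.1
    · exact (F.fiberEquiv (p.1.1 0)).symm_apply_apply p.2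
  right_inv p := by
    refine Prod.ext ?_ ?_
    · exact (solenoidMap F.base).apply_symm_apply p.1
    · exact (F.fiberEquiv (p.1.1 1)).apply_symm_apply p.2

/-- The distance on `𝒮 × 𝕋`. -/
noncomputable def extDist (F : ForcedCircleDiffeo) (p q : Solenoid F.base × UnitAddCircle) : ℝ :=
  solenoidDist p.1 q.1 + dist p.2 q.2

/-- `F` is partially hyperbolic on `𝒮 × 𝕋` with the fibers as center direction: the expansion of
`g` dominates the fiber derivatives, and these dominate the contraction by `1/2` in the
solenoid. -/
def IsPartiallyHyperbolic (F : ForcedCircleDiffeo) : Prop :=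
  ∀ y x z, 1 / 2 < |circleDeriv (F.fiber y) x| ∧
    |circleDeriv (F.fiber y) x| < |circleDeriv F.base z|

/-- The strong stable manifold `W^ss(p)`: the points whose forward orbit approaches that of `p`
exponentially fast, at a rate stronger than every contraction in the fibers. -/
def strongStable (F : ForcedCircleDiffeo) (p : Solenoid F.base × UnitAddCircle) :
    Set (Solenoid F.base × UnitAddCircle) :=
  {q | ∃ ρ > 0, (∀ y x, ρ < |circleDeriv (F.fiber y) x|) ∧
    ∃ C : ℝ, ∀ n : ℕ, F.extDist (F.ext^[n] p) (F.ext^[n] q) ≤ C * ρ ^ n}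

/-- The strong unstable manifold `W^uu(p)`: the points whose backward orbit approaches that of `p`
exponentially fast, at a rate stronger than every contraction of `F⁻¹` in the fibers. -/
def strongUnstable (F : ForcedCircleDiffeo) (p : Solenoid F.base × UnitAddCircle) :
    Set (Solenoid F.base × UnitAddCircle) :=
  {q | ∃ ρ > 0, (∀ y x, ρ < |circleDeriv (F.fiber y) x|⁻¹) ∧
    ∃ C : ℝ, ∀ n : ℕ, F.extDist (F.ext.symm^[n] p) (F.ext.symm^[n] q) ≤ C * ρ ^ n}

/-- `F` is robustly topologically mixing, both on `𝕋²` and on `𝒮 × 𝕋`: this holds for all smooth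
skew products in a `C^k` neighborhood of `F`. -/
def IsRobustlyMixing (F : ForcedCircleDiffeo) (k : ℕ) : Prop :=
  ∃ δ > 0, ∀ G : ForcedCircleDiffeo, CkClose k δ F.map G.map →
    IsTopMixing G.map ∧ IsTopMixing G.ext

end ForcedCircleDiffeo

/-!
The example is `F(y, x) = (i y, x + ε v(y, x))` with a small `ε` and a fixed trigonometric
polynomial `v`, the `forcing` field. It is arranged so that near every height `x₀` the fiber maps
over some orbit of `y ↦ i y` all expand; that over the fixed point `0` the fiber map has exactly a
repelling fixed point `0` and an attracting fixed point `1/2`; and that over the orbit `±1/(i+1)`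
the fiber maps are rotations by `ε θ`, where `ε` is chosen with `2 ε θ` irrational. These and some
uniform bounds are the content of the structure `ForcingField`.

*Robust mixing.* Every nonempty open set has an iterated image equal to the torus. A thin strip
around a long horizontal curve contains a part that follows an orbit over which the fiber maps
expand at the height of the curve. After a fixed number `N` of iterates this part is long again and
has become thicker by a definite factor, so that any open set has images containing balls of a
fixed radius (`NearModel.exists_ball_subset_image`). This uses only `C¹` bounds and holds for all
maps near `F`. For `F` itself, backward orbits are dense, since they accumulate on the circle over
`1/(i+1)`, where `F²` is an irrational rotation, and every open set meets the preimages of that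
circle (`ForcingField.exists_mem_image_iterate`). As `(0, 0)` is a repelling fixed point, images of
small boxes around it increase, by compactness, to the torus
(`ForcingField.exists_image_iterate_eq_univ`). By compactness again, balls of a fixed radius are
mapped onto the torus after a common number of iterates, and this also survives small perturbations
because preimages move little (`ForcingField.exists_robust_image_iterate_eq_univ`). An open subset
of `𝒮 × 𝕋` contains an iterate of a set of points lying over an open subset of `𝕋²`
(`ForcedCircleDiffeo.exists_open_proj`), and this transfers mixing to the natural extension.

*Strong stable manifolds.* Two points whose forward orbits eventually have the same projection to
`𝕋²` approach each other at the rate `1/2`. As some image of every open set is the whole torus,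
every open set contains such a partner of any given point.

*Strong unstable manifolds.* The strong unstable manifold of any point contains a set projecting
onto a curve of slope at most `1/100`, a limit of images of horizontal segments
(`ForcingField.exists_leaf`). The forward images of the unstable curve of the saddle `(0, 1/2)` are
dense because that curve crosses the circle over `1/(i+1)` (`ForcingField.exists_iterate_mem_of_curve`). Any other curve of
small slope has, after a fixed number of iterates, a point over an integer at a definite distance
from the repelling point `0` (`ForcingField.exists_away_from_int`), because the forcing pushes the
circle `x = 0` upwards over `1/i`; hence its images accumulate on the saddle curve. So all images of
such curves under one iterate meet a given open set (`ForcingField.exists_iterate_meets_curves`),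
and pulling a point back along its orbit before taking the curve gives density.
-/

open Filter Topology

/-! ### The forcing field -/

/-- The properties of a function `v` on `ℝ²`, periodic in both variables, on which the dynamics
of the skew product `(y, x) ↦ (i y, x + ε v(y, x))` rests:
* `v` is bounded, Lipschitz in each variable, and its increments in `x` are Lipschitz in `y`, with
  the constant `L` throughout;
* `expand`: near each height `x₀` the fiber maps over some orbit of `y ↦ i y` all expand;
* over the fixed point `0` there is a repelling point `0` and an attracting point `1/2`, and all
  other points move from the former to the latter;
* over the orbit `±1/(i+1)` the fiber maps are rotations by the same angle `ε θ`;
* the horizontal circle `x = 0` is moved upwards. -/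
structure ForcingField (i : ℤ) (v : ℝ → ℝ → ℝ) (L c θ : ℝ) : Prop where
  two_le : 2 ≤ i
  L_pos : 0 < L
  c_pos : 0 < c
  θ_pos : 0 < θ
  smooth : ContDiff ℝ ∞ (fun p : ℝ × ℝ => v p.1 p.2)
  per_left : ∀ y x, v (y + 1) x = v y x
  per_right : ∀ y x, v y (x + 1) = v y x
  bound : ∀ y x, |v y x| ≤ L
  lip_left : ∀ y y' x, |v y x - v y' x| ≤ L * |y - y'|
  lip_right : ∀ y x x', |v y x - v y x'| ≤ L * |x - x'|
  mixed : ∀ y y' x x', |(v y x - v y x') - (v y' x - v y' x')| ≤ L * |y - y'| * |x - x'|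
  expand : ∀ x₀, ∃ o, ∀ k : ℕ, ∀ x x', |x - x₀| ≤ 1 / 40 → |x' - x₀| ≤ 1 / 40 → x ≤ x' →
    c * (x' - x) ≤ v ((i : ℝ) ^ k * o) x' - v ((i : ℝ) ^ k * o) x
  expand_zero : ∀ x x', |x| ≤ 1 / 40 → |x'| ≤ 1 / 40 → x ≤ x' → c * (x' - x) ≤ v 0 x' - v 0 x
  contract_half : ∀ x x', |x - 1 / 2| ≤ 1 / 40 → |x' - 1 / 2| ≤ 1 / 40 → x ≤ x' →
    v 0 x' - v 0 x ≤ - c * (x' - x)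
  zero_zero : v 0 0 = 0
  zero_half : v 0 (1 / 2) = 0
  zero_pos : ∀ x, 0 < x → x < 1 / 2 → 0 < v 0 x
  zero_neg : ∀ x, 1 / 2 < x → x < 1 → v 0 x < 0
  rotation : ∀ x, v (1 / ((i : ℝ) + 1)) x = θ
  rotation_neg : ∀ x, v (-(1 / ((i : ℝ) + 1))) x = θ
  section_nonneg : ∀ y, 0 ≤ v y 0
  section_pos : 0 < v (1 / (i : ℝ)) 0

/-- The profile `A sin(2πx)/2π - sin(4πx)/8π` of the fiber perturbations. For `A = 1` it increases
on more than half of the circle, namely where `cos(2πx) ≥ -1/3`; for `A = -1` it increases where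
`cos(2πx) ≤ 1/3`. -/
noncomputable def profile (A x : ℝ) : ℝ :=
  A * (Real.sin (2 * Real.pi * x) / (2 * Real.pi)) - Real.sin (4 * Real.pi * x) / (8 * Real.pi)

/-- The quadratic polynomial with value `1` at `1` and `-1` at `κ₁`, `κ₂`. -/
noncomputable def amplitude (κ₁ κ₂ e : ℝ) : ℝ :=
  2 / ((1 - κ₁) * (1 - κ₂)) * ((e - κ₁) * (e - κ₂)) - 1

/-- The forcing field used for the example. The factor `(cos(2πy) - κ)²` makes it constant over
the two points where `cos(2πy) = κ`; the amplitude `1` over `0` and `-1` over the points where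
`cos(2πy)` is `κ₁` or `κ₂` makes the regions of expansion cover the circle. -/
noncomputable def forcing (κ κ₁ κ₂ : ℝ) (y x : ℝ) : ℝ :=
  (Real.cos (2 * Real.pi * y) - κ) ^ 2 * profile (amplitude κ₁ κ₂ (Real.cos (2 * Real.pi * y))) x
    + (1 - Real.cos (2 * Real.pi * y))

lemma hasDerivAt_profile (A x : ℝ) :
    HasDerivAt (profile A) (A * Real.cos (2 * Real.pi * x)
      + 1 / 2 - Real.cos (2 * Real.pi * x) ^ 2) x := by
  have hpi := Real.pi_ne_zero
  have h1 : HasDerivAt (fun x : ℝ => 2 * Real.pi * x) (2 * Real.pi) x := by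
    simpa using (hasDerivAt_id x).const_mul (2 * Real.pi)
  have h2 : HasDerivAt (fun x : ℝ => 4 * Real.pi * x) (4 * Real.pi) x := by
    simpa using (hasDerivAt_id x).const_mul (4 * Real.pi)
  have h := ((h1.sin.div_const (2 * Real.pi)).const_mul A).sub (h2.sin.div_const (8 * Real.pi))
  refine h.congr_deriv ?_
  have hc : Real.cos (4 * Real.pi * x) = 2 * Real.cos (2 * Real.pi * x) ^ 2 - 1 := by
    rw [← Real.cos_two_mul]; ring_nf
  rw [hc]
  field_simp
  ring

lemma profile_eq (A x : ℝ) : profile A x = Real.sin (2 * Real.pi * x) / (2 * Real.pi) *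
    (A - Real.cos (2 * Real.pi * x) / 2) := by
  have hpi := Real.pi_ne_zero
  have hs : Real.sin (4 * Real.pi * x) =
      2 * Real.sin (2 * Real.pi * x) * Real.cos (2 * Real.pi * x) := by
    rw [← Real.sin_two_mul]; ring_nf
  unfold profile
  rw [hs]
  field_simp
  ring

lemma profile_sub_ge {A m x₀ r : ℝ} (h : ∀ x, |x - x₀| ≤ r →
      m ≤ A * Real.cos (2 * Real.pi * x) + 1 / 2 - Real.cos (2 * Real.pi * x) ^ 2)
    {x x' : ℝ} (hx : |x - x₀| ≤ r) (hx' : |x' - x₀| ≤ r) (hxx : x ≤ x') :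
    m * (x' - x) ≤ profile A x' - profile A x := by
  have hc : Continuous (profile A) :=
    continuous_iff_continuousAt.2 fun x => (hasDerivAt_profile A x).continuousAt
  refine (convex_Icc x x').mul_sub_le_image_sub_of_le_deriv hc.continuousOn
    (fun z _ => (hasDerivAt_profile A z).differentiableAt.differentiableWithinAt) ?_
    x ⟨le_rfl, hxx⟩ x' ⟨hxx, le_rfl⟩ hxx
  intro z hz
  rw [interior_Icc] at hz
  rw [(hasDerivAt_profile A z).deriv]
  apply h
  rw [abs_le] at *
  constructor <;> linarith [hz.1, hz.2]

lemma profile_sub_le {A m x₀ r : ℝ} (h : ∀ x, |x - x₀| ≤ r →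
      A * Real.cos (2 * Real.pi * x) + 1 / 2 - Real.cos (2 * Real.pi * x) ^ 2 ≤ m)
    {x x' : ℝ} (hx : |x - x₀| ≤ r) (hx' : |x' - x₀| ≤ r) (hxx : x ≤ x') :
    profile A x' - profile A x ≤ m * (x' - x) := by
  have hc : Continuous (profile A) :=
    continuous_iff_continuousAt.2 fun x => (hasDerivAt_profile A x).continuousAt
  refine (convex_Icc x x').image_sub_le_mul_sub_of_deriv_le hc.continuousOn
    (fun z _ => (hasDerivAt_profile A z).differentiableAt.differentiableWithinAt) ?_
    x ⟨le_rfl, hxx⟩ x' ⟨hxx, le_rfl⟩ hxx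
  intro z hz
  rw [interior_Icc] at hz
  rw [(hasDerivAt_profile A z).deriv]
  apply h
  rw [abs_le] at *
  constructor <;> linarith [hz.1, hz.2]

lemma abs_cos_two_pi_sub_le {x x₀ : ℝ} (h : |x - x₀| ≤ 1 / 40) :
    |Real.cos (2 * Real.pi * x) - Real.cos (2 * Real.pi * x₀)| ≤ 1 / 6 := by
  refine (Real.abs_cos_sub_cos_le _ _).trans ?_
  rw [← mul_sub, abs_mul, abs_of_pos (by positivity)]
  have := Real.pi_lt_d2
  have := Real.pi_pos
  nlinarith [abs_nonneg (x - x₀)]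

lemma profile_expand_of_cos_nonneg {x₀ : ℝ} (h0 : 0 ≤ Real.cos (2 * Real.pi * x₀)) {x x' : ℝ}
    (hx : |x - x₀| ≤ 1 / 40) (hx' : |x' - x₀| ≤ 1 / 40) (hxx : x ≤ x') :
    1 / 4 * (x' - x) ≤ profile 1 x' - profile 1 x := by
  refine profile_sub_ge (x₀ := x₀) (r := 1 / 40) ?_ hx hx' hxx
  intro z hz
  have h1 := abs_le.1 (abs_cos_two_pi_sub_le hz)
  have h2 := Real.cos_le_one (2 * Real.pi * z)
  nlinarith [h1.1]

lemma profile_expand_of_cos_nonpos {x₀ : ℝ} (h0 : Real.cos (2 * Real.pi * x₀) ≤ 0) {x x' : ℝ}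
    (hx : |x - x₀| ≤ 1 / 40) (hx' : |x' - x₀| ≤ 1 / 40) (hxx : x ≤ x') :
    1 / 4 * (x' - x) ≤ profile (-1) x' - profile (-1) x := by
  refine profile_sub_ge (x₀ := x₀) (r := 1 / 40) ?_ hx hx' hxx
  intro z hz
  have h1 := abs_le.1 (abs_cos_two_pi_sub_le hz)
  have h2 := Real.neg_one_le_cos (2 * Real.pi * z)
  nlinarith [h1.1]

lemma profile_contract_half {x x' : ℝ} (hx : |x - 1 / 2| ≤ 1 / 40) (hx' : |x' - 1 / 2| ≤ 1 / 40)
    (hxx : x ≤ x') : profile 1 x' - profile 1 x ≤ -(1 / 4) * (x' - x) := by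
  refine profile_sub_le (x₀ := 1 / 2) (r := 1 / 40) ?_ hx hx' hxx
  intro z hz
  have h1 := abs_le.1 (abs_cos_two_pi_sub_le hz)
  have h3 : Real.cos (2 * Real.pi * (1 / 2)) = -1 := by
    rw [show 2 * Real.pi * (1 / 2) = Real.pi by ring, Real.cos_pi]
  have h2 := Real.neg_one_le_cos (2 * Real.pi * z)
  rw [h3] at h1
  nlinarith [h1.1]

/-- A smooth function of period `1` is bounded and Lipschitz. -/
lemma exists_bound_lipschitz_of_periodic {w : ℝ → ℝ} (hw : ContDiff ℝ ∞ w)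
    (hp : Function.Periodic w 1) :
    ∃ K : ℝ, 0 ≤ K ∧ (∀ x, |w x| ≤ K) ∧ ∀ x x', |w x - w x'| ≤ K * |x - x'| := by
  obtain ⟨K₁, hK₁⟩ := (hp.isBounded_of_continuous one_ne_zero hw.continuous).exists_norm_le
  have hd : Function.Periodic (deriv w) 1 := by
    intro x
    rw [← deriv_comp_add_const]
    congr 1
    ext y
    exact hp y
  have hdc : Continuous (deriv w) := hw.continuous_deriv (by simp)
  obtain ⟨K₂, hK₂⟩ := (hd.isBounded_of_continuous one_ne_zero hdc).exists_norm_le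
  refine ⟨max (max K₁ K₂) 0, le_max_right _ _, fun x => ?_, fun x x' => ?_⟩
  · exact (hK₁ _ ⟨x, rfl⟩).trans ((le_max_left _ _).trans (le_max_left _ _))
  · have hdiff : Differentiable ℝ w := hw.differentiable (by simp)
    have := convex_univ.norm_image_sub_le_of_norm_deriv_le (f := w) (C := max (max K₁ K₂) 0)
      (fun z _ => hdiff z)
      (fun z _ => (hK₂ _ ⟨z, rfl⟩).trans ((le_max_right _ _).trans (le_max_left _ _)))
      (Set.mem_univ x') (Set.mem_univ x)
    simpa using this

/-- Sums of products of smooth periodic functions of one variable satisfy all the uniform bounds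
required of a forcing field. -/
lemma exists_bounds_of_sum_mul {w s : Fin 3 → ℝ → ℝ} (hw : ∀ j, ContDiff ℝ ∞ (w j))
    (hs : ∀ j, ContDiff ℝ ∞ (s j)) (hwp : ∀ j, Function.Periodic (w j) 1)
    (hsp : ∀ j, Function.Periodic (s j) 1) {v : ℝ → ℝ → ℝ}
    (hv : ∀ y x, v y x = ∑ j, w j y * s j x) :
    ∃ L : ℝ, 0 < L ∧ (∀ y x, |v y x| ≤ L) ∧ (∀ y y' x, |v y x - v y' x| ≤ L * |y - y'|) ∧
      (∀ y x x', |v y x - v y x'| ≤ L * |x - x'|) ∧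
      ∀ y y' x x', |(v y x - v y x') - (v y' x - v y' x')| ≤ L * |y - y'| * |x - x'| := by
  choose A hA0 hA hA' using fun j => exists_bound_lipschitz_of_periodic (hw j) (hwp j)
  choose B hB0 hB hB' using fun j => exists_bound_lipschitz_of_periodic (hs j) (hsp j)
  have hsum : 0 ≤ ∑ j, A j * B j := Finset.sum_nonneg fun j _ => mul_nonneg (hA0 j) (hB0 j)
  refine ⟨∑ j, A j * B j + 1, by linarith, fun y x => ?_, fun y y' x => ?_, fun y x x' => ?_,
    fun y y' x x' => ?_⟩
  · rw [hv]
    refine (Finset.abs_sum_le_sum_abs _ _).trans ?_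
    refine le_trans (Finset.sum_le_sum fun j _ => ?_) (le_add_of_nonneg_right zero_le_one)
    rw [abs_mul]
    exact mul_le_mul (hA j y) (hB j x) (abs_nonneg _) (hA0 j)
  · rw [hv, hv, ← Finset.sum_sub_distrib]
    refine (Finset.abs_sum_le_sum_abs _ _).trans ?_
    refine le_trans (Finset.sum_le_sum (g := fun j => A j * B j * |y - y'|) fun j _ => ?_) ?_
    · rw [← sub_mul, abs_mul]
      calc _ ≤ (A j * |y - y'|) * B j := mul_le_mul (hA' j y y') (hB j x) (abs_nonneg _)
            (mul_nonneg (hA0 j) (abs_nonneg _))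
        _ = _ := by ring
    · rw [← Finset.sum_mul]
      exact mul_le_mul_of_nonneg_right (by linarith) (abs_nonneg _)
  · rw [hv, hv, ← Finset.sum_sub_distrib]
    refine (Finset.abs_sum_le_sum_abs _ _).trans ?_
    refine le_trans (Finset.sum_le_sum (g := fun j => A j * B j * |x - x'|) fun j _ => ?_) ?_
    · rw [← mul_sub, abs_mul]
      calc _ ≤ A j * (B j * |x - x'|) := mul_le_mul (hA j y) (hB' j x x') (abs_nonneg _)
            (hA0 j)
        _ = _ := by ring
    · rw [← Finset.sum_mul]
      exact mul_le_mul_of_nonneg_right (by linarith) (abs_nonneg _)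
  · rw [hv, hv, hv, hv, ← Finset.sum_sub_distrib, ← Finset.sum_sub_distrib,
      ← Finset.sum_sub_distrib]
    refine (Finset.abs_sum_le_sum_abs _ _).trans ?_
    refine le_trans (Finset.sum_le_sum (g := fun j => A j * B j * (|y - y'| * |x - x'|))
      fun j _ => ?_) ?_
    · rw [show w j y * s j x - w j y * s j x' - (w j y' * s j x - w j y' * s j x') =
        (w j y - w j y') * (s j x - s j x') by ring, abs_mul]
      calc _ ≤ (A j * |y - y'|) * (B j * |x - x'|) := mul_le_mul (hA' j y y') (hB' j x x')
            (abs_nonneg _) (mul_nonneg (hA0 j) (abs_nonneg _))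
        _ = _ := by ring
    · rw [← Finset.sum_mul, mul_assoc]
      exact mul_le_mul_of_nonneg_right (by linarith) (by positivity)

lemma forcing_of_cos_eq {κ κ₁ κ₂ y : ℝ} (h : Real.cos (2 * Real.pi * y) = κ) (x : ℝ) :
    forcing κ κ₁ κ₂ y x = 1 - κ := by
  simp [forcing, h]

lemma cos_two_pi_mul_add_int (y : ℝ) (n : ℤ) :
    Real.cos (2 * Real.pi * (y + n)) = Real.cos (2 * Real.pi * y) := by
  rw [mul_add, mul_comm (2 * Real.pi) (n : ℝ), Real.cos_add_int_mul_two_pi]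

/-- The point `1/(i²+1)` has period four under `y ↦ i y`, and the orbit is symmetric under
`y ↦ -y`. -/
lemma cos_orbit_mem (i : ℤ) (k : ℕ) :
    Real.cos (2 * Real.pi * ((i : ℝ) ^ k * (1 / ((i : ℝ) ^ 2 + 1)))) =
        Real.cos (2 * Real.pi * (1 / ((i : ℝ) ^ 2 + 1))) ∨
      Real.cos (2 * Real.pi * ((i : ℝ) ^ k * (1 / ((i : ℝ) ^ 2 + 1)))) =
        Real.cos (2 * Real.pi * ((i : ℝ) * (1 / ((i : ℝ) ^ 2 + 1)))) := by
  induction k using Nat.twoStepInduction with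
  | zero => left; simp
  | one => right; simp
  | more k ih _ =>
    have h0 : (i : ℝ) ^ 2 + 1 ≠ 0 := by positivity
    have : (i : ℝ) ^ (k + 2) * (1 / ((i : ℝ) ^ 2 + 1)) =
        -((i : ℝ) ^ k * (1 / ((i : ℝ) ^ 2 + 1))) + ((i ^ k : ℤ) : ℝ) := by
      push_cast
      field_simp
      ring
    rw [this, cos_two_pi_mul_add_int, mul_neg, Real.cos_neg]
    exact ih

lemma exists_forcingField {i : ℤ} (hi : 1 < i) :
    ∃ (v : ℝ → ℝ → ℝ) (L c θ : ℝ), ForcingField i v L c θ := by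
  have hpi := Real.pi_pos
  have hi' : (2 : ℝ) ≤ i := by exact_mod_cast hi
  -- `κ` is the cosine over the orbit of the rotations, `κ₁` and `κ₂` are the cosines over the second
  -- orbit of expansion
  set o : ℝ := 1 / ((i : ℝ) ^ 2 + 1) with ho
  set κ := Real.cos (2 * Real.pi * (1 / ((i : ℝ) + 1))) with hκ
  set κ₁ := Real.cos (2 * Real.pi * o) with hκ₁
  set κ₂ := Real.cos (2 * Real.pi * (i * o)) with hκ₂
  have ho0 : 0 < o := by positivity
  have hio : i * o ≤ 1 / 2 := by
    rw [ho, mul_one_div, div_le_iff₀ (by positivity)]; nlinarith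
  have hoio : o ≤ 1 / 2 := by nlinarith
  have hη : 1 / ((i : ℝ) + 1) ≤ 1 / 2 := by
    rw [div_le_iff₀ (by positivity)]; linarith
  have hη0 : 0 < 1 / ((i : ℝ) + 1) := by positivity
  have hinj : ∀ {a b : ℝ}, 0 ≤ a → a ≤ 1 / 2 → 0 ≤ b → b ≤ 1 / 2 → a ≠ b →
      Real.cos (2 * Real.pi * a) ≠ Real.cos (2 * Real.pi * b) := by
    intro a b ha ha' hb hb' hab h
    have := Real.injOn_cos (show 2 * Real.pi * a ∈ Set.Icc 0 Real.pi from
      ⟨by positivity, by nlinarith⟩) (show 2 * Real.pi * b ∈ Set.Icc 0 Real.pi from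
      ⟨by positivity, by nlinarith⟩) h
    exact hab (mul_left_cancel₀ (by positivity) this)
  have hone : Real.cos (2 * Real.pi * 0) = 1 := by simp
  have hlt : ∀ {a : ℝ}, 0 < a → a ≤ 1 / 2 → Real.cos (2 * Real.pi * a) < 1 := by
    intro a ha ha'
    refine lt_of_le_of_ne (Real.cos_le_one _) ?_
    rw [← hone]
    exact hinj ha.le ha' le_rfl (by norm_num) ha.ne'
  have hκlt : κ < 1 := hlt hη0 hη
  have hκ₁lt : κ₁ < 1 := hlt ho0 hoio
  have hκ₂lt : κ₂ < 1 := hlt (by positivity) hio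
  have hκ₁ne : κ₁ ≠ κ := by
    refine hinj ho0.le hoio hη0.le hη ?_
    rw [ho, Ne, div_eq_div_iff (by positivity) (by positivity)]
    nlinarith
  have hκ₂ne : κ₂ ≠ κ := by
    refine hinj (by positivity) hio hη0.le hη ?_
    rw [ho, Ne, mul_one_div, div_eq_div_iff (by positivity) (by positivity)]
    nlinarith
  have ham0 : amplitude κ₁ κ₂ 1 = 1 := by
    have : (1 - κ₁) * (1 - κ₂) ≠ 0 := mul_ne_zero (by linarith) (by linarith)
    unfold amplitude; rw [div_mul_cancel₀ _ this]; norm_num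
  have ham1 : amplitude κ₁ κ₂ κ₁ = -1 := by simp [amplitude]
  have ham2 : amplitude κ₁ κ₂ κ₂ = -1 := by simp [amplitude]
  set b := min (min ((1 - κ) ^ 2) ((κ₁ - κ) ^ 2)) ((κ₂ - κ) ^ 2) with hb
  have hb0 : 0 < b := by
    have h1 : 1 - κ ≠ 0 := by linarith
    have h2 : κ₁ - κ ≠ 0 := sub_ne_zero.2 hκ₁ne
    have h3 : κ₂ - κ ≠ 0 := sub_ne_zero.2 hκ₂ne
    exact lt_min (lt_min (by positivity) (by positivity)) (by positivity)
  have hb1 : b ≤ (1 - κ) ^ 2 := (min_le_left _ _).trans (min_le_left _ _)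
  have hb2 : b ≤ (κ₁ - κ) ^ 2 := (min_le_left _ _).trans (min_le_right _ _)
  have hb3 : b ≤ (κ₂ - κ) ^ 2 := min_le_right _ _
  have hcper : ∀ y : ℝ, Real.cos (2 * Real.pi * (y + 1)) = Real.cos (2 * Real.pi * y) := by
    intro y; simpa using cos_two_pi_mul_add_int y 1
  have hsper : ∀ y : ℝ, Real.sin (2 * Real.pi * (y + 1)) = Real.sin (2 * Real.pi * y) := by
    intro y; rw [mul_add, mul_one, Real.sin_add_two_pi]
  have hpper : ∀ A x : ℝ, profile A (x + 1) = profile A x := by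
    intro A x; rw [profile_eq, profile_eq, hsper, hcper]
  obtain ⟨L, hL, hL1, hL2, hL3, hL4⟩ := exists_bounds_of_sum_mul (v := forcing κ κ₁ κ₂)
    (w := ![fun y => (Real.cos (2 * Real.pi * y) - κ) ^ 2 *
        amplitude κ₁ κ₂ (Real.cos (2 * Real.pi * y)),
      fun y => -(Real.cos (2 * Real.pi * y) - κ) ^ 2, fun y => 1 - Real.cos (2 * Real.pi * y)])
    (s := ![fun x => Real.sin (2 * Real.pi * x) / (2 * Real.pi),
      fun x => Real.sin (4 * Real.pi * x) / (8 * Real.pi), fun _ => 1])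
    (by
      intro j
      fin_cases j
      · simp only [amplitude]; simp; fun_prop
      · simp; fun_prop
      · simp; fun_prop)
    (by
      intro j
      fin_cases j
      · simp; fun_prop
      · simp; fun_prop
      · simp; fun_prop)
    (by
      intro j y
      fin_cases j
      · simp [hcper]
      · simp [hcper]
      · simp [hcper])
    (by
      intro j y
      fin_cases j
      · simp [hsper]
      · simp only [Fin.mk_one, Matrix.cons_val_one, Matrix.cons_val_zero]
        rw [show 4 * Real.pi * (y + 1) = 4 * Real.pi * y + (2 : ℕ) * (2 * Real.pi) by
          push_cast; ring, Real.sin_add_nat_mul_two_pi]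
      · simp)
    (by
      intro y x
      simp [Fin.sum_univ_three, forcing, profile]
      ring)
  have hv0 : ∀ x, forcing κ κ₁ κ₂ 0 x = (1 - κ) ^ 2 * profile 1 x := by
    intro x; simp [forcing, ham0]
  have hexp : ∀ {e A x x' : ℝ}, b ≤ e → x ≤ x' →
      1 / 4 * (x' - x) ≤ profile A x' - profile A x →
      b / 4 * (x' - x) ≤ e * profile A x' - e * profile A x := by
    intro e A x x' he hxx h
    have h1 : 0 ≤ 1 / 4 * (x' - x) := by linarith
    nlinarith [mul_le_mul he h h1 (hb0.le.trans he)]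
  have hprof : ∀ x, profile 1 x = Real.sin (2 * Real.pi * x) / (2 * Real.pi) *
      (1 - Real.cos (2 * Real.pi * x) / 2) := profile_eq 1
  have hfac : ∀ x, 0 < 1 - Real.cos (2 * Real.pi * x) / 2 := by
    intro x; linarith [Real.cos_le_one (2 * Real.pi * x)]
  have hsq : 0 < (1 - κ) ^ 2 := by nlinarith
  refine ⟨forcing κ κ₁ κ₂, L, b / 4, 1 - κ,
    { two_le := hi
      L_pos := hL
      c_pos := by positivity
      θ_pos := by linarith
      smooth := ?_
      per_left := ?_
      per_right := ?_
      bound := hL1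
      lip_left := hL2
      lip_right := hL3
      mixed := hL4
      expand := ?_
      expand_zero := ?_
      contract_half := ?_
      zero_zero := ?_
      zero_half := ?_
      zero_pos := ?_
      zero_neg := ?_
      rotation := fun x => forcing_of_cos_eq hκ.symm x
      rotation_neg := fun x => forcing_of_cos_eq (by rw [mul_neg, Real.cos_neg]) x
      section_nonneg := ?_
      section_pos := ?_ }⟩
  · unfold forcing profile amplitude
    fun_prop
  · intro y x; simp only [forcing, hcper]
  · intro y x; simp only [forcing, hpper]
  · intro x₀
    rcases le_total 0 (Real.cos (2 * Real.pi * x₀)) with h | h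
    · refine ⟨0, fun k x x' hx hx' hxx => ?_⟩
      rw [mul_zero, hv0, hv0]
      exact hexp hb1 hxx (profile_expand_of_cos_nonneg h hx hx' hxx)
    · refine ⟨o, fun k x x' hx hx' hxx => ?_⟩
      have h2 := profile_expand_of_cos_nonpos h hx hx' hxx
      have hmem := cos_orbit_mem i k
      rw [← ho, ← hκ₁, ← hκ₂] at hmem
      rcases hmem with hk | hk
      · simp only [forcing, hk, ham1, add_sub_add_right_eq_sub]
        exact hexp hb2 hxx h2
      · simp only [forcing, hk, ham2, add_sub_add_right_eq_sub]
        exact hexp hb3 hxx h2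
  · intro x x' hx hx' hxx
    rw [hv0, hv0]
    exact hexp hb1 hxx (profile_expand_of_cos_nonneg (x₀ := 0) (by simp) (by simpa using hx)
      (by simpa using hx') hxx)
  · intro x x' hx hx' hxx
    rw [hv0, hv0]
    have h1 := profile_contract_half hx hx' hxx
    nlinarith
  · rw [hv0, hprof]; simp
  · rw [hv0, hprof, show 2 * Real.pi * (1 / 2) = Real.pi by ring]; simp
  · intro x hx hx'
    rw [hv0, hprof]
    have : 0 < Real.sin (2 * Real.pi * x) :=
      Real.sin_pos_of_pos_of_lt_pi (by positivity) (by nlinarith)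
    have := hfac x
    positivity
  · intro x hx hx'
    rw [hv0, hprof]
    have h1 : Real.sin (2 * Real.pi * x) < 0 := by
      rw [← Real.sin_sub_two_pi]
      exact Real.sin_neg_of_neg_of_neg_pi_lt (by nlinarith) (by nlinarith)
    have h2 := hfac x
    have h3 : Real.sin (2 * Real.pi * x) / (2 * Real.pi) < 0 :=
      div_neg_of_neg_of_pos h1 (by positivity)
    exact mul_neg_of_pos_of_neg hsq (mul_neg_of_neg_of_pos h3 h2)
  · intro y
    simp only [forcing, profile_eq]
    simp [Real.cos_le_one]
  · simp only [forcing, profile_eq]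
    have : Real.cos (2 * Real.pi * (1 / (i : ℝ))) < 1 :=
      hlt (by positivity) (by rw [div_le_div_iff₀ (by positivity) (by norm_num)]; linarith)
    simp only [mul_zero, Real.sin_zero, zero_div, zero_mul, zero_add]
    linarith

/-! ### Skew products of the plane near the model -/

/-- The skew product `(y, x) ↦ (g y, f y x)` of the plane. -/
def skew (g : ℝ → ℝ) (f : ℝ → ℝ → ℝ) (w : ℝ × ℝ) : ℝ × ℝ := (g w.1, f w.1 w.2)

/-- The second coordinate of the `n`-th image of `(y, x)` under `skew g f`. -/
def fiberOrbit (g : ℝ → ℝ) (f : ℝ → ℝ → ℝ) (n : ℕ) (y x : ℝ) : ℝ := ((skew g f)^[n] (y, x)).2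

section fiberOrbit

variable (g : ℝ → ℝ) (f : ℝ → ℝ → ℝ)

lemma skew_iterate (n : ℕ) (y x : ℝ) :
    (skew g f)^[n] (y, x) = (g^[n] y, fiberOrbit g f n y x) := by
  refine Prod.ext ?_ rfl
  induction n with
  | zero => rfl
  | succ n ih =>
    rw [Function.iterate_succ_apply']
    exact (congrArg g ih).trans (Function.iterate_succ_apply' g n y).symm

@[simp] lemma fiberOrbit_zero (y x : ℝ) : fiberOrbit g f 0 y x = x := rfl

lemma fiberOrbit_succ (n : ℕ) (y x : ℝ) :
    fiberOrbit g f (n + 1) y x = f (g^[n] y) (fiberOrbit g f n y x) := by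
  rw [fiberOrbit, Function.iterate_succ_apply', skew_iterate]; rfl

lemma fiberOrbit_add (m n : ℕ) (y x : ℝ) :
    fiberOrbit g f (m + n) y x = fiberOrbit g f m (g^[n] y) (fiberOrbit g f n y x) := by
  rw [fiberOrbit, Function.iterate_add_apply, skew_iterate _ _ n]; rfl

end fiberOrbit

/-- The skew product `skew g f` differs from the model `(y, x) ↦ (i y, x + ε v(y, x))` by a
function of size at most `δ` which is `δ`-Lipschitz in each variable, for small `ε` and `δ`. -/
structure NearModel (i : ℤ) (v : ℝ → ℝ → ℝ) (L c θ ε δ : ℝ) (g : ℝ → ℝ) (f : ℝ → ℝ → ℝ) :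
    Prop where
  field : ForcingField i v L c θ
  ε_pos : 0 < ε
  ε_small : ε * L ≤ 1 / 1000
  δ_nonneg : 0 ≤ δ
  δ_small : δ ≤ 1 / 1000
  base_near : ∀ y, |g y - i * y| ≤ δ
  base_lip : ∀ y y', |(g y - i * y) - (g y' - i * y')| ≤ δ * |y - y'|
  fiber_near : ∀ y x, |f y x - (x + ε * v y x)| ≤ δ
  fiber_lip_left : ∀ y y' x,
    |(f y x - (x + ε * v y x)) - (f y' x - (x + ε * v y' x))| ≤ δ * |y - y'|
  fiber_lip_right : ∀ y x x',
    |(f y x - (x + ε * v y x)) - (f y x' - (x' + ε * v y x'))| ≤ δ * |x - x'|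

namespace ForcingField

variable {i : ℤ} {v : ℝ → ℝ → ℝ} {L c θ : ℝ} (h : ForcingField i v L c θ)
include h

lemma two_le_cast : (2 : ℝ) ≤ i := by exact_mod_cast h.two_le

lemma add_int_left (y x : ℝ) (m : ℤ) : v (y + m) x = v y x := by
  have : Function.Periodic (fun y => v y x) 1 := fun y => h.per_left y x
  simpa using this.int_mul m y

lemma add_int_right (y x : ℝ) (m : ℤ) : v y (x + m) = v y x := by
  have : Function.Periodic (fun x => v y x) 1 := fun x => h.per_right y x
  simpa using this.int_mul m x

end ForcingField

lemma one_add_mul_mul_one_sub_le {a k r R : ℝ} (ha : 0 ≤ a) (hk : 0 ≤ k) (hR : 2 * r ≤ R) :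
    (1 + (k + 1) * a) * (1 - R) ≤ (1 + a) * (1 - r) * ((1 + k * a) * (1 - r)) := by
  have h1 : 1 - R ≤ (1 - r) * (1 - r) := by nlinarith [sq_nonneg r]
  have h2 : 1 + (k + 1) * a ≤ (1 + a) * (1 + k * a) := by
    linarith [mul_nonneg (mul_nonneg ha ha) hk]
  calc _ ≤ (1 + (k + 1) * a) * ((1 - r) * (1 - r)) :=
        mul_le_mul_of_nonneg_left h1 (by positivity)
    _ ≤ (1 + a) * (1 + k * a) * ((1 - r) * (1 - r)) :=
        mul_le_mul_of_nonneg_right h2 (mul_self_nonneg _)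
    _ = _ := by ring

namespace NearModel

variable {i : ℤ} {v : ℝ → ℝ → ℝ} {L c θ ε δ : ℝ} {g : ℝ → ℝ} {f : ℝ → ℝ → ℝ}

lemma model (hv : ForcingField i v L c θ) (hε : 0 < ε) (hεL : ε * L ≤ 1 / 1000) :
    NearModel i v L c θ ε 0 (fun y => i * y) (fun y x => x + ε * v y x) where
  field := hv
  ε_pos := hε
  ε_small := hεL
  δ_nonneg := le_rfl
  δ_small := by norm_num
  base_near := by simp
  base_lip := by simp
  fiber_near := by simp
  fiber_lip_left := by simp
  fiber_lip_right := by simp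

variable (h : NearModel i v L c θ ε δ g f)
include h

lemma εL_pos : 0 < ε * L := mul_pos h.ε_pos h.field.L_pos

lemma base_lower {y y' : ℝ} (hy : y ≤ y') : (i - δ) * (y' - y) ≤ g y' - g y := by
  have := abs_le.1 (h.base_lip y' y)
  rw [abs_of_nonneg (sub_nonneg.2 hy)] at this
  linarith [this.1]

lemma base_upper {y y' : ℝ} (hy : y ≤ y') : g y' - g y ≤ (i + δ) * (y' - y) := by
  have := abs_le.1 (h.base_lip y' y)
  rw [abs_of_nonneg (sub_nonneg.2 hy)] at this
  linarith [this.2]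

lemma base_abs_lower (y y' : ℝ) : (i - δ) * |y' - y| ≤ |g y' - g y| := by
  rcases le_total y y' with hy | hy
  · rw [abs_of_nonneg (sub_nonneg.2 hy)]
    exact (h.base_lower hy).trans (le_abs_self _)
  · rw [abs_sub_comm, abs_sub_comm (g y'), abs_of_nonneg (sub_nonneg.2 hy)]
    exact (h.base_lower hy).trans (le_abs_self _)

lemma base_strictMono : StrictMono g := by
  intro y y' hy
  have h1 := h.base_lower hy.le
  have h2 := h.field.two_le_cast
  have h3 := h.δ_small
  nlinarith

lemma base_continuous : Continuous g := by
  have : LipschitzWith (i + δ).toNNReal g := by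
    refine LipschitzWith.of_le_add_mul _ fun y y' => ?_
    have h2 := h.field.two_le_cast
    have h3 := h.δ_nonneg
    rw [Real.coe_toNNReal _ (by linarith), Real.dist_eq]
    rcases le_total y' y with hy | hy
    · rw [abs_of_nonneg (sub_nonneg.2 hy)]
      linarith [h.base_upper hy]
    · have := h.base_strictMono.monotone hy
      have : 0 ≤ (i + δ) * |y - y'| := by positivity
      linarith
  exact this.continuous

lemma base_surjective : Function.Surjective g := by
  have h2 := h.field.two_le_cast
  have hb := fun y => abs_le.1 (h.base_near y)
  refine h.base_continuous.surjective ?_ ?_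
  · refine Filter.tendsto_atTop_mono' _ (f₁ := fun y => 2 * y - δ) ?_ ?_
    · filter_upwards [Filter.eventually_ge_atTop 0] with y hy
      nlinarith [(hb y).1]
    · exact Filter.tendsto_atTop_add_const_right _ _
        (Filter.tendsto_id.const_mul_atTop (by norm_num))
  · refine Filter.tendsto_atBot_mono' _ (f₁ := fun y => 2 * y + δ) ?_ ?_
    · filter_upwards [Filter.eventually_le_atBot 0] with y hy
      nlinarith [(hb y).2]
    · exact Filter.tendsto_atBot_add_const_right _ _
        (Filter.tendsto_id.const_mul_atBot (by norm_num))

/-- Increments of the fiber maps are bounded below by those of the forcing field. -/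
lemma fiber_lower_of {y x x' m : ℝ} (hx : x ≤ x') (hm : m * (x' - x) ≤ v y x' - v y x) :
    (1 + ε * m - δ) * (x' - x) ≤ f y x' - f y x := by
  have h1 := abs_le.1 (h.fiber_lip_right y x' x)
  rw [abs_of_nonneg (sub_nonneg.2 hx)] at h1
  have h2 := mul_le_mul_of_nonneg_left hm h.ε_pos.le
  nlinarith [h1.1]

lemma fiber_lower {y x x' : ℝ} (hx : x ≤ x') :
    (1 - ε * L - δ) * (x' - x) ≤ f y x' - f y x := by
  have h1 := abs_le.1 (h.field.lip_right y x' x)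
  rw [abs_of_nonneg (sub_nonneg.2 hx)] at h1
  have := h.fiber_lower_of (m := -L) hx (by linarith [h1.1])
  linarith

lemma fiber_upper {y x x' : ℝ} (hx : x ≤ x') :
    f y x' - f y x ≤ (1 + ε * L + δ) * (x' - x) := by
  have h1 := abs_le.1 (h.fiber_lip_right y x' x)
  have h2 := abs_le.1 (h.field.lip_right y x' x)
  rw [abs_of_nonneg (sub_nonneg.2 hx)] at h1 h2
  have h3 := mul_le_mul_of_nonneg_left h2.2 h.ε_pos.le
  nlinarith [h1.2]

lemma fiber_half_lower {y x x' : ℝ} (hx : x ≤ x') :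
    1 / 2 * (x' - x) ≤ f y x' - f y x := by
  have h1 := h.fiber_lower (y := y) hx
  have := h.ε_small
  have := h.δ_small
  nlinarith

lemma fiber_strictMono (y : ℝ) : StrictMono (f y) := by
  intro x x' hx
  have h1 := h.fiber_half_lower (y := y) hx.le
  linarith

lemma fiber_abs_upper (y x x' : ℝ) : |f y x - f y x'| ≤ (1 + ε * L + δ) * |x - x'| := by
  rcases le_total x x' with hx | hx
  · rw [abs_sub_comm, abs_sub_comm x, abs_of_nonneg (sub_nonneg.2 hx),
      abs_of_nonneg (sub_nonneg.2 ((h.fiber_strictMono y).monotone hx))]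
    exact h.fiber_upper hx
  · rw [abs_of_nonneg (sub_nonneg.2 hx),
      abs_of_nonneg (sub_nonneg.2 ((h.fiber_strictMono y).monotone hx))]
    exact h.fiber_upper hx

lemma fiber_abs_lower (y x x' : ℝ) : 1 / 2 * |x - x'| ≤ |f y x - f y x'| := by
  rcases le_total x x' with hx | hx
  · rw [abs_sub_comm, abs_sub_comm (f y x), abs_of_nonneg (sub_nonneg.2 hx)]
    exact (h.fiber_half_lower hx).trans (le_abs_self _)
  · rw [abs_of_nonneg (sub_nonneg.2 hx)]
    exact (h.fiber_half_lower hx).trans (le_abs_self _)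

lemma fiber_abs_left (y y' x : ℝ) : |f y x - f y' x| ≤ (ε * L + δ) * |y - y'| := by
  have h1 := abs_le.1 (h.fiber_lip_left y y' x)
  have h2 := abs_le.1 (h.field.lip_left y y' x)
  have h3 := mul_le_mul_of_nonneg_left h2.1 h.ε_pos.le
  have h4 := mul_le_mul_of_nonneg_left h2.2 h.ε_pos.le
  rw [abs_le]
  constructor <;> nlinarith [h1.1, h1.2]

lemma fiber_continuous (y : ℝ) : Continuous (f y) := by
  have : LipschitzWith (1 + ε * L + δ).toNNReal (f y) := by
    have h2 := h.εL_pos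
    have h3 := h.δ_nonneg
    refine LipschitzWith.of_dist_le_mul fun x x' => ?_
    rw [Real.coe_toNNReal _ (by linarith), Real.dist_eq, Real.dist_eq]
    exact h.fiber_abs_upper y x x'
  exact this.continuous

/-- A fiber map moves no point by more than `ε L + δ`. -/
lemma fiber_disp (y x : ℝ) : |f y x - x| ≤ ε * L + δ := by
  have h1 := abs_le.1 (h.fiber_near y x)
  have h2 := abs_le.1 (h.field.bound y x)
  have h3 := mul_le_mul_of_nonneg_left h2.1 h.ε_pos.le
  have h4 := mul_le_mul_of_nonneg_left h2.2 h.ε_pos.le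
  rw [abs_le]
  constructor <;> linarith [h1.1, h1.2]

lemma fiber_surjective (y : ℝ) : Function.Surjective (f y) := by
  have hb := fun x => abs_le.1 (h.fiber_disp y x)
  refine (h.fiber_continuous y).surjective ?_ ?_
  · refine Filter.tendsto_atTop_mono (f := fun x => x - (ε * L + δ)) ?_ ?_
    · intro x; linarith [(hb x).1]
    · exact Filter.tendsto_atTop_add_const_right _ _ Filter.tendsto_id
  · refine Filter.tendsto_atBot_mono (f := fun x => x + (ε * L + δ)) ?_ ?_
    · intro x; linarith [(hb x).2]
    · exact Filter.tendsto_atBot_add_const_right _ _ Filter.tendsto_id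

/-- The cone of directions of slope at most `1/100` is invariant. -/
lemma cone {y y' x x' : ℝ} (hx : |x - x'| ≤ 1 / 100 * |y - y'|) :
    |f y x - f y' x'| ≤ 1 / 100 * |g y - g y'| := by
  have h1 := h.fiber_abs_upper y x x'
  have h2 := h.fiber_abs_left y y' x'
  have h3 := h.base_abs_lower y' y
  have h4 := h.field.two_le_cast
  have h5 := h.ε_small
  have h6 := h.δ_small
  have h7 := h.εL_pos
  have h8 := h.δ_nonneg
  have h9 := abs_nonneg (y - y')
  calc |f y x - f y' x'| ≤ |f y x - f y x'| + |f y x' - f y' x'| := abs_sub_le _ _ _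
    _ ≤ (1 + ε * L + δ) * (1 / 100 * |y - y'|) + (ε * L + δ) * |y - y'| := by
      refine add_le_add (h1.trans ?_) h2
      exact mul_le_mul_of_nonneg_left hx (by linarith)
    _ ≤ 1 / 100 * ((i - δ) * |y - y'|) := by nlinarith
    _ ≤ _ := by linarith

lemma cone_iterate {y y' x x' : ℝ} (hx : |x - x'| ≤ 1 / 100 * |y - y'|) (n : ℕ) :
    |fiberOrbit g f n y x - fiberOrbit g f n y' x'| ≤ 1 / 100 * |g^[n] y - g^[n] y'| := by
  induction n with
  | zero => simpa using hx
  | succ n ih =>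
    rw [fiberOrbit_succ, fiberOrbit_succ, Function.iterate_succ_apply',
      Function.iterate_succ_apply']
    exact h.cone ih

lemma fiberOrbit_strictMono (n : ℕ) (y : ℝ) : StrictMono (fiberOrbit g f n y) := by
  induction n with
  | zero => exact strictMono_id
  | succ n ih =>
    intro x x' hx
    rw [fiberOrbit_succ, fiberOrbit_succ]
    exact h.fiber_strictMono _ (ih hx)

lemma fiberOrbit_continuous (n : ℕ) (y : ℝ) : Continuous (fiberOrbit g f n y) := by
  induction n with
  | zero => exact continuous_id
  | succ n ih =>
    simp only [funext (fiberOrbit_succ g f n y)]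
    exact (h.fiber_continuous _).comp ih

lemma fiberOrbit_half_lower (n : ℕ) {y x x' : ℝ} (hx : x ≤ x') :
    (1 / 2) ^ n * (x' - x) ≤ fiberOrbit g f n y x' - fiberOrbit g f n y x := by
  induction n with
  | zero => simp
  | succ n ih =>
    rw [fiberOrbit_succ, fiberOrbit_succ]
    have := h.fiber_half_lower (y := g^[n] y) ((h.fiberOrbit_strictMono n y).monotone hx)
    rw [pow_succ]
    nlinarith

lemma fiberOrbit_disp (n : ℕ) (y x : ℝ) :
    |fiberOrbit g f n y x - x| ≤ n * (ε * L + δ) := by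
  induction n with
  | zero => simp
  | succ n ih =>
    rw [fiberOrbit_succ]
    have h1 := h.fiber_disp (g^[n] y) (fiberOrbit g f n y x)
    have h2 := abs_sub_le (f (g^[n] y) (fiberOrbit g f n y x)) (fiberOrbit g f n y x) x
    push_cast
    linarith

lemma base_iterate_continuous (n : ℕ) : Continuous g^[n] := h.base_continuous.iterate n

lemma base_iterate_strictMono (n : ℕ) : StrictMono g^[n] := h.base_strictMono.iterate n

lemma base_iterate_near (k : ℕ) (y : ℝ) :
    |g^[k] y - (i : ℝ) ^ k * y| ≤ δ * ((i : ℝ) ^ k - 1) := by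
  have hi := h.field.two_le_cast
  induction k with
  | zero => simp
  | succ k ih =>
    rw [Function.iterate_succ_apply']
    have h1 := h.base_near (g^[k] y)
    have h2 : |i * g^[k] y - (i : ℝ) ^ (k + 1) * y| ≤ i * (δ * ((i : ℝ) ^ k - 1)) := by
      rw [pow_succ', mul_assoc, ← mul_sub, abs_mul, abs_of_nonneg (by linarith : (0 : ℝ) ≤ i)]
      exact mul_le_mul_of_nonneg_left ih (by linarith)
    have h3 := abs_sub_le (g (g^[k] y)) (i * g^[k] y) ((i : ℝ) ^ (k + 1) * y)
    have h4 : 0 ≤ δ * ((i : ℝ) - 2) := mul_nonneg h.δ_nonneg (by linarith)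
    have h5 : i * (δ * ((i : ℝ) ^ k - 1)) + δ = δ * ((i : ℝ) ^ (k + 1) - 1) - δ * (i - 2) := by
      ring
    linarith

/-! ### Growth of strips -/

/-- Along `N` steps close to an orbit over which the fiber maps expand near `x₀`, vertical segments
near `x₀` grow. The distance to that orbit is of order `i ^ (k - N)` at time `k`; since these
distances are summable, the loss of expansion is bounded, while the gain is of order `N`. -/
lemma fiberOrbit_grow {N : ℕ} (hN : 24 * L ≤ N * c) (hNε : N * (ε * L + δ) ≤ 1 / 200)
    (hδN : δ * (i : ℝ) ^ N ≤ 1) (hδc : δ ≤ ε * c / 2) {x₀ o : ℝ}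
    (ho : ∀ k : ℕ, ∀ x x', |x - x₀| ≤ 1 / 40 → |x' - x₀| ≤ 1 / 40 → x ≤ x' →
      c * (x' - x) ≤ v ((i : ℝ) ^ k * o) x' - v ((i : ℝ) ^ k * o) x)
    {y x x' : ℝ} (hy : (i : ℝ) ^ N * |y - o| ≤ 2) (hx : |x - x₀| ≤ 1 / 50)
    (hx' : |x' - x₀| ≤ 1 / 50) (hxx : x ≤ x') :
    (1 + ε * L) * (x' - x) ≤ fiberOrbit g f N y x' - fiberOrbit g f N y x := by
  have hi := h.field.two_le_cast
  have hi0 : (0 : ℝ) < i := by linarith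
  have hεL := h.εL_pos
  have hεL' := h.ε_small
  have hδ0 := h.δ_nonneg
  have hε := h.ε_pos
  have hL := h.field.L_pos
  have hc := h.field.c_pos
  set a := ε * c - δ with ha
  have ha0 : 0 ≤ a := by rw [ha]; nlinarith [mul_pos hε hc]
  set q : ℕ → ℝ := fun k => (i : ℝ) ^ k / (i : ℝ) ^ N with hq
  have hq0 : ∀ k, 0 ≤ q k := fun k => by positivity
  have hqs : ∀ k, q (k + 1) = i * q k := fun k => by simp only [hq, pow_succ']; ring
  have hq1 : ∀ k ≤ N, q k ≤ 1 := fun k hk => by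
    rw [hq, div_le_one (by positivity)]
    exact pow_le_pow_right₀ (by linarith) hk
  have hdist : ∀ k, |g^[k] y - (i : ℝ) ^ k * o| ≤ 3 * q k := by
    intro k
    have h1 := h.base_iterate_near k y
    have h2 : |(i : ℝ) ^ k * y - (i : ℝ) ^ k * o| ≤ 2 * q k := by
      rw [← mul_sub, abs_mul, abs_of_pos (by positivity : (0 : ℝ) < i ^ k)]
      have : |y - o| ≤ 2 / (i : ℝ) ^ N := by
        rw [le_div_iff₀ (by positivity)]; linarith
      calc _ ≤ (i : ℝ) ^ k * (2 / (i : ℝ) ^ N) :=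
            mul_le_mul_of_nonneg_left this (by positivity)
        _ = _ := by simp only [hq]; ring
    have h3 : δ * ((i : ℝ) ^ k - 1) ≤ q k := by
      have : δ * (i : ℝ) ^ k ≤ q k := by
        rw [hq, le_div_iff₀ (by positivity)]
        have : 0 < (i : ℝ) ^ k := by positivity
        nlinarith
      linarith
    have h4 := abs_sub_le (g^[k] y) ((i : ℝ) ^ k * y) ((i : ℝ) ^ k * o)
    linarith
  have hclose : ∀ k ≤ N, ∀ z, |z - x₀| ≤ 1 / 50 → |fiberOrbit g f k y z - x₀| ≤ 1 / 40 := by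
    intro k hk z hz
    have h1 := h.fiberOrbit_disp k y z
    have h2 : (k : ℝ) * (ε * L + δ) ≤ N * (ε * L + δ) :=
      mul_le_mul_of_nonneg_right (by exact_mod_cast hk) (by linarith)
    have h3 := abs_sub_le (fiberOrbit g f k y z) z x₀
    linarith
  -- gain `1 + k a`, accumulated loss `3 ε L i ^ (k - N)`
  have key : ∀ k ≤ N, (1 + k * a) * (1 - 3 * (ε * L) * q k) * (x' - x) ≤
      fiberOrbit g f k y x' - fiberOrbit g f k y x := by
    intro k
    induction k with
    | zero =>
      intro _
      have : 0 ≤ 3 * (ε * L) * q 0 := mul_nonneg (by linarith) (hq0 0)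
      simp only [Nat.cast_zero, fiberOrbit_zero]
      nlinarith
    | succ k ih =>
      intro hk
      have hk' : k ≤ N := by omega
      have hI := ih hk'
      set u := fiberOrbit g f k y x with hu
      set u' := fiberOrbit g f k y x' with hu'
      have huu : u ≤ u' := (h.fiberOrbit_strictMono k y).monotone hxx
      have h1 := ho k u u' (hclose k hk' x hx) (hclose k hk' x' hx') huu
      have h2 := abs_le.1 (h.field.mixed (g^[k] y) ((i : ℝ) ^ k * o) u' u)
      rw [abs_of_nonneg (sub_nonneg.2 huu)] at h2
      have h3 : L * |g^[k] y - (i : ℝ) ^ k * o| * (u' - u) ≤ L * (3 * q k) * (u' - u) :=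
        mul_le_mul_of_nonneg_right (mul_le_mul_of_nonneg_left (hdist k) hL.le)
          (sub_nonneg.2 huu)
      have h4 : (c - L * (3 * q k)) * (u' - u) ≤ v (g^[k] y) u' - v (g^[k] y) u := by
        linarith [h2.1]
      have h5 := h.fiber_lower_of huu h4
      rw [fiberOrbit_succ, fiberOrbit_succ]
      set r := 3 * (ε * L) * q k with hr
      have hr0 : 0 ≤ r := mul_nonneg (by linarith) (hq0 k)
      have hr1 : r ≤ 1 / 2 := by nlinarith [hq1 k hk']
      have h6 : (1 + a) * (1 - r) * (u' - u) ≤ f (g^[k] y) u' - f (g^[k] y) u := by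
        refine le_trans ?_ h5
        refine mul_le_mul_of_nonneg_right ?_ (sub_nonneg.2 huu)
        have : 1 + ε * (c - L * (3 * q k)) - δ = 1 + a - r := by rw [ha, hr]; ring
        rw [this]
        nlinarith [mul_nonneg ha0 hr0]
      refine le_trans ?_ h6
      refine le_trans ?_ (mul_le_mul_of_nonneg_left hI
        (mul_nonneg (by linarith) (by linarith) : 0 ≤ (1 + a) * (1 - r)))
      rw [← mul_assoc ((1 + a) * (1 - r))]
      refine mul_le_mul_of_nonneg_right ?_ (sub_nonneg.2 hxx)
      rw [Nat.cast_succ]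
      refine one_add_mul_mul_one_sub_le ha0 (Nat.cast_nonneg k) ?_
      rw [hqs, hr]
      have : 0 ≤ (ε * L) * q k * (i - 2) :=
        mul_nonneg (mul_nonneg hεL.le (hq0 k)) (by linarith)
      linarith
  refine le_trans ?_ (key N le_rfl)
  refine mul_le_mul_of_nonneg_right ?_ (sub_nonneg.2 hxx)
  have hqN : q N = 1 := div_self (by positivity)
  have hNa : 12 * (ε * L) ≤ N * a := by
    have h1 : ε * c / 2 ≤ a := by rw [ha]; linarith
    have h2 : (N : ℝ) * (ε * c / 2) ≤ N * a := mul_le_mul_of_nonneg_left h1 (by positivity)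
    have h3 : ε * (24 * L) ≤ ε * (N * c) := mul_le_mul_of_nonneg_left hN hε.le
    linarith
  rw [hqN, mul_one]
  nlinarith

/-- A strip around the image of a horizontal segment, at least two units long and of thickness at
most `1/100`, contains a part which after `N` more steps is again two units long and has become
thicker by the factor `1 + ε L`. -/
lemma strip_grow {N : ℕ} (hN : 24 * L ≤ N * c) (hNε : N * (ε * L + δ) ≤ 1 / 200)
    (hδN : δ * (i : ℝ) ^ N ≤ 1) (hiN : 4 ≤ (i : ℝ) ^ N) (hδc : δ ≤ ε * c / 2)
    {n : ℕ} {a b X X' τ : ℝ} (hab : a ≤ b) (hlen : 2 ≤ g^[n] b - g^[n] a)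
    (hτ0 : 0 ≤ τ) (hτ : τ ≤ 1 / 100)
    (hthick : ∀ y ∈ Set.Icc a b, τ ≤ fiberOrbit g f n y X' - fiberOrbit g f n y X) :
    ∃ a' b', a' ≤ b' ∧ 2 ≤ g^[N + n] b' - g^[N + n] a' ∧ Set.Icc a' b' ⊆ Set.Icc a b ∧
      ∀ y ∈ Set.Icc a' b',
        (1 + ε * L) * τ ≤ fiberOrbit g f (N + n) y X' - fiberOrbit g f (N + n) y X := by
  have hi := h.field.two_le_cast
  have hi0 : (0 : ℝ) < i := by linarith
  have hδ0 := h.δ_nonneg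
  set G := g^[n] with hG
  have hGc : Continuous G := h.base_iterate_continuous n
  have hGm : StrictMono G := h.base_iterate_strictMono n
  have hivt : ∀ z ∈ Set.Icc (G a) (G b), ∃ y ∈ Set.Icc a b, G y = z := fun z hz =>
    intermediate_value_Icc hab hGc.continuousOn hz
  obtain ⟨y₁, hy₁, hy₁'⟩ := hivt (G a + 1) ⟨by linarith, by linarith⟩
  set x₀ := fiberOrbit g f n y₁ X with hx₀
  obtain ⟨o, ho⟩ := h.field.expand x₀
  -- a translate of `o` in the middle part of the strip
  set m : ℤ := round (G a + 1 - o) with hm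
  set o' : ℝ := o + m with ho'
  have ho'1 : |G a + 1 - o'| ≤ 1 / 2 := by
    have := abs_sub_round (G a + 1 - o)
    rw [ho']
    rwa [show G a + 1 - (o + m) = G a + 1 - o - round (G a + 1 - o) by rw [hm]; ring]
  have ho'2 : ∀ k : ℕ, ∀ x x', |x - x₀| ≤ 1 / 40 → |x' - x₀| ≤ 1 / 40 → x ≤ x' →
      c * (x' - x) ≤ v ((i : ℝ) ^ k * o') x' - v ((i : ℝ) ^ k * o') x := by
    intro k x x' hx hx' hxx
    have : (i : ℝ) ^ k * o' = (i : ℝ) ^ k * o + ((i ^ k * m : ℤ) : ℝ) := by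
      rw [ho']; push_cast; ring
    rw [this, h.field.add_int_left, h.field.add_int_left]
    exact ho k x x' hx hx' hxx
  set w : ℝ := 2 / (i : ℝ) ^ N with hw
  have hw0 : 0 < w := by positivity
  have hwi : (i : ℝ) ^ N * w = 2 := by rw [hw]; field_simp
  have hw1 : w ≤ 1 / 2 := by rw [hw, div_le_iff₀ (by positivity)]; linarith
  have ho'3 := abs_le.1 ho'1
  obtain ⟨a', ha', hGa'⟩ := hivt (o' - w) ⟨by linarith, by linarith⟩
  obtain ⟨b', hb', hGb'⟩ := hivt (o' + w) ⟨by linarith, by linarith⟩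
  have hab' : a' ≤ b' := by
    rw [← hGm.le_iff_le, hGa', hGb']; linarith
  refine ⟨a', b', hab', ?_, Set.Icc_subset_Icc ha'.1 hb'.2, ?_⟩
  · rw [Function.iterate_add_apply, Function.iterate_add_apply]
    change 2 ≤ g^[N] (G b') - g^[N] (G a')
    rw [hGa', hGb']
    have h1 := abs_le.1 (h.base_iterate_near N (o' - w))
    have h2 := abs_le.1 (h.base_iterate_near N (o' + w))
    nlinarith [h1.2, h2.1]
  · intro y hy
    have hyab : y ∈ Set.Icc a b := Set.Icc_subset_Icc ha'.1 hb'.2 hy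
    have hGy : |G y - o'| ≤ w := by
      have h1 := hGm.monotone hy.1
      have h2 := hGm.monotone hy.2
      rw [abs_le]; constructor <;> linarith
    have hGy' : |G y - G y₁| ≤ 1 := by
      rw [hy₁']
      have h1 := abs_le.1 hGy
      rw [abs_le]; constructor <;> linarith
    have hcone := h.cone_iterate (y := y) (y' := y₁) (x := X) (x' := X) (by simp) n
    set u := fiberOrbit g f n y X with hu
    have hux : |u - x₀| ≤ 1 / 100 := hcone.trans (by linarith)
    have hgrow := h.fiberOrbit_grow hN hNε hδN hδc ho'2 (y := G y) (x := u) (x' := u + τ)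
      (by
        calc _ ≤ (i : ℝ) ^ N * w := mul_le_mul_of_nonneg_left hGy (by positivity)
          _ = 2 := hwi
          _ ≤ 2 := le_rfl)
      (by linarith)
      (by
        have h1 := abs_le.1 hux
        rw [abs_le]; constructor <;> linarith)
      (by linarith)
    rw [fiberOrbit_add, fiberOrbit_add]
    have hmono := (h.fiberOrbit_strictMono N (G y)).monotone
      (show u + τ ≤ fiberOrbit g f n y X' by linarith [hthick y hyab])
    rw [add_sub_cancel_left] at hgrow
    exact hgrow.trans (by linarith)

/-- Every nonempty open set has an image that contains a square of side `1/200`. -/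
theorem exists_ball_subset_image {N : ℕ} (hN : 24 * L ≤ N * c)
    (hNε : N * (ε * L + δ) ≤ 1 / 200) (hδN : δ * (i : ℝ) ^ N ≤ 1) (hiN : 4 ≤ (i : ℝ) ^ N)
    (hδc : δ ≤ ε * c / 2) {U : Set (ℝ × ℝ)} (hU : IsOpen U) (hne : U.Nonempty) :
    ∃ (n : ℕ) (q : ℝ × ℝ), Metric.ball q (1 / 400) ⊆ (skew g f)^[n] '' U := by
  have hi := h.field.two_le_cast
  have hδ0 := h.δ_nonneg
  have hδ1 := h.δ_small
  obtain ⟨⟨A, X₀⟩, hp⟩ := hne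
  obtain ⟨r, hr, hball⟩ := Metric.isOpen_iff.1 hU _ hp
  set X := X₀ - r / 2 with hX
  set X' := X₀ + r / 2 with hX'
  have hbox : ∀ y ∈ Set.Icc (A - r / 2) (A + r / 2), ∀ x ∈ Set.Icc X X', (y, x) ∈ U := by
    intro y hy x hx
    apply hball
    rw [Metric.mem_ball, Prod.dist_eq, max_lt_iff, Real.dist_eq, Real.dist_eq, abs_lt, abs_lt]
    simp only [Set.mem_Icc] at hy hx
    refine ⟨⟨?_, ?_⟩, ?_, ?_⟩ <;> simp only <;> linarith [hy.1, hy.2, hx.1, hx.2]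
  have hXX : X ≤ X' := by linarith
  -- the image of the box becomes long
  obtain ⟨n₀, hn₀⟩ : ∃ n₀, 2 ≤ g^[n₀] (A + r / 2) - g^[n₀] (A - r / 2) := by
    have hexp : ∀ n, (3 / 2 : ℝ) ^ n * r ≤ g^[n] (A + r / 2) - g^[n] (A - r / 2) := by
      intro n
      induction n with
      | zero => simp
      | succ n ih =>
        rw [Function.iterate_succ_apply', Function.iterate_succ_apply', pow_succ']
        have h1 := h.base_lower ((h.base_iterate_strictMono n).monotone
          (show A - r / 2 ≤ A + r / 2 by linarith))
        have h2 : 0 ≤ (3 / 2 : ℝ) ^ n * r := by positivity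
        nlinarith
    obtain ⟨n, hn⟩ := pow_unbounded_of_one_lt (2 / r) (show (1 : ℝ) < 3 / 2 by norm_num)
    refine ⟨n, le_trans ?_ (hexp n)⟩
    rw [div_lt_iff₀ hr] at hn
    exact hn.le
  -- then it becomes thick
  have hthick : ∀ m : ℕ, ∃ (n : ℕ) (a b : ℝ), a ≤ b ∧ 2 ≤ g^[n] b - g^[n] a ∧
      Set.Icc a b ⊆ Set.Icc (A - r / 2) (A + r / 2) ∧ ∀ y ∈ Set.Icc a b,
        min ((1 + ε * L) ^ m * ((1 / 2) ^ n₀ * r)) (1 / 100) ≤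
          fiberOrbit g f n y X' - fiberOrbit g f n y X := by
    intro m
    induction m with
    | zero =>
      refine ⟨n₀, A - r / 2, A + r / 2, by linarith, hn₀, subset_rfl, fun y _ => ?_⟩
      refine (min_le_left _ _).trans ?_
      have := h.fiberOrbit_half_lower n₀ (y := y) hXX
      rw [show X' - X = r by rw [hX, hX']; ring] at this
      simpa using this
    | succ m ih =>
      obtain ⟨n, a, b, hab, hlen, hsub, hth⟩ := ih
      have hτ0 : 0 ≤ min ((1 + ε * L) ^ m * ((1 / 2) ^ n₀ * r)) (1 / 100) := by
        have := h.εL_pos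
        positivity
      obtain ⟨a', b', hab', hlen', hsub', hth'⟩ := h.strip_grow hN hNε hδN hiN hδc hab hlen
        hτ0 (min_le_right _ _) hth
      refine ⟨N + n, a', b', hab', hlen', hsub'.trans hsub, fun y hy => le_trans ?_ (hth' y hy)⟩
      have h1 := h.εL_pos
      rw [mul_min_of_nonneg _ _ (by linarith)]
      refine min_le_min ?_ (by linarith)
      rw [pow_succ']
      linarith
  obtain ⟨m, hm⟩ := pow_unbounded_of_one_lt ((1 / 100) / ((1 / 2) ^ n₀ * r))
    (show 1 < 1 + ε * L by linarith [h.εL_pos])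
  obtain ⟨n, a, b, hab, hlen, hsub, hth⟩ := hthick m
  rw [div_lt_iff₀ (by positivity)] at hm
  rw [min_eq_right hm.le] at hth
  have hivt : ∀ z ∈ Set.Icc (g^[n] a) (g^[n] b), ∃ y ∈ Set.Icc a b, g^[n] y = z := fun z hz =>
    intermediate_value_Icc hab (h.base_iterate_continuous n).continuousOn hz
  obtain ⟨y₁, hy₁, hy₁'⟩ := hivt (g^[n] a + 1) ⟨by linarith, by linarith⟩
  refine ⟨n, (g^[n] y₁, fiberOrbit g f n y₁ X + 1 / 200), ?_⟩
  rintro ⟨z₁, z₂⟩ hz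
  rw [Metric.mem_ball, Prod.dist_eq, max_lt_iff, Real.dist_eq, Real.dist_eq] at hz
  simp only at hz
  have hz1 := abs_lt.1 hz.1
  have hz2 := abs_lt.1 hz.2
  obtain ⟨y, hy, rfl⟩ := hivt z₁ ⟨by linarith, by linarith⟩
  have hcone := abs_le.1 ((h.cone_iterate (y := y) (y' := y₁) (x := X) (x' := X) (by simp) n).trans
    (mul_le_mul_of_nonneg_left hz.1.le (by norm_num)))
  obtain ⟨x, hx, rfl⟩ := intermediate_value_Icc hXX (h.fiberOrbit_continuous n y).continuousOn
    (show z₂ ∈ Set.Icc (fiberOrbit g f n y X) (fiberOrbit g f n y X') from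
      ⟨by linarith, by linarith [hth y hy]⟩)
  exact ⟨(y, x), hbox y (hsub hy) x hx, skew_iterate g f n y x⟩

end NearModel

/-! ### Preimages and the projection to the torus -/

/-- If `β` is irrational and `ξ n + n β` converges, then `ξ` comes arbitrarily close to any given
number modulo `1`, infinitely often. -/
lemma frequently_near_int {β ζ : ℝ} (hβ : Irrational β) {ξ : ℕ → ℝ}
    (hξ : Tendsto (fun n => ξ n + n * β) atTop (𝓝 ζ)) (x₀ : ℝ) {τ : ℝ} (hτ : 0 < τ) :
    ∃ᶠ n in atTop, ∃ b : ℤ, |ξ n - (x₀ + b)| < τ := by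
  have hdense : DenseRange (fun n : ℤ => n • (β : UnitAddCircle)) := by
    rw [AddCircle.denseRange_zsmul_coe_iff]; simpa using hβ
  have hcl : MapClusterPt ((ζ - x₀ : ℝ) : UnitAddCircle) atTop
      (fun n : ℕ => n • (β : UnitAddCircle)) := by
    rw [mapClusterPt_atTop_nsmul_iff_mem_topologicalClosure_zmultiples]
    have := hdense ((ζ - x₀ : ℝ) : UnitAddCircle)
    rw [← SetLike.mem_coe, AddSubgroup.topologicalClosure_coe, AddSubgroup.coe_zmultiples]
    exact this
  have h1 := hcl.frequently (Metric.ball_mem_nhds _ (half_pos hτ))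
  have h2 : ∀ᶠ n in atTop, |ξ n + n * β - ζ| < τ / 2 := by
    have := hξ.eventually (Metric.ball_mem_nhds _ (half_pos hτ))
    simpa [Real.dist_eq] using this
  refine (h1.and_eventually h2).mono ?_
  rintro n ⟨hn1, hn2⟩
  rw [dist_eq_norm, ← AddCircle.coe_nsmul, ← AddCircle.coe_sub,
    UnitAddCircle.norm_eq, nsmul_eq_mul] at hn1
  refine ⟨-round ((n : ℝ) * β - (ζ - x₀)), ?_⟩
  set m := round ((n : ℝ) * β - (ζ - x₀))
  push_cast
  rw [abs_lt] at *
  constructor <;> linarith [hn1.1, hn1.2, hn2.1, hn2.2]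

/-- The projection of the plane onto the torus. -/
def torusMk (w : ℝ × ℝ) : UnitAddCircle × UnitAddCircle := (w.1, w.2)

lemma torusMk_surjective : Function.Surjective torusMk := by
  rintro ⟨y, x⟩
  obtain ⟨y, rfl⟩ := QuotientAddGroup.mk_surjective y
  obtain ⟨x, rfl⟩ := QuotientAddGroup.mk_surjective x
  exact ⟨(y, x), rfl⟩

lemma continuous_torusMk : Continuous torusMk :=
  ((AddCircle.continuous_mk' 1).comp continuous_fst).prodMk
    ((AddCircle.continuous_mk' 1).comp continuous_snd)

lemma isOpenMap_torusMk : IsOpenMap torusMk :=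
  (QuotientAddGroup.isOpenMap_coe (N := AddSubgroup.zmultiples (1 : ℝ))).prodMap
    (QuotientAddGroup.isOpenMap_coe (N := AddSubgroup.zmultiples (1 : ℝ)))

lemma coe_unitAddCircle_eq_iff {a b : ℝ} :
    (a : UnitAddCircle) = b ↔ ∃ m : ℤ, a = b + m := by
  rw [← sub_eq_zero, ← AddCircle.coe_sub, AddCircle.coe_eq_zero_iff]
  constructor
  · rintro ⟨n, hn⟩
    exact ⟨n, by rw [zsmul_one] at hn; linarith⟩
  · rintro ⟨m, rfl⟩
    exact ⟨m, by simp⟩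

lemma torusMk_add_int (y x : ℝ) (m n : ℤ) : torusMk (y + m, x + n) = torusMk (y, x) :=
  Prod.ext (coe_unitAddCircle_eq_iff.2 ⟨m, rfl⟩) (coe_unitAddCircle_eq_iff.2 ⟨n, rfl⟩)

lemma torusMk_eq_iff {w z : ℝ × ℝ} :
    torusMk w = torusMk z ↔ ∃ m n : ℤ, w = (z.1 + m, z.2 + n) := by
  constructor
  · intro h
    obtain ⟨m, hm⟩ := coe_unitAddCircle_eq_iff.1 (congrArg Prod.fst h)
    obtain ⟨n, hn⟩ := coe_unitAddCircle_eq_iff.1 (congrArg Prod.snd h)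
    exact ⟨m, n, Prod.ext hm hn⟩
  · rintro ⟨m, n, rfl⟩
    exact torusMk_add_int _ _ m n

/-- The base map `y ↦ i y` of the model. -/
abbrev modelBase (i : ℤ) : ℝ → ℝ := fun y => i * y

/-- The fiber maps `x ↦ x + ε v(y, x)` of the model. -/
abbrev modelFiber (v : ℝ → ℝ → ℝ) (ε : ℝ) : ℝ → ℝ → ℝ := fun y x => x + ε * v y x

lemma modelBase_iterate (i : ℤ) (n : ℕ) (y : ℝ) : (modelBase i)^[n] y = (i : ℝ) ^ n * y := by
  induction n with
  | zero => simp
  | succ n ih => rw [Function.iterate_succ_apply', ih, pow_succ']; simp [modelBase, mul_assoc]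

lemma semiconj_iterate {T : UnitAddCircle × UnitAddCircle → UnitAddCircle × UnitAddCircle}
    {Φ : ℝ × ℝ → ℝ × ℝ} (hT : ∀ w, T (torusMk w) = torusMk (Φ w)) (n : ℕ) (w : ℝ × ℝ) :
    T^[n] (torusMk w) = torusMk (Φ^[n] w) :=
  ((show Function.Semiconj torusMk Φ T from fun w => (hT w).symm).iterate_right n w).symm

lemma image_iterate_torusMk {T : UnitAddCircle × UnitAddCircle → UnitAddCircle × UnitAddCircle}
    {Φ : ℝ × ℝ → ℝ × ℝ} (hT : ∀ w, T (torusMk w) = torusMk (Φ w)) (n : ℕ) (B : Set (ℝ × ℝ)) :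
    T^[n] '' (torusMk '' B) = torusMk '' (Φ^[n] '' B) := by
  simp only [Set.image_image, semiconj_iterate hT]

lemma image_iterate_univ_mono {X : Type*} {T : X → X} (hs : Function.Surjective T) {U : Set X}
    {m n : ℕ} (hU : T^[m] '' U = Set.univ) (hmn : m ≤ n) : T^[n] '' U = Set.univ := by
  obtain ⟨k, rfl⟩ := Nat.exists_eq_add_of_le' hmn
  rw [Function.iterate_add, Set.image_comp, hU, Set.image_univ, (hs.iterate k).range_eq]

namespace NearModel

variable {i : ℤ} {v : ℝ → ℝ → ℝ} {L c θ ε δ : ℝ} {g : ℝ → ℝ} {f : ℝ → ℝ → ℝ}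
  (h : NearModel i v L c θ ε δ g f)
include h

/-- Preimages under nearby skew products of nearby points are near. -/
lemma exists_near_preimage (w z : ℝ × ℝ) {η : ℝ}
    (hz : dist (skew (modelBase i) (modelFiber v ε) w) z ≤ η) :
    ∃ w', skew g f w' = z ∧ dist w w' ≤ 4 * (η + δ) := by
  obtain ⟨y, x⟩ := w
  obtain ⟨z₁, z₂⟩ := z
  simp only [skew, Prod.dist_eq, max_le_iff, Real.dist_eq] at hz
  obtain ⟨y', rfl⟩ := h.base_surjective z₁
  obtain ⟨x', rfl⟩ := h.fiber_surjective y' z₂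
  refine ⟨(y', x'), rfl, ?_⟩
  have hi := h.field.two_le_cast
  have h0 := h.δ_nonneg
  have h1 := h.δ_small
  have h2 := h.ε_small
  have h20 := h.εL_pos
  have hη : 0 ≤ η := (abs_nonneg _).trans hz.1
  have h3 := h.base_abs_lower y' y
  have h4 := h.base_near y
  have h5 : |g y - g y'| ≤ δ + η :=
    (abs_sub_le (g y) (i * y) (g y')).trans (add_le_add h4 hz.1)
  have h6 : |y - y'| ≤ η + δ := by nlinarith [abs_nonneg (y - y')]
  have h7 := h.fiber_abs_lower y' x x'
  have h8 := h.fiber_abs_left y' y x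
  rw [abs_sub_comm y' y] at h8
  have h9 := h.fiber_near y x
  have h10 : |f y' x - f y' x'| ≤ (ε * L + δ) * |y - y'| + (δ + η) :=
    (abs_sub_le (f y' x) (f y x) (f y' x')).trans (add_le_add h8
      ((abs_sub_le (f y x) (x + ε * v y x) (f y' x')).trans (add_le_add h9 hz.2)))
  have h11 : (ε * L + δ) * |y - y'| ≤ 1 * (η + δ) :=
    mul_le_mul (by linarith) h6 (abs_nonneg _) zero_le_one
  rw [Prod.dist_eq, max_le_iff, Real.dist_eq, Real.dist_eq]
  constructor <;> simp only <;> linarith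

lemma exists_near_preimage_iterate (K : ℕ) (w z : ℝ × ℝ) {η : ℝ}
    (hz : dist ((skew (modelBase i) (modelFiber v ε))^[K] w) z ≤ η) :
    ∃ w', (skew g f)^[K] w' = z ∧ dist w w' ≤ 8 ^ K * (η + δ) := by
  induction K generalizing w with
  | zero => exact ⟨z, rfl, by simpa using hz.trans (le_add_of_nonneg_right h.δ_nonneg)⟩
  | succ K ih =>
    rw [Function.iterate_succ_apply] at hz
    obtain ⟨w₁, hw₁, hd⟩ := ih _ hz
    obtain ⟨w', hw', hd'⟩ := h.exists_near_preimage w w₁ hd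
    refine ⟨w', by rw [Function.iterate_succ_apply, hw', hw₁], hd'.trans ?_⟩
    have h0 := h.δ_nonneg
    have hη : 0 ≤ η := dist_nonneg.trans hz
    have h1 : (1 : ℝ) ≤ 8 ^ K := one_le_pow₀ (by norm_num)
    rw [pow_succ]
    nlinarith [mul_le_mul_of_nonneg_right h1 (add_nonneg hη h0)]

end NearModel

/-! ### Images of open sets under the model -/

namespace ForcingField

variable {i : ℤ} {v : ℝ → ℝ → ℝ} {L c θ ε : ℝ} (h : ForcingField i v L c θ)
  {T : UnitAddCircle × UnitAddCircle → UnitAddCircle × UnitAddCircle}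
include h

lemma isOpenMap_skew (hε : 0 < ε) (hεL : ε * L ≤ 1 / 1000) :
    IsOpenMap (skew (modelBase i) (modelFiber v ε)) := by
  intro U hU
  rw [Metric.isOpen_iff]
  rintro _ ⟨w, hw, rfl⟩
  obtain ⟨r, hr, hball⟩ := Metric.isOpen_iff.1 hU w hw
  refine ⟨r / 5, by positivity, fun z hz => ?_⟩
  obtain ⟨w', hw', hd⟩ := (NearModel.model h hε hεL).exists_near_preimage w z
    (η := r / 5) (by rw [dist_comm]; exact (Metric.mem_ball.1 hz).le)
  exact ⟨w', hball (by rw [Metric.mem_ball, dist_comm]; linarith), hw'⟩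

lemma surjective_of_semiconj (hε : 0 < ε) (hεL : ε * L ≤ 1 / 1000)
    (hT : ∀ w, T (torusMk w) = torusMk (skew (modelBase i) (modelFiber v ε) w)) :
    Function.Surjective T := by
  intro q
  obtain ⟨z, rfl⟩ := torusMk_surjective q
  obtain ⟨w', hw', -⟩ := (NearModel.model h hε hεL).exists_near_preimage (0 : ℝ × ℝ) z le_rfl
  exact ⟨torusMk w', by rw [hT]; exact congrArg torusMk hw'⟩

lemma isOpenMap_of_semiconj (hε : 0 < ε) (hεL : ε * L ≤ 1 / 1000)
    (hT : ∀ w, T (torusMk w) = torusMk (skew (modelBase i) (modelFiber v ε) w)) :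
    IsOpenMap T := by
  intro U hU
  have : T '' U = torusMk '' (skew (modelBase i) (modelFiber v ε) '' (torusMk ⁻¹' U)) := by
    conv_lhs => rw [← Set.image_preimage_eq U torusMk_surjective]
    simp only [Set.image_image, hT]
  rw [this]
  exact isOpenMap_torusMk _ (h.isOpenMap_skew hε hεL _ (hU.preimage continuous_torusMk))

/-- The point at time `-2n` of the backward orbit of `η` that converges to the orbit of period two
of `1/(i+1)`. -/
noncomputable def _root_.backwardBase (i : ℤ) (η : ℝ) (n : ℕ) : ℝ :=
  1 / ((i : ℝ) + 1) + (η - 1 / ((i : ℝ) + 1)) / ((i : ℝ) ^ 2) ^ n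

omit h in
lemma backwardBase_zero (i : ℤ) (η : ℝ) : backwardBase i η 0 = η := by
  simp [backwardBase]

lemma backwardBase_succ (η : ℝ) (n : ℕ) :
    (i : ℝ) ^ 2 * backwardBase i η (n + 1) = backwardBase i η n + ((i - 1 : ℤ) : ℝ) := by
  have hi := h.two_le_cast
  have h1 : (i : ℝ) + 1 ≠ 0 := by linarith
  have h2 : (i : ℝ) ≠ 0 := by linarith
  have h3 : (i : ℝ) ^ 2 * (1 / ((i : ℝ) + 1)) = 1 / ((i : ℝ) + 1) + (i - 1) := by
    field_simp; ring
  rw [backwardBase, backwardBase, mul_add, h3, pow_succ _ n]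
  push_cast
  field_simp
  ring

lemma tendsto_backwardBase (η : ℝ) :
    Tendsto (backwardBase i η) atTop (𝓝 (1 / ((i : ℝ) + 1))) := by
  have hi := h.two_le_cast
  have h1 := (tendsto_inv_atTop_zero.comp (tendsto_pow_atTop_atTop_of_one_lt
    (show 1 < (i : ℝ) ^ 2 by nlinarith))).const_mul (η - 1 / ((i : ℝ) + 1))
  have h2 := h1.const_add (1 / ((i : ℝ) + 1))
  rw [mul_zero, add_zero] at h2
  exact h2.congr fun n => by simp [backwardBase, div_eq_mul_inv]

lemma abs_backwardBase_succ_sub_le (η : ℝ) (n : ℕ) :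
    |backwardBase i η (n + 1) - 1 / ((i : ℝ) + 1)| ≤ |η - 1 / ((i : ℝ) + 1)| * (1 / 4) ^ n := by
  have hi := h.two_le_cast
  rw [backwardBase, add_sub_cancel_left, abs_div,
    abs_of_pos (by positivity : (0 : ℝ) < (i ^ 2) ^ (n + 1)), div_eq_mul_inv]
  refine mul_le_mul_of_nonneg_left ?_ (abs_nonneg _)
  rw [one_div, inv_pow]
  refine inv_anti₀ (by positivity) ?_
  calc (4 : ℝ) ^ n ≤ ((i : ℝ) ^ 2) ^ n := pow_le_pow_left₀ (by norm_num) (by nlinarith) n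
    _ ≤ ((i : ℝ) ^ 2) ^ (n + 1) := pow_le_pow_right₀ (by nlinarith) (by omega)

lemma abs_v_sub_rotation (y x : ℝ) : |v y x - θ| ≤ L * |y - 1 / ((i : ℝ) + 1)| := by
  have := h.lip_left y (1 / ((i : ℝ) + 1)) x
  rwa [h.rotation] at this

lemma abs_v_base_sub_rotation (y x : ℝ) :
    |v (i * y) x - θ| ≤ L * (i * |y - 1 / ((i : ℝ) + 1)|) := by
  have hi := h.two_le_cast
  have h1 : (i : ℝ) + 1 ≠ 0 := by linarith
  have h2 : (i : ℝ) * (1 / ((i : ℝ) + 1)) = -(1 / ((i : ℝ) + 1)) + ((1 : ℤ) : ℝ) := by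
    push_cast; field_simp; ring
  have h3 := h.lip_left (i * y) (i * (1 / ((i : ℝ) + 1))) x
  rw [h2, h.add_int_left, h.rotation_neg, ← h2, ← mul_sub, abs_mul,
    abs_of_pos (by linarith : (0 : ℝ) < i)] at h3
  exact h3

/-- Near `1/(i+1)` the second iterate rotates the fibers by almost exactly `2 ε θ`. -/
lemma fiberOrbit_two_near (hε : 0 < ε) (y x : ℝ) :
    |fiberOrbit (modelBase i) (modelFiber v ε) 2 y x - x - 2 * (ε * θ)| ≤
      ε * L * (1 + i) * |y - 1 / ((i : ℝ) + 1)| := by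
  have h1 := mul_le_mul_of_nonneg_left (h.abs_v_sub_rotation y x) hε.le
  have h2 := mul_le_mul_of_nonneg_left (h.abs_v_base_sub_rotation y (x + ε * v y x)) hε.le
  rw [← abs_of_pos hε, ← abs_mul, abs_of_pos hε] at h1 h2
  have h3 : fiberOrbit (modelBase i) (modelFiber v ε) 2 y x - x - 2 * (ε * θ) =
      ε * (v y x - θ) + ε * (v (i * y) (x + ε * v y x) - θ) := by
    rw [fiberOrbit_succ, fiberOrbit_succ]
    simp only [fiberOrbit_zero, modelFiber, Function.iterate_one, Function.iterate_zero, id]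
    ring
  rw [h3]
  refine (abs_add_le _ _).trans ((add_le_add h1 h2).trans (le_of_eq ?_))
  ring

/-- Every point has a backward orbit asymptotic to the rotation by `2 ε θ` over the orbit of
period two of `1/(i+1)`. -/
lemma exists_backward_orbit (hε : 0 < ε) (hεL : ε * L ≤ 1 / 1000) (η ξ₀ : ℝ) :
    ∃ (ξ : ℕ → ℝ) (ζ : ℝ), ξ 0 = ξ₀ ∧
      (∀ n, fiberOrbit (modelBase i) (modelFiber v ε) 2 (backwardBase i η (n + 1)) (ξ (n + 1)) =
        ξ n) ∧ Tendsto (fun n => ξ n + n * (2 * (ε * θ))) atTop (𝓝 ζ) := by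
  have hi := h.two_le_cast
  have hN := NearModel.model h hε hεL
  have hsurj : ∀ y, Function.Surjective (fiberOrbit (modelBase i) (modelFiber v ε) 2 y) := by
    intro y x
    obtain ⟨x₁, hx₁⟩ := hN.fiber_surjective ((modelBase i)^[1] y) x
    obtain ⟨x₂, hx₂⟩ := hN.fiber_surjective y x₁
    refine ⟨x₂, ?_⟩
    rw [fiberOrbit_succ, fiberOrbit_succ, fiberOrbit_zero, Function.iterate_zero, id]
    exact (congrArg (modelFiber v ε ((modelBase i)^[1] y)) hx₂).trans hx₁
  choose inv hinv using hsurj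
  set ξ : ℕ → ℝ := fun n => Nat.rec ξ₀ (fun n x => inv (backwardBase i η (n + 1)) x) n with hξ
  have hrec : ∀ n, fiberOrbit (modelBase i) (modelFiber v ε) 2 (backwardBase i η (n + 1))
      (ξ (n + 1)) = ξ n := fun n => hinv _ _
  have hcau : CauchySeq (fun n => ξ n + n * (2 * (ε * θ))) := by
    refine cauchySeq_of_le_geometric (1 / 4)
      (ε * L * (1 + i) * |η - 1 / ((i : ℝ) + 1)|) (by norm_num) fun n => ?_
    have h1 := h.fiberOrbit_two_near hε (backwardBase i η (n + 1)) (ξ (n + 1))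
    rw [hrec n] at h1
    have h2 := h.abs_backwardBase_succ_sub_le η n
    rw [Real.dist_eq]
    have h3 : ξ n + n * (2 * (ε * θ)) - (ξ (n + 1) + ((n + 1 : ℕ) : ℝ) * (2 * (ε * θ))) =
        ξ n - ξ (n + 1) - 2 * (ε * θ) := by push_cast; ring
    rw [h3]
    refine h1.trans ?_
    rw [mul_assoc _ _ ((1 / 4 : ℝ) ^ n)]
    have := h.L_pos
    exact mul_le_mul_of_nonneg_left h2 (by positivity)
  obtain ⟨ζ, hζ⟩ := cauchySeq_tendsto_of_complete hcau
  exact ⟨ξ, ζ, rfl, hrec, hζ⟩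

lemma iterate_backward_orbit {η : ℝ}
    (hT : ∀ w, T (torusMk w) = torusMk (skew (modelBase i) (modelFiber v ε) w)) {ξ : ℕ → ℝ}
    (hξ : ∀ n, fiberOrbit (modelBase i) (modelFiber v ε) 2 (backwardBase i η (n + 1)) (ξ (n + 1)) =
      ξ n) (n : ℕ) :
    T^[2 * n] (torusMk (backwardBase i η n, ξ n)) = torusMk (η, ξ 0) := by
  induction n with
  | zero => simp [backwardBase_zero]
  | succ n ih =>
    rw [mul_add, mul_one, Function.iterate_add_apply, semiconj_iterate hT 2, skew_iterate, hξ,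
      modelBase_iterate, h.backwardBase_succ]
    have := torusMk_add_int (backwardBase i η n) (ξ n) (i - 1) 0
    rw [Int.cast_zero, add_zero] at this
    rw [this, ih]

/-- Backward orbits are dense: they accumulate on the whole circle over `1/(i+1)`, and the
preimages of that circle are dense. -/
lemma exists_mem_image_iterate (hε : 0 < ε) (hεL : ε * L ≤ 1 / 1000)
    (hβ : Irrational (2 * (ε * θ)))
    (hT : ∀ w, T (torusMk w) = torusMk (skew (modelBase i) (modelFiber v ε) w))
    {U : Set (UnitAddCircle × UnitAddCircle)} (hU : IsOpen U) (hne : U.Nonempty)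
    (q : UnitAddCircle × UnitAddCircle) : ∃ n, q ∈ T^[n] '' U := by
  have hi := h.two_le_cast
  have hN := NearModel.model h hε hεL
  obtain ⟨u, hu⟩ := hne
  obtain ⟨⟨a, x⟩, rfl⟩ := torusMk_surjective u
  obtain ⟨r, hr, hball⟩ := Metric.isOpen_iff.1 (hU.preimage continuous_torusMk) _ hu
  obtain ⟨⟨η, ξ₀⟩, rfl⟩ := torusMk_surjective q
  -- a preimage of `1/(i+1)` close to `a`
  obtain ⟨m, hm⟩ := pow_unbounded_of_one_lt (1 / r) (show 1 < (i : ℝ) by linarith)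
  set j : ℤ := round ((i : ℝ) ^ m * a - 1 / ((i : ℝ) + 1)) with hj
  set b : ℝ := (1 / ((i : ℝ) + 1) + j) / (i : ℝ) ^ m with hb
  have him : (0 : ℝ) < (i : ℝ) ^ m := by positivity
  have hbm : (i : ℝ) ^ m * b = 1 / ((i : ℝ) + 1) + j := by rw [hb]; field_simp
  have hba : |b - a| < r := by
    have h1 := abs_sub_round ((i : ℝ) ^ m * a - 1 / ((i : ℝ) + 1))
    rw [← hj, ← abs_neg, show -((i : ℝ) ^ m * a - 1 / ((i : ℝ) + 1) - j) =
      (i : ℝ) ^ m * (b - a) by rw [mul_sub, hbm]; ring, abs_mul, abs_of_pos him] at h1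
    rw [div_lt_iff₀ hr] at hm
    by_contra hcon
    push Not at hcon
    nlinarith [mul_le_mul_of_nonneg_left hcon him.le]
  set x₁ := fiberOrbit (modelBase i) (modelFiber v ε) m b x with hx₁
  have hmem : (b, x) ∈ torusMk ⁻¹' U := by
    apply hball
    rw [Metric.mem_ball, Prod.dist_eq, max_lt_iff, Real.dist_eq, Real.dist_eq]
    simpa using ⟨hba, hr⟩
  obtain ⟨r', hr', hball'⟩ := Metric.isOpen_iff.1 (hU.preimage continuous_torusMk) _ hmem
  obtain ⟨ξ, ζ, hξ0, hξ, hζ⟩ := h.exists_backward_orbit hε hεL η ξ₀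
  set τ : ℝ := r' / (2 * 8 ^ m) with hτ
  have hτ0 : 0 < τ := by positivity
  have hev : ∀ᶠ n in atTop, |backwardBase i η n - 1 / ((i : ℝ) + 1)| < τ := by
    have := (h.tendsto_backwardBase η).eventually (Metric.ball_mem_nhds _ hτ0)
    simpa [Real.dist_eq] using this
  obtain ⟨n, ⟨k, hk⟩, hn⟩ := ((frequently_near_int hβ hζ x₁ hτ0).and_eventually hev).exists
  obtain ⟨w', hw', hd⟩ := hN.exists_near_preimage_iterate m (b, x)
    (backwardBase i η n + j, ξ n + ((-k : ℤ) : ℝ)) (η := τ) (by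
      rw [skew_iterate, modelBase_iterate, hbm, Prod.dist_eq, max_le_iff, Real.dist_eq,
        Real.dist_eq, abs_sub_comm, abs_sub_comm (fiberOrbit _ _ _ _ _)]
      push_cast
      constructor
      · simpa using hn.le
      · rw [show ξ n + -(k : ℝ) - fiberOrbit (modelBase i) (modelFiber v ε) m b x =
          ξ n - (x₁ + k) by rw [hx₁]; ring]
        exact hk.le)
  have hw'U : torusMk w' ∈ U := by
    apply hball'
    rw [Metric.mem_ball, dist_comm]
    refine hd.trans_lt ?_
    rw [add_zero, hτ, mul_div_assoc', div_lt_iff₀ (by positivity)]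
    have : (0 : ℝ) < 8 ^ m := by positivity
    nlinarith
  refine ⟨2 * n + m, torusMk w', hw'U, ?_⟩
  rw [Function.iterate_add_apply, semiconj_iterate hT m, hw', torusMk_add_int,
    h.iterate_backward_orbit hT hξ n, hξ0]

/-- The fixed point `(0, 0)` is repelling: small boxes around it are contained in their images. -/
lemma subset_image_box (hε : 0 < ε) (hεL : ε * L ≤ 1 / 1000) {ρ : ℝ} (hρ : 0 < ρ)
    (hρ' : ρ ≤ 1 / 40) :
    Set.Ioo (-(c / L * ρ)) (c / L * ρ) ×ˢ Set.Ioo (-ρ) ρ ⊆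
      skew (modelBase i) (modelFiber v ε) ''
        (Set.Ioo (-(c / L * ρ)) (c / L * ρ) ×ˢ Set.Ioo (-ρ) ρ) := by
  have hi := h.two_le_cast
  have hN := NearModel.model h hε hεL
  have hL := h.L_pos
  have hc := h.c_pos
  rintro ⟨y, x⟩ ⟨hy, hx⟩
  simp only [Set.mem_Ioo] at hy hx
  have hy' : |y / i| ≤ c / L * ρ := by
    rw [abs_div, abs_of_pos (by linarith : (0 : ℝ) < i)]
    rw [div_le_iff₀ (by linarith)]
    have := abs_lt.2 hy
    nlinarith [abs_nonneg y]
  have hLy : L * |y / i| ≤ c * ρ := by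
    calc _ ≤ L * (c / L * ρ) := mul_le_mul_of_nonneg_left hy' hL.le
      _ = c * ρ := by field_simp
  obtain ⟨x', rfl⟩ := hN.fiber_surjective (y / i) x
  have hmono := hN.fiber_strictMono (y / i)
  have habs : |ρ| ≤ 1 / 40 := by rwa [abs_of_pos hρ]
  have h1 := h.expand_zero 0 ρ (by norm_num) habs hρ.le
  have h2 := h.expand_zero (-ρ) 0 (by rwa [abs_neg]) (by norm_num) (by linarith)
  rw [h.zero_zero] at h1 h2
  have h3 := abs_le.1 (h.lip_left (y / i) 0 ρ)
  have h4 := abs_le.1 (h.lip_left (y / i) 0 (-ρ))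
  rw [sub_zero] at h3 h4
  have h5 : 0 ≤ ε * v (y / i) ρ := mul_nonneg hε.le (by linarith [h3.1])
  have h6 : ε * v (y / i) (-ρ) ≤ 0 := mul_nonpos_of_nonneg_of_nonpos hε.le (by linarith [h4.2])
  refine ⟨(y / i, x'), ⟨?_, ?_, ?_⟩, ?_⟩
  · have h7 := abs_lt.2 hy
    rw [Set.mem_Ioo, ← abs_lt]
    change |y / i| < _
    rw [abs_div, abs_of_pos (by linarith : (0 : ℝ) < i), div_lt_iff₀ (by linarith)]
    nlinarith [abs_nonneg y]
  · refine hmono.lt_iff_lt.1 (lt_of_le_of_lt ?_ hx.1)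
    change -ρ + ε * v (y / i) (-ρ) ≤ -ρ
    linarith
  · refine hmono.lt_iff_lt.1 (lt_of_lt_of_le hx.2 ?_)
    change ρ ≤ ρ + ε * v (y / i) ρ
    linarith
  · refine Prod.ext ?_ rfl
    change (i : ℝ) * (y / i) = y
    field_simp

/-- The model is locally eventually onto: some image of every nonempty open set is the whole
torus. -/
theorem exists_image_iterate_eq_univ (hε : 0 < ε) (hεL : ε * L ≤ 1 / 1000)
    (hβ : Irrational (2 * (ε * θ)))
    (hT : ∀ w, T (torusMk w) = torusMk (skew (modelBase i) (modelFiber v ε) w))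
    {U : Set (UnitAddCircle × UnitAddCircle)} (hU : IsOpen U) (hne : U.Nonempty) :
    ∃ n, T^[n] '' U = Set.univ := by
  have hL := h.L_pos
  have hc := h.c_pos
  have hN := NearModel.model h hε hεL
  -- some image of `U` contains a box `B` around `(0, 0)`
  obtain ⟨a, u, hu, hua⟩ := h.exists_mem_image_iterate hε hεL hβ hT hU hne (torusMk (0, 0))
  obtain ⟨w, rfl⟩ := torusMk_surjective u
  obtain ⟨r, hr, hball⟩ := Metric.isOpen_iff.1 (hU.preimage continuous_torusMk) _ hu
  rw [semiconj_iterate hT, torusMk_eq_iff] at hua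
  obtain ⟨m, n, hmn⟩ := hua
  set ρ := min (1 / 40) (r / (2 * 8 ^ a * (1 + c / L))) with hρ
  have hρ0 : 0 < ρ := by positivity
  have hρ1 : ρ ≤ 1 / 40 := min_le_left _ _
  have hρ2 : 8 ^ a * ((1 + c / L) * ρ) < r := by
    have : ρ ≤ r / (2 * 8 ^ a * (1 + c / L)) := min_le_right _ _
    rw [le_div_iff₀ (by positivity)] at this
    linarith
  set B := Set.Ioo (-(c / L * ρ)) (c / L * ρ) ×ˢ Set.Ioo (-ρ) ρ with hB
  have hBU : torusMk '' B ⊆ T^[a] '' U := by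
    rintro _ ⟨⟨y, x⟩, ⟨hy, hx⟩, rfl⟩
    simp only [Set.mem_Ioo] at hy hx
    have hcL : 0 < c / L * ρ := by positivity
    obtain ⟨w', hw', hd⟩ := hN.exists_near_preimage_iterate a w (y + m, x + n)
      (η := (1 + c / L) * ρ) (by
        rw [hmn, Prod.dist_eq, max_le_iff, Real.dist_eq, Real.dist_eq]
        simp only [zero_add]
        rw [show (m : ℝ) - (y + m) = -y by ring, show (n : ℝ) - (x + n) = -x by ring, abs_neg,
          abs_neg]
        have h1 := abs_lt.2 hy
        have h2 := abs_lt.2 hx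
        constructor <;> linarith)
    refine ⟨torusMk w', ?_, ?_⟩
    · apply hball
      rw [Metric.mem_ball, dist_comm]
      exact hd.trans_lt (by rwa [add_zero])
    · rw [semiconj_iterate hT, hw', torusMk_add_int]
  -- the images of `B` increase to everything
  have hBopen : IsOpen (torusMk '' B) := isOpenMap_torusMk _ (isOpen_Ioo.prod isOpen_Ioo)
  have hBne : (torusMk '' B).Nonempty :=
    ⟨torusMk (0, 0), (0, 0), ⟨by constructor <;> simp <;> positivity, by simp [hρ0]⟩, rfl⟩
  have hmono : Monotone fun n => T^[n] '' (torusMk '' B) := by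
    refine monotone_nat_of_le_succ fun n => ?_
    rw [Function.iterate_succ, Set.image_comp]
    refine Set.image_mono ?_
    have := image_iterate_torusMk hT 1 B
    rw [Function.iterate_one] at this
    rw [this]
    exact Set.image_mono (h.subset_image_box hε hεL hρ0 hρ1)
  have hopen := h.isOpenMap_of_semiconj hε hεL hT
  have hopenIt : ∀ n, IsOpenMap T^[n] := fun n => by
    induction n with
    | zero => exact IsOpenMap.id
    | succ n ih => rw [Function.iterate_succ]; exact ih.comp hopen
  obtain ⟨k, hk⟩ := isCompact_univ.elim_directed_cover (fun n => T^[n] '' (torusMk '' B))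
    (fun n => hopenIt n _ hBopen)
    (fun q _ => Set.mem_iUnion.2 (h.exists_mem_image_iterate hε hεL hβ hT hBopen hBne q))
    hmono.directed_le
  refine ⟨k + a, Set.univ_subset_iff.1 (hk.trans ?_)⟩
  rw [Function.iterate_add, Set.image_comp]
  exact Set.image_mono hBU

/-- Balls of a given radius are mapped onto the torus after a common number of iterates. -/
lemma exists_uniform_preimage (hε : 0 < ε) (hεL : ε * L ≤ 1 / 1000)
    (hβ : Irrational (2 * (ε * θ)))
    (hT : ∀ w, T (torusMk w) = torusMk (skew (modelBase i) (modelFiber v ε) w)) {ρ : ℝ}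
    (hρ : 0 < ρ) :
    ∃ K : ℕ, ∀ (p : ℝ × ℝ) (z : UnitAddCircle × UnitAddCircle),
      ∃ w ∈ Metric.ball p ρ, torusMk ((skew (modelBase i) (modelFiber v ε))^[K] w) = z := by
  have hsurj := h.surjective_of_semiconj hε hεL hT
  have hopen : ∀ p : ℝ × ℝ, IsOpen (torusMk '' Metric.ball p (ρ / 2)) := fun p =>
    isOpenMap_torusMk _ Metric.isOpen_ball
  have hmem : ∀ p : ℝ × ℝ, torusMk p ∈ torusMk '' Metric.ball p (ρ / 2) := fun p =>
    ⟨p, Metric.mem_ball_self (by positivity), rfl⟩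
  choose N hN using fun p => h.exists_image_iterate_eq_univ hε hεL hβ hT (hopen p) ⟨_, hmem p⟩
  obtain ⟨t, ht⟩ := isCompact_univ.elim_finite_subcover _ hopen (fun q _ => by
    obtain ⟨p, rfl⟩ := torusMk_surjective q
    exact Set.mem_iUnion.2 ⟨p, hmem p⟩)
  refine ⟨t.sup N, fun p z => ?_⟩
  have hp := ht (Set.mem_univ (torusMk p))
  simp only [Set.mem_iUnion] at hp
  obtain ⟨p', hp't, p₁, hp₁, hp₁'⟩ := hp
  obtain ⟨m, n, rfl⟩ := torusMk_eq_iff.1 hp₁'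
  have hall := image_iterate_univ_mono hsurj (hN p') (Finset.le_sup hp't)
  obtain ⟨_, ⟨w, hw, rfl⟩, hwz⟩ := hall.ge (Set.mem_univ z)
  refine ⟨(w.1 + ((-m : ℤ) : ℝ), w.2 + ((-n : ℤ) : ℝ)), ?_, ?_⟩
  · rw [Metric.mem_ball, Prod.dist_eq, max_lt_iff, Real.dist_eq, Real.dist_eq] at hp₁ hw ⊢
    simp only at hp₁ hw ⊢
    push_cast
    rw [abs_lt, abs_lt] at *
    refine ⟨⟨?_, ?_⟩, ?_, ?_⟩ <;>
      linarith [hp₁.1.1, hp₁.1.2, hp₁.2.1, hp₁.2.2, hw.1.1, hw.1.2, hw.2.1, hw.2.2]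
  · rw [← semiconj_iterate hT, torusMk_add_int, ← hwz]

/-- Every skew product close enough to the model is locally eventually onto. -/
theorem exists_robust_image_iterate_eq_univ (hε : 0 < ε) (hεL : ε * L ≤ 1 / 1000)
    (hβ : Irrational (2 * (ε * θ))) {N : ℕ} (hN : 24 * L ≤ N * c)
    (hNε : N * (ε * L) ≤ 1 / 400) (hiN : 4 ≤ (i : ℝ) ^ N)
    (hT : ∀ w, T (torusMk w) = torusMk (skew (modelBase i) (modelFiber v ε) w)) :
    ∃ δ > 0, δ ≤ 1 / 1000 ∧ ∀ (g : ℝ → ℝ) (f : ℝ → ℝ → ℝ), NearModel i v L c θ ε δ g f →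
      ∀ S : UnitAddCircle × UnitAddCircle → UnitAddCircle × UnitAddCircle,
        (∀ w, S (torusMk w) = torusMk (skew g f w)) →
          ∀ U, IsOpen U → U.Nonempty → ∃ n, S^[n] '' U = Set.univ := by
  have hi := h.two_le_cast
  have hc := h.c_pos
  obtain ⟨K, hK⟩ := h.exists_uniform_preimage hε hεL hβ hT (show (0 : ℝ) < 1 / 800 by norm_num)
  set δ := min (min (1 / (400 * ((N : ℝ) + 1))) (1 / (i : ℝ) ^ N))
    (min (ε * c / 2) (1 / (1600 * 8 ^ K))) with hδ
  have hδ0 : 0 < δ := by positivity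
  have h1 : δ ≤ 1 / (400 * ((N : ℝ) + 1)) := (min_le_left _ _).trans (min_le_left _ _)
  have h2 : δ ≤ 1 / (i : ℝ) ^ N := (min_le_left _ _).trans (min_le_right _ _)
  have h3 : δ ≤ ε * c / 2 := (min_le_right _ _).trans (min_le_left _ _)
  have h4 : δ ≤ 1 / (1600 * 8 ^ K) := (min_le_right _ _).trans (min_le_right _ _)
  rw [le_div_iff₀ (by positivity)] at h1 h2 h4
  refine ⟨δ, hδ0, by nlinarith [one_le_pow₀ (show (1 : ℝ) ≤ 8 by norm_num) (n := K)],
    fun g f hgf S hS U hU hne => ?_⟩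
  obtain ⟨n, q, hq⟩ := hgf.exists_ball_subset_image hN (by nlinarith) h2 hiN h3
    (hU.preimage continuous_torusMk) (hne.preimage torusMk_surjective)
  refine ⟨K + n, Set.eq_univ_of_forall fun z => ?_⟩
  obtain ⟨w, hw, rfl⟩ := hK q z
  obtain ⟨w', hw', hd⟩ := hgf.exists_near_preimage_iterate K w _ (η := 0) (dist_self _).le
  have hw'q : w' ∈ Metric.ball q (1 / 400) := by
    rw [Metric.mem_ball, dist_comm] at hw ⊢
    have := dist_triangle q w w'
    linarith
  obtain ⟨u, hu, hu'⟩ := hq hw'q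
  refine ⟨torusMk u, hu, ?_⟩
  rw [semiconj_iterate hS, Function.iterate_add_apply, hu', hw']

end ForcingField

/-! ### Unstable curves of the model -/

namespace ForcingField

variable {i : ℤ} {v : ℝ → ℝ → ℝ} {L c θ ε : ℝ} (h : ForcingField i v L c θ)
  {T : UnitAddCircle × UnitAddCircle → UnitAddCircle × UnitAddCircle}
include h

/-- Given the fibers `(Y n, X n)` of a backward orbit, there are curves `ℓ n` of slope at most
`1/100`, displacements from that orbit, which are mapped to each other by the model. They are the
limits of the images of horizontal segments. -/
lemma exists_leaf (hε : 0 < ε) (hεL : ε * L ≤ 1 / 1000) (Y X : ℕ → ℝ) :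
    ∃ ℓ : ℕ → ℝ → ℝ, (∀ n, ℓ n 0 = 0) ∧ (∀ n t t', |ℓ n t - ℓ n t'| ≤ 1 / 100 * |t - t'|) ∧
      ∀ n t, ℓ n (i * t) = modelFiber v ε (Y (n + 1) + t) (X (n + 1) + ℓ (n + 1) t) -
        modelFiber v ε (Y (n + 1)) (X (n + 1)) := by
  have hi := h.two_le_cast
  have hi0 : (i : ℝ) ≠ 0 := by linarith
  have hN := NearModel.model h hε hεL
  have hL := h.L_pos
  set A : ℕ → ℕ → ℝ → ℝ := fun k => Nat.rec (fun _ _ => 0)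
    (fun _ a n t => modelFiber v ε (Y (n + 1) + t / i) (X (n + 1) + a (n + 1) (t / i)) -
      modelFiber v ε (Y (n + 1)) (X (n + 1))) k with hA
  have hAs : ∀ k n t, A (k + 1) n t =
      modelFiber v ε (Y (n + 1) + t / i) (X (n + 1) + A k (n + 1) (t / i)) -
      modelFiber v ε (Y (n + 1)) (X (n + 1)) := fun _ _ _ => rfl
  have hA0 : ∀ k n, A k n 0 = 0 := by
    intro k
    induction k with
    | zero => intro n; rfl
    | succ k ih => intro n; rw [hAs, zero_div, ih, add_zero, add_zero, sub_self]
  have hAlip : ∀ k n t t', |A k n t - A k n t'| ≤ 1 / 100 * |t - t'| := by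
    intro k
    induction k with
    | zero => intro n t t'; simp [hA]
    | succ k ih =>
      intro n t t'
      rw [hAs, hAs, sub_sub_sub_cancel_right]
      have h1 := hN.cone (y := Y (n + 1) + t / i) (y' := Y (n + 1) + t' / i)
        (x := X (n + 1) + A k (n + 1) (t / i)) (x' := X (n + 1) + A k (n + 1) (t' / i))
        (by rw [add_sub_add_left_eq_sub, add_sub_add_left_eq_sub]; exact ih _ _ _)
      rwa [show (i : ℝ) * (Y (n + 1) + t / i) - i * (Y (n + 1) + t' / i) = t - t' by
        field_simp; ring] at h1
  have hAc : ∀ k n t, |A (k + 1) n t - A k n t| ≤ |t| * (3 / 4) ^ k := by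
    intro k
    induction k with
    | zero =>
      intro n t
      have h1 := hAlip 1 n t 0
      rw [hA0, sub_zero, sub_zero] at h1
      have h2 : A 0 n t = 0 := rfl
      rw [h2, zero_add, sub_zero, pow_zero]
      linarith [abs_nonneg t]
    | succ k ih =>
      intro n t
      rw [hAs (k + 1), hAs k, sub_sub_sub_cancel_right]
      have h1 := hN.fiber_abs_upper (Y (n + 1) + t / i) (X (n + 1) + A (k + 1) (n + 1) (t / i))
        (X (n + 1) + A k (n + 1) (t / i))
      rw [add_sub_add_left_eq_sub] at h1
      have h2 := ih (n + 1) (t / i)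
      have h3 : |t / i| ≤ 1 / 2 * |t| := by
        rw [abs_div, abs_of_pos (by linarith : (0 : ℝ) < i), div_le_iff₀ (by linarith)]
        nlinarith [abs_nonneg t]
      have h4 : |t / i| * (3 / 4 : ℝ) ^ k ≤ 1 / 2 * |t| * (3 / 4 : ℝ) ^ k :=
        mul_le_mul_of_nonneg_right h3 (by positivity)
      have h5 : 0 ≤ |t| * (3 / 4 : ℝ) ^ k := by positivity
      have h6 : (1 + ε * L + 0) * |A (k + 1) (n + 1) (t / i) - A k (n + 1) (t / i)| ≤
          (1 + ε * L + 0) * (1 / 2 * (|t| * (3 / 4 : ℝ) ^ k)) :=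
        mul_le_mul_of_nonneg_left (by linarith) (by positivity)
      rw [pow_succ]
      nlinarith
  have hlim : ∀ n t, ∃ x, Tendsto (fun k => A k n t) atTop (𝓝 x) := by
    intro n t
    refine cauchySeq_tendsto_of_complete (cauchySeq_of_le_geometric (3 / 4) |t| (by norm_num)
      fun k => ?_)
    rw [Real.dist_eq, abs_sub_comm]
    exact hAc k n t
  choose ℓ hℓ using hlim
  refine ⟨ℓ, fun n => ?_, fun n t t' => ?_, fun n t => ?_⟩
  · refine tendsto_nhds_unique (hℓ n 0) ?_
    simp only [hA0]
    exact tendsto_const_nhds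
  · exact le_of_tendsto (((hℓ n t).sub (hℓ n t')).abs) (Eventually.of_forall fun k => hAlip k n t t')
  · refine tendsto_nhds_unique ((hℓ n (i * t)).comp (tendsto_add_atTop_nat 1)) ?_
    have h1 := ((hN.fiber_continuous (Y (n + 1) + t)).tendsto _).comp
      ((hℓ (n + 1) t).const_add (X (n + 1)))
    refine (h1.sub_const _).congr fun k => ?_
    simp only [Function.comp_apply, hAs]
    rw [mul_div_cancel_left₀ _ hi0]

lemma fiberOrbit_add_int_left (n : ℕ) (y x : ℝ) (m : ℤ) :
    fiberOrbit (modelBase i) (modelFiber v ε) n (y + m) x =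
      fiberOrbit (modelBase i) (modelFiber v ε) n y x := by
  induction n with
  | zero => rfl
  | succ n ih =>
    rw [fiberOrbit_succ, fiberOrbit_succ, ih, modelBase_iterate, modelBase_iterate, modelFiber]
    have : (i : ℝ) ^ n * (y + m) = i ^ n * y + ((i ^ n * m : ℤ) : ℝ) := by push_cast; ring
    rw [this, h.add_int_left]

lemma fiberOrbit_add_int_right (n : ℕ) (y x : ℝ) (m : ℤ) :
    fiberOrbit (modelBase i) (modelFiber v ε) n y (x + m) =
      fiberOrbit (modelBase i) (modelFiber v ε) n y x + m := by
  induction n with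
  | zero => rfl
  | succ n ih =>
    rw [fiberOrbit_succ, fiberOrbit_succ, ih, modelFiber, h.add_int_right]
    ring

/-- Where the fiber maps are constantly a rotation over `y₀`, they are almost isometric near
`y₀`. -/
lemma fiber_lipschitz_of_const {y₀ : ℝ} (hy₀ : ∀ x, v y₀ x = θ) (hε : 0 < ε) (y x x' : ℝ) :
    |modelFiber v ε y x - modelFiber v ε y x'| ≤ Real.exp (ε * L * |y - y₀|) * |x - x'| := by
  have h1 := h.mixed y y₀ x x'
  rw [hy₀, hy₀, sub_self, sub_zero] at h1
  have h2 : modelFiber v ε y x - modelFiber v ε y x' = (x - x') + ε * (v y x - v y x') := by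
    simp only [modelFiber]; ring
  rw [h2]
  refine (abs_add_le _ _).trans ?_
  rw [abs_mul, abs_of_pos hε]
  have h3 := mul_le_mul_of_nonneg_left h1 hε.le
  have h4 := mul_le_mul_of_nonneg_right (Real.add_one_le_exp (ε * L * |y - y₀|))
    (abs_nonneg (x - x'))
  linarith

lemma fiberOrbit_two_lipschitz (hε : 0 < ε) (y x x' : ℝ) :
    |fiberOrbit (modelBase i) (modelFiber v ε) 2 y x -
      fiberOrbit (modelBase i) (modelFiber v ε) 2 y x'| ≤
      Real.exp (2 * (ε * L * i) * |y - 1 / ((i : ℝ) + 1)|) * |x - x'| := by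
  have hi := h.two_le_cast
  have hL := h.L_pos
  have h1 : (i : ℝ) + 1 ≠ 0 := by linarith
  have hrot : ∀ x, v (i * (1 / ((i : ℝ) + 1))) x = θ := by
    intro x
    rw [show (i : ℝ) * (1 / ((i : ℝ) + 1)) = -(1 / ((i : ℝ) + 1)) + ((1 : ℤ) : ℝ) by
      push_cast; field_simp; ring, h.add_int_left, h.rotation_neg]
  have h2 := h.fiber_lipschitz_of_const h.rotation hε y x x'
  have h3 := h.fiber_lipschitz_of_const hrot hε (i * y) (modelFiber v ε y x)
    (modelFiber v ε y x')
  rw [← mul_sub, abs_mul, abs_of_pos (by linarith : (0 : ℝ) < i)] at h3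
  rw [fiberOrbit_succ, fiberOrbit_succ, fiberOrbit_succ, fiberOrbit_succ]
  simp only [fiberOrbit_zero, Function.iterate_one, Function.iterate_zero, id]
  refine h3.trans ((mul_le_mul_of_nonneg_left h2 (Real.exp_nonneg _)).trans ?_)
  rw [← mul_assoc, ← Real.exp_add]
  refine mul_le_mul_of_nonneg_right (Real.exp_le_exp.2 ?_) (abs_nonneg _)
  have h4 : 0 ≤ ε * L * |y - 1 / ((i : ℝ) + 1)| := by positivity
  nlinarith

/-- The iterates along the backward orbit of `η` asymptotic to `±1/(i+1)` are Lipschitz with a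
constant independent of the number of iterates. -/
lemma exists_lipschitz_backwardBase (hε : 0 < ε) (η : ℝ) :
    ∃ C > 0, ∀ n x x', |fiberOrbit (modelBase i) (modelFiber v ε) (2 * n) (backwardBase i η n) x -
      fiberOrbit (modelBase i) (modelFiber v ε) (2 * n) (backwardBase i η n) x'| ≤
        C * |x - x'| := by
  have hi := h.two_le_cast
  have hL := h.L_pos
  set D := ε * L * i * |η - 1 / ((i : ℝ) + 1)| with hD
  have hD0 : 0 ≤ D := by positivity
  refine ⟨Real.exp (4 * D), Real.exp_pos _, fun n x x' => ?_⟩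
  have key : ∀ n x x', |fiberOrbit (modelBase i) (modelFiber v ε) (2 * n) (backwardBase i η n) x -
      fiberOrbit (modelBase i) (modelFiber v ε) (2 * n) (backwardBase i η n) x'| ≤
        Real.exp (4 * D * (1 - (1 / 4) ^ n)) * |x - x'| := by
    intro n
    induction n with
    | zero => intro x x'; simp
    | succ n ih =>
      intro x x'
      rw [mul_add, mul_one, fiberOrbit_add, fiberOrbit_add, modelBase_iterate,
        h.backwardBase_succ, h.fiberOrbit_add_int_left, h.fiberOrbit_add_int_left]
      refine (ih _ _).trans ((mul_le_mul_of_nonneg_left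
        (h.fiberOrbit_two_lipschitz hε _ x x') (Real.exp_nonneg _)).trans ?_)
      rw [← mul_assoc, ← Real.exp_add]
      refine mul_le_mul_of_nonneg_right (Real.exp_le_exp.2 ?_) (abs_nonneg _)
      have h1 := mul_le_mul_of_nonneg_left (h.abs_backwardBase_succ_sub_le η n)
        (show 0 ≤ 2 * (ε * L * i) by positivity)
      have h2 : 2 * (ε * L * i) * (|η - 1 / ((i : ℝ) + 1)| * (1 / 4) ^ n) = 2 * D * (1 / 4) ^ n := by
        rw [hD]; ring
      have h3 : 0 ≤ D * (1 / 4 : ℝ) ^ n := by positivity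
      rw [pow_succ]
      linarith
  refine (key n x x').trans (mul_le_mul_of_nonneg_right (Real.exp_le_exp.2 ?_) (abs_nonneg _))
  have : 0 ≤ D * (1 / 4 : ℝ) ^ n := by positivity
  linarith

/-- The forward images of a curve of small slope are dense, because they cross the circle over
`1/(i+1)`, where the model acts as an irrational rotation. -/
lemma exists_iterate_mem_of_curve (hε : 0 < ε) (hεL : ε * L ≤ 1 / 1000)
    (hβ : Irrational (2 * (ε * θ)))
    (hT : ∀ w, T (torusMk w) = torusMk (skew (modelBase i) (modelFiber v ε) w))
    {V : Set (UnitAddCircle × UnitAddCircle)} (hV : IsOpen V) (hne : V.Nonempty) {C : ℝ → ℝ}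
    (hC : ∀ t t', |C t - C t'| ≤ 1 / 100 * |t - t'|) :
    ∃ (n : ℕ) (s σ : ℝ), 0 < σ ∧ ∀ x, |x - C s| < σ → T^[n] (torusMk (s, x)) ∈ V := by
  obtain ⟨q, hq⟩ := hne
  obtain ⟨⟨η, ξ₀⟩, rfl⟩ := torusMk_surjective q
  obtain ⟨r, hr, hball⟩ := Metric.isOpen_iff.1 (hV.preimage continuous_torusMk) _ hq
  obtain ⟨K, hK, hlip⟩ := h.exists_lipschitz_backwardBase hε η
  obtain ⟨ξ, ζ, hξ0, hξ, hζ⟩ := h.exists_backward_orbit hε hεL η ξ₀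
  set τ : ℝ := r / (3 * K) with hτ
  have hτ0 : 0 < τ := by positivity
  have hev : ∀ᶠ n in atTop, |backwardBase i η n - 1 / ((i : ℝ) + 1)| < τ := by
    have := (h.tendsto_backwardBase η).eventually (Metric.ball_mem_nhds _ hτ0)
    simpa [Real.dist_eq] using this
  obtain ⟨n, ⟨k, hk⟩, hn⟩ :=
    ((frequently_near_int hβ hζ (C (1 / ((i : ℝ) + 1))) hτ0).and_eventually hev).exists
  refine ⟨2 * n, backwardBase i η n, τ, hτ0, fun x hx => ?_⟩
  have h1 : |(x + k) - ξ n| < 3 * τ := by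
    have h2 := abs_le.1 ((hC (backwardBase i η n) (1 / ((i : ℝ) + 1))).trans
      (mul_le_mul_of_nonneg_left hn.le (by norm_num)))
    rw [abs_lt] at *
    constructor <;> linarith [h2.1, h2.2, hx.1, hx.2, hk.1, hk.2]
  have h3 := hlip n (x + k) (ξ n)
  have h4 := h.iterate_backward_orbit hT hξ n
  rw [semiconj_iterate hT, skew_iterate, hξ0, torusMk_eq_iff] at h4
  obtain ⟨a, b, hab⟩ := h4
  rw [Prod.ext_iff] at hab
  simp only at hab
  have h5 := torusMk_add_int (backwardBase i η n) x 0 k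
  rw [Int.cast_zero, add_zero] at h5
  rw [← h5, semiconj_iterate hT, skew_iterate, hab.1]
  rw [hab.2] at h3
  set z := fiberOrbit (modelBase i) (modelFiber v ε) (2 * n) (backwardBase i η n) (x + k)
  have h6 := torusMk_add_int η (z - b) a b
  rw [sub_add_cancel] at h6
  rw [h6]
  apply hball
  rw [Metric.mem_ball, Prod.dist_eq, max_lt_iff, Real.dist_eq, Real.dist_eq]
  refine ⟨by simpa using hr, ?_⟩
  change |z - b - ξ₀| < r
  rw [show z - b - ξ₀ = z - (ξ₀ + b) by ring]
  have h7 : K * |x + k - ξ n| < K * (3 * τ) := mul_lt_mul_of_pos_left h1 hK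
  have h8 : K * (3 * τ) = r := by rw [hτ]; field_simp
  linarith

/-- Points near the height `0` over `y` are pushed upwards relative to their
counterparts over `0`, because `v y 0 ≥ 0`. -/
lemma fiber_zero_sub_le (hε : 0 < ε) (hεL : ε * L ≤ 1 / 1000) {y a b ρ E : ℝ} (hy : 0 ≤ y)
    (hb : |b| ≤ ρ) (hE : 0 ≤ E) (hab : b - a ≤ E) :
    modelFiber v ε 0 b - modelFiber v ε y a ≤
      (1 + ε * L) * E + ε * L * ρ * y - ε * v y 0 := by
  have hN := NearModel.model h hε hεL
  have hL := h.L_pos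
  have h1 := abs_le.1 (h.mixed 0 y b 0)
  rw [h.zero_zero, zero_sub, sub_zero, abs_neg, abs_of_nonneg hy, sub_zero] at h1
  have h2 : L * y * |b| ≤ L * y * ρ := mul_le_mul_of_nonneg_left hb (by positivity)
  have h3 : v 0 b - v y b ≤ L * y * ρ - v y 0 := by linarith [h1.2]
  have h4 := mul_le_mul_of_nonneg_left h3 hε.le
  have h5 : modelFiber v ε y b - modelFiber v ε y a ≤ (1 + ε * L) * E := by
    rcases le_total a b with hle | hle
    · have := hN.fiber_upper (y := y) hle
      rw [add_zero] at this
      exact this.trans (mul_le_mul_of_nonneg_left hab (by positivity))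
    · have := (hN.fiber_strictMono y).monotone hle
      have h6 : 0 ≤ (1 + ε * L) * E := by positivity
      linarith
  have h7 : modelFiber v ε 0 b - modelFiber v ε y b = ε * (v 0 b - v y b) := by
    simp only [modelFiber]; ring
  linarith

lemma abs_fiberOrbit_zero_lt (hε : 0 < ε) (hεL : ε * L ≤ 1 / 1000) {ρ x : ℝ} (hρ : 0 < ρ)
    (hρ' : ρ ≤ 1 / 40) {k j : ℕ} (hjk : j ≤ k)
    (hx : |fiberOrbit (modelBase i) (modelFiber v ε) k 0 x| < ρ) :
    |fiberOrbit (modelBase i) (modelFiber v ε) j 0 x| < ρ := by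
  have hN := NearModel.model h hε hεL
  have hc := h.c_pos
  induction k, hjk using Nat.le_induction with
  | base => exact hx
  | succ k _ ih =>
    apply ih
    rw [fiberOrbit_succ, modelBase_iterate, mul_zero] at hx
    set b := fiberOrbit (modelBase i) (modelFiber v ε) k 0 x
    have hmono := hN.fiber_strictMono 0
    have habs : |ρ| ≤ 1 / 40 := by rwa [abs_of_pos hρ]
    have h1 := h.expand_zero 0 ρ (by norm_num) habs hρ.le
    have h2 := h.expand_zero (-ρ) 0 (by rwa [abs_neg]) (by norm_num) (by linarith)
    rw [h.zero_zero] at h1 h2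
    have h3 : 0 ≤ c * ρ := by positivity
    have h5 : 0 ≤ ε * v 0 ρ := mul_nonneg hε.le (by linarith)
    have h6 : ε * v 0 (-ρ) ≤ 0 := mul_nonpos_of_nonneg_of_nonpos hε.le (by linarith)
    rw [abs_lt] at hx ⊢
    constructor
    · refine hmono.lt_iff_lt.1 (lt_of_le_of_lt ?_ hx.1)
      change -ρ + ε * v 0 (-ρ) ≤ -ρ
      linarith
    · refine hmono.lt_iff_lt.1 (lt_of_lt_of_le hx.2 ?_)
      change ρ ≤ ρ + ε * v 0 ρ
      linarith

/-- After a fixed number of iterates, every curve of small slope passes over an integer at a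
definite distance from the repelling point. If it were near that point over `0`, then over `1` it
would be strictly higher, since the curves are pushed upwards over `1/i`, but by less than `1`. -/
lemma exists_away_from_int (hε : 0 < ε) (hεL : ε * L ≤ 1 / 1000) :
    ∃ ρ > 0, ρ ≤ 1 / 40 ∧ ∃ k : ℕ, ∀ C : ℝ → ℝ, (∀ t t', |C t - C t'| ≤ 1 / 100 * |t - t'|) →
      ∃ (s : ℝ) (J : ℤ), (i : ℝ) ^ k * s = J ∧
        ∀ m : ℤ, ρ ≤ |fiberOrbit (modelBase i) (modelFiber v ε) k s (C s) - m| := by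
  have hi := h.two_le_cast
  have hi0 : (0 : ℝ) < i := by linarith
  have hN := NearModel.model h hε hεL
  have hL := h.L_pos
  set w := v (1 / (i : ℝ)) 0 with hw
  have hw0 : 0 < w := h.section_pos
  set ρ := ε * w / 5 with hρ
  have hρ0 : 0 < ρ := by positivity
  have hwL : w ≤ L := (le_abs_self _).trans (h.bound _ _)
  have hρ1 : ρ ≤ 1 / 5000 := by
    have := mul_le_mul_of_nonneg_left hwL hε.le
    linarith
  obtain ⟨k, hk⟩ := exists_pow_lt_of_lt_one hρ0 (show (3 / 4 : ℝ) < 1 by norm_num)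
  refine ⟨ρ, hρ0, by linarith, k + 1, fun C hC => ?_⟩
  by_contra! hcon
  set s : ℝ := 1 / (i : ℝ) ^ (k + 1) with hs
  have hs0 : 0 < s := by positivity
  have his : (i : ℝ) ^ (k + 1) * s = 1 := by rw [hs]; field_simp
  obtain ⟨m, hm⟩ := hcon 0 0 (by simp)
  obtain ⟨m', hm'⟩ := hcon s 1 (by rw [his]; simp)
  set b : ℕ → ℝ := fun j => fiberOrbit (modelBase i) (modelFiber v ε) j 0 (C 0 + (-m : ℤ)) with hb
  set a : ℕ → ℝ := fun j => fiberOrbit (modelBase i) (modelFiber v ε) j s (C s + (-m : ℤ)) with ha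
  have hbk : |b (k + 1)| < ρ := by
    simp only [hb]
    rw [h.fiberOrbit_add_int_right]
    push_cast
    exact hm
  have hbj : ∀ j ≤ k + 1, |b j| ≤ ρ := fun j hj =>
    (h.abs_fiberOrbit_zero_lt hε hεL hρ0 (by linarith) hj hbk).le
  have hbs : ∀ j, b (j + 1) = modelFiber v ε 0 (b j) := fun j => by
    simp only [hb]; rw [fiberOrbit_succ, modelBase_iterate, mul_zero]
  have has : ∀ j, a (j + 1) = modelFiber v ε ((i : ℝ) ^ j * s) (a j) := fun j => by
    simp only [ha]; rw [fiberOrbit_succ, modelBase_iterate]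
  have key : ∀ j ≤ k, b j - a j ≤ (1 + ε * L) ^ j * (1 / 100 * s) + ρ * ((i : ℝ) ^ j * s) := by
    intro j
    induction j with
    | zero =>
      intro _
      have h1 := (abs_le.1 (hC 0 s)).2
      rw [zero_sub, abs_neg, abs_of_pos hs0] at h1
      simp only [hb, ha, fiberOrbit_zero, pow_zero]
      have : 0 ≤ ρ * (1 * s) := by positivity
      linarith
    | succ j ih =>
      intro hj
      have h1 := h.fiber_zero_sub_le hε hεL (y := (i : ℝ) ^ j * s) (by positivity)
        (hbj j (by omega)) (by positivity) (ih (by omega))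
      rw [hbs, has]
      have h2 : 0 ≤ ε * v ((i : ℝ) ^ j * s) 0 := mul_nonneg hε.le (h.section_nonneg _)
      have h3 : 0 ≤ ρ * ((i : ℝ) ^ j * s) := by positivity
      have h4 : (1 + 2 * (ε * L)) * (ρ * ((i : ℝ) ^ j * s)) ≤ i * (ρ * ((i : ℝ) ^ j * s)) :=
        mul_le_mul_of_nonneg_right (by linarith) h3
      rw [pow_succ' (1 + ε * L), pow_succ' (i : ℝ)]
      linarith
  have hfin := h.fiber_zero_sub_le hε hεL (y := (i : ℝ) ^ k * s) (by positivity)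
    (hbj k (by omega)) (by positivity) (key k le_rfl)
  have hik : (i : ℝ) ^ k * s = 1 / i := by rw [hs, pow_succ]; field_simp
  rw [← hbs, ← has, hik] at hfin
  have hpow : (1 + ε * L) ^ k * s ≤ (3 / 4) ^ k := by
    have h1 : s ≤ (1 / 2) ^ k := by
      rw [hs, one_div, one_div, inv_pow]
      refine inv_anti₀ (by positivity) ?_
      calc (2 : ℝ) ^ k ≤ (i : ℝ) ^ k := pow_le_pow_left₀ (by norm_num) hi k
        _ ≤ _ := pow_le_pow_right₀ (by linarith) (by omega)
    calc _ ≤ (3 / 2) ^ k * (1 / 2 : ℝ) ^ k :=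
          mul_le_mul (pow_le_pow_left₀ (by positivity) (by linarith) k) h1 hs0.le (by positivity)
      _ = (3 / 4) ^ k := by rw [← mul_pow]; norm_num
  have h1i : 1 / (i : ℝ) ≤ 1 / 2 := by
    rw [div_le_div_iff₀ hi0 (by norm_num)]; linarith
  have h1i0 : 0 < 1 / (i : ℝ) := by positivity
  have hgap : b (k + 1) - a (k + 1) ≤ -3 * ρ := by
    have h1 : ε * L * ρ * (1 / i) ≤ ρ * (1 / 2) := by
      have : ε * L * ρ ≤ 1 * ρ := mul_le_mul_of_nonneg_right (by linarith) hρ0.le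
      nlinarith
    have h2 : (1 + ε * L) * ((1 + ε * L) ^ k * (1 / 100 * s) + ρ * (1 / i)) ≤ 3 / 2 * ρ := by
      have h3 : (1 + ε * L) ^ k * (1 / 100 * s) + ρ * (1 / i) ≤ 51 / 100 * ρ := by nlinarith
      calc _ ≤ (1 + ε * L) * (51 / 100 * ρ) := mul_le_mul_of_nonneg_left h3 (by positivity)
        _ ≤ 2 * (51 / 100 * ρ) := mul_le_mul_of_nonneg_right (by linarith) (by positivity)
        _ ≤ _ := by linarith
    have h4 : ε * w = 5 * ρ := by rw [hρ]; ring
    rw [← hw] at hfin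
    linarith
  have hcone := abs_le.1 (hN.cone_iterate (y := 0) (y' := s) (x := C 0 + (-m : ℤ))
    (x' := C s + (-m : ℤ)) (by rw [add_sub_add_right_eq_sub]; exact hC 0 s) (k + 1))
  rw [modelBase_iterate, modelBase_iterate, his, mul_zero, zero_sub, abs_neg, abs_one] at hcone
  have hcone1 : -(1 / 100 * 1) ≤ b (k + 1) - a (k + 1) := hcone.1
  have hak : |a (k + 1) - ((m' - m : ℤ) : ℝ)| < ρ := by
    simp only [ha]
    rw [h.fiberOrbit_add_int_right]
    push_cast
    rwa [show ∀ z : ℝ, z + -(m : ℝ) - (m' - m) = z - m' from fun z => by ring]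
  rw [abs_lt] at hak hbk
  have hlo : (0 : ℝ) < ((m' - m : ℤ) : ℝ) := by linarith
  have hhi : ((m' - m : ℤ) : ℝ) < 1 := by linarith
  norm_cast at hlo hhi
  omega

/-- Over points `y` near `0`, the maps move the points of `[α, 1/2 - 1/80]` towards `1/2` by a
definite amount, and likewise on the other side. -/
lemma exists_drift {α : ℝ} (hα : 0 < α) (hα' : α ≤ 1 / 40) :
    ∃ μ > 0, ∃ r > 0, L * r ≤ c / 2 ∧ ∀ y, |y| ≤ r →
      (∀ x ∈ Set.Icc α (1 / 2 - 1 / 80), μ ≤ v y x) ∧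
        ∀ x ∈ Set.Icc (1 / 2 + 1 / 80) (1 - α), v y x ≤ -μ := by
  have hL := h.L_pos
  have hc := h.c_pos
  have hcont : Continuous (v 0) :=
    h.smooth.continuous.comp (Continuous.prodMk continuous_const continuous_id)
  obtain ⟨x₁, hx₁, hmin⟩ := isCompact_Icc.exists_isMinOn
    (Set.nonempty_Icc.2 (show α ≤ 1 / 2 - 1 / 80 by linarith)) hcont.continuousOn
  obtain ⟨x₂, hx₂, hmax⟩ := isCompact_Icc.exists_isMaxOn
    (Set.nonempty_Icc.2 (show 1 / 2 + 1 / 80 ≤ 1 - α by linarith)) hcont.continuousOn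
  have h1 : 0 < v 0 x₁ := h.zero_pos x₁ (by linarith [hx₁.1]) (by linarith [hx₁.2])
  have h2 : v 0 x₂ < 0 := h.zero_neg x₂ (by linarith [hx₂.1]) (by linarith [hx₂.2])
  set μ := min (v 0 x₁) (-v 0 x₂) / 2 with hμ
  have hμ0 : 0 < μ := half_pos (lt_min h1 (by linarith))
  have hμ1 : 2 * μ ≤ v 0 x₁ := by rw [hμ]; linarith [min_le_left (v 0 x₁) (-v 0 x₂)]
  have hμ2 : 2 * μ ≤ -v 0 x₂ := by rw [hμ]; linarith [min_le_right (v 0 x₁) (-v 0 x₂)]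
  set r := min (c / 2) μ / L with hr
  have hLr : L * r = min (c / 2) μ := by rw [hr]; field_simp
  refine ⟨μ, hμ0, r, by positivity, hLr.le.trans (min_le_left _ _), fun y hy => ?_⟩
  have hlip : ∀ x, |v y x - v 0 x| ≤ μ := by
    intro x
    have h3 := h.lip_left y 0 x
    rw [sub_zero] at h3
    exact h3.trans ((mul_le_mul_of_nonneg_left hy hL.le).trans (hLr.le.trans (min_le_right _ _)))
  constructor
  · intro x hx
    have h3 : v 0 x₁ ≤ v 0 x := hmin hx
    linarith [(abs_le.1 (hlip x)).1]
  · intro x hx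
    have h3 : v 0 x ≤ v 0 x₂ := hmax hx
    linarith [(abs_le.1 (hlip x)).2]

omit h in
lemma abs_pow_mul_le_of_le {i r t : ℝ} (hi : 1 ≤ i) {j m : ℕ} (hjm : j ≤ m)
    (ht : i ^ m * |t| ≤ r) : |i ^ j * t| ≤ r := by
  rw [abs_mul, abs_of_nonneg (by positivity)]
  exact (mul_le_mul_of_nonneg_right (pow_le_pow_right₀ hi hjm) (abs_nonneg t)).trans ht

/-- Orbits over points near `0` enter the interval of radius `1/80` around `1/2`. -/
lemma fiberOrbit_mem_Icc (hε : 0 < ε) (hεL : ε * L ≤ 1 / 1000) {α μ r : ℝ} (hμ : 0 < μ)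
    (hdrift : ∀ y, |y| ≤ r → (∀ x ∈ Set.Icc α (1 / 2 - 1 / 80), μ ≤ v y x) ∧
        ∀ x ∈ Set.Icc (1 / 2 + 1 / 80) (1 - α), v y x ≤ -μ) {α' x t : ℝ} (hα : α ≤ α')
    (hα' : α' ≤ 1 / 2 - 1 / 80) (hx : x ∈ Set.Icc α' (1 - α')) (m : ℕ)
    (ht : (i : ℝ) ^ m * |t| ≤ r) :
    fiberOrbit (modelBase i) (modelFiber v ε) m t x ∈
      Set.Icc (min (α' + m * (ε * μ)) (1 / 2 - 1 / 80))
        (max (1 - α' - m * (ε * μ)) (1 / 2 + 1 / 80)) := by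
  have hi := h.two_le_cast
  have hN := NearModel.model h hε hεL
  have hεμ : 0 < ε * μ := mul_pos hε hμ
  have key : ∀ j ≤ m, fiberOrbit (modelBase i) (modelFiber v ε) j t x ∈
      Set.Icc (min (α' + j * (ε * μ)) (1 / 2 - 1 / 80))
        (max (1 - α' - j * (ε * μ)) (1 / 2 + 1 / 80)) := by
    intro j
    induction j with
    | zero =>
      intro _
      rw [fiberOrbit_zero]
      exact ⟨(min_le_left _ _).trans (by simpa using hx.1),
        le_trans (by simpa using hx.2) (le_max_left _ _)⟩
    | succ j ih =>
      intro hj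
      obtain ⟨h1, h2⟩ := ih (by omega)
      have hyr := abs_pow_mul_le_of_le (by linarith) (show j ≤ m by omega) ht
      obtain ⟨d1, d2⟩ := hdrift _ hyr
      have hmono := (hN.fiber_strictMono ((i : ℝ) ^ j * t)).monotone
      have hj0 : 0 ≤ (j : ℝ) * (ε * μ) := by positivity
      rw [fiberOrbit_succ, modelBase_iterate]
      set p := min (α' + j * (ε * μ)) (1 / 2 - 1 / 80) with hp
      set q := max (1 - α' - j * (ε * μ)) (1 / 2 + 1 / 80) with hq
      push_cast
      constructor
      · refine le_trans ?_ (hmono h1)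
        have h3 := d1 p ⟨le_min (by linarith) (by linarith), min_le_right _ _⟩
        have h4 := mul_le_mul_of_nonneg_left h3 hε.le
        change _ ≤ p + ε * v _ p
        refine le_trans ?_ (add_le_add_right h4 p)
        rw [hp, min_add]
        exact min_le_min (by linarith) (by linarith)
      · refine le_trans (hmono h2) ?_
        have h3 := d2 q ⟨le_max_right _ _, max_le (by linarith) (by linarith)⟩
        have h4 := mul_le_mul_of_nonneg_left h3 hε.le
        change q + ε * v _ q ≤ _
        refine le_trans (add_le_add_right h4 q) ?_
        rw [hq, max_add]
        exact max_le_max (by linarith) (by linarith)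
  exact key m le_rfl

/-- Near the attracting fixed point `1/2` over `0`, orbits over the same base point approach each
other. -/
lemma fiberOrbit_contract (hε : 0 < ε) (hεL : ε * L ≤ 1 / 1000) {α μ r : ℝ} (hμ : 0 < μ)
    (hr : L * r ≤ c / 2)
    (hdrift : ∀ y, |y| ≤ r → (∀ x ∈ Set.Icc α (1 / 2 - 1 / 80), μ ≤ v y x) ∧
        ∀ x ∈ Set.Icc (1 / 2 + 1 / 80) (1 - α), v y x ≤ -μ) (hα : α ≤ 1 / 40)
    {x x' t : ℝ} (hx : |x - 1 / 2| ≤ 1 / 80) (hx' : |x' - 1 / 2| ≤ 1 / 80)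
    (m : ℕ) (ht : (i : ℝ) ^ m * |t| ≤ r) :
    |fiberOrbit (modelBase i) (modelFiber v ε) m t x -
      fiberOrbit (modelBase i) (modelFiber v ε) m t x'| ≤ (1 - ε * c / 2) ^ m := by
  have hi := h.two_le_cast
  have hN := NearModel.model h hε hεL
  have hL := h.L_pos
  have hc := h.c_pos
  wlog hxx : x ≤ x' generalizing x x'
  · rw [abs_sub_comm]
    exact this hx' hx (le_of_not_ge hxx)
  have hmem : ∀ z, |z - 1 / 2| ≤ 1 / 80 → ∀ j ≤ m,
      |fiberOrbit (modelBase i) (modelFiber v ε) j t z - 1 / 2| ≤ 1 / 40 := by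
    intro z hz j hj
    have hz' := abs_le.1 hz
    have h1 := h.fiberOrbit_mem_Icc hε hεL hμ hdrift (α' := 1 / 2 - 1 / 80) (by linarith) le_rfl
      (x := z) (t := t) ⟨by linarith [hz'.1], by linarith [hz'.2]⟩ j
      ((mul_le_mul_of_nonneg_right (pow_le_pow_right₀ (by linarith) hj) (abs_nonneg t)).trans ht)
    have hj0 : 0 ≤ (j : ℝ) * (ε * μ) := by positivity
    rw [min_eq_right (by linarith), max_eq_right (by linarith)] at h1
    rw [abs_le]
    constructor <;> linarith [h1.1, h1.2]
  have hcL : ε * c ≤ 1 / 1000 := by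
    have h1 := h.contract_half (1 / 2) (1 / 2 + 1 / 40) (by norm_num) (by norm_num) (by norm_num)
    have h2 := (abs_le.1 (h.lip_right 0 (1 / 2 + 1 / 40) (1 / 2))).1
    rw [abs_of_pos (by norm_num)] at h2
    have h3 : c ≤ L := by linarith
    exact (mul_le_mul_of_nonneg_left h3 hε.le).trans hεL
  have key : ∀ j ≤ m, fiberOrbit (modelBase i) (modelFiber v ε) j t x' -
      fiberOrbit (modelBase i) (modelFiber v ε) j t x ≤ (1 - ε * c / 2) ^ j := by
    intro j
    induction j with
    | zero =>
      intro _
      have h1 := abs_le.1 hx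
      have h2 := abs_le.1 hx'
      simp only [fiberOrbit_zero, pow_zero]
      linarith [h1.1, h2.2]
    | succ j ih =>
      intro hj
      have hI := ih (by omega)
      have hu := hmem x hx j (by omega)
      have hu' := hmem x' hx' j (by omega)
      have huu := (hN.fiberOrbit_strictMono j t).monotone hxx
      rw [fiberOrbit_succ, fiberOrbit_succ, modelBase_iterate]
      set u := fiberOrbit (modelBase i) (modelFiber v ε) j t x
      set u' := fiberOrbit (modelBase i) (modelFiber v ε) j t x'
      have huu' : u ≤ u' := huu
      have h1 := h.contract_half u u' hu hu' huu'
      have hyr := abs_pow_mul_le_of_le (by linarith) (show j ≤ m by omega) ht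
      have h2 := (abs_le.1 (h.mixed ((i : ℝ) ^ j * t) 0 u' u)).2
      rw [sub_zero, abs_of_nonneg (sub_nonneg.2 huu')] at h2
      have h3 : L * |(i : ℝ) ^ j * t| * (u' - u) ≤ c / 2 * (u' - u) :=
        mul_le_mul_of_nonneg_right ((mul_le_mul_of_nonneg_left hyr hL.le).trans hr)
          (sub_nonneg.2 huu')
      have h4 : v ((i : ℝ) ^ j * t) u' - v ((i : ℝ) ^ j * t) u ≤ -(c / 2) * (u' - u) := by
        linarith
      have h5 := mul_le_mul_of_nonneg_left h4 hε.le
      have h6 := mul_le_mul_of_nonneg_left hI (show 0 ≤ 1 - ε * c / 2 by linarith)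
      have h7 : modelFiber v ε ((i : ℝ) ^ j * t) u' - modelFiber v ε ((i : ℝ) ^ j * t) u =
        (u' - u) + ε * (v ((i : ℝ) ^ j * t) u' - v ((i : ℝ) ^ j * t) u) := by
        simp only [modelFiber]; ring
      rw [h7, pow_succ']
      linarith
  rw [abs_sub_comm, abs_of_nonneg (sub_nonneg.2 ((hN.fiberOrbit_strictMono m t).monotone hxx))]
  exact key m le_rfl

lemma fiberOrbit_abs_upper (hε : 0 < ε) (hεL : ε * L ≤ 1 / 1000) (n : ℕ) (y x x' : ℝ) :
    |fiberOrbit (modelBase i) (modelFiber v ε) n y x -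
      fiberOrbit (modelBase i) (modelFiber v ε) n y x'| ≤ 2 ^ n * |x - x'| := by
  have hN := NearModel.model h hε hεL
  induction n with
  | zero => simp
  | succ n ih =>
    rw [fiberOrbit_succ, fiberOrbit_succ, pow_succ']
    refine (hN.fiber_abs_upper _ _ _).trans ?_
    rw [add_zero, mul_assoc]
    exact mul_le_mul (by linarith) ih (abs_nonneg _) (by norm_num)

/-- The unstable curve through the saddle point `(0, 1/2)` attracts: starting over `s / i ^ k`
away from the repelling fixed point, the `k`-th image is close to the curve. -/
lemma eventually_near_saddle_curve (hε : 0 < ε) (hεL : ε * L ≤ 1 / 1000) {H : ℕ → ℝ → ℝ}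
    (hH0 : ∀ n, H n 0 = 1 / 2) (hHlip : ∀ n t t', |H n t - H n t'| ≤ 1 / 100 * |t - t'|)
    (hH : ∀ n t, H n (i * t) = modelFiber v ε t (H (n + 1) t)) {α : ℝ} (hα : 0 < α)
    (hα' : α ≤ 1 / 40) (s : ℝ) {σ : ℝ} (hσ : 0 < σ) :
    ∀ᶠ k in atTop, ∀ x ∈ Set.Icc α (1 - α),
      |fiberOrbit (modelBase i) (modelFiber v ε) k (s / (i : ℝ) ^ k) x - H 0 s| < σ := by
  have hi := h.two_le_cast
  have hi0 : (0 : ℝ) < i := by linarith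
  have hc := h.c_pos
  have hL := h.L_pos
  obtain ⟨μ, hμ, r, hr, hLr, hdrift⟩ := h.exists_drift hα hα'
  have hεμ : 0 < ε * μ := mul_pos hε hμ
  have hiter : ∀ j n t, fiberOrbit (modelBase i) (modelFiber v ε) j t (H (n + j) t) =
      H n ((i : ℝ) ^ j * t) := by
    intro j
    induction j with
    | zero => intro n t; simp
    | succ j ih =>
      intro n t
      rw [fiberOrbit_succ, show n + (j + 1) = (n + 1) + j by ring, ih, modelBase_iterate,
        pow_succ', mul_assoc, hH]
  -- `l` steps near the end, `m₁` steps to come close to `1/2`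
  obtain ⟨l, hl⟩ := pow_unbounded_of_one_lt (|s| / min r 1) (show 1 < (i : ℝ) by linarith)
  rw [div_lt_iff₀ (by positivity)] at hl
  have hl1 : |s| < (i : ℝ) ^ l * r :=
    hl.trans_le (mul_le_mul_of_nonneg_left (min_le_left _ _) (by positivity))
  have hl2 : |s| < (i : ℝ) ^ l * 1 :=
    hl.trans_le (mul_le_mul_of_nonneg_left (min_le_right _ _) (by positivity))
  obtain ⟨m₁, hm₁⟩ := exists_nat_gt (1 / (ε * μ))
  rw [div_lt_iff₀ hεμ] at hm₁
  have hcε : ε * c ≤ 1 := by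
    have h1 := h.contract_half (1 / 2) (1 / 2 + 1 / 40) (by norm_num) (by norm_num) (by norm_num)
    have h2 := (abs_le.1 (h.lip_right 0 (1 / 2 + 1 / 40) (1 / 2))).1
    rw [abs_of_pos (by norm_num)] at h2
    have h3 : c ≤ L := by linarith
    linarith [mul_le_mul_of_nonneg_left h3 hε.le]
  have hlim : Tendsto (fun m : ℕ => 2 ^ l * (1 - ε * c / 2) ^ m) atTop (𝓝 0) := by
    have := (tendsto_pow_atTop_nhds_zero_of_lt_one (r := 1 - ε * c / 2) (by linarith)
      (by linarith [mul_pos hε hc])).const_mul ((2 : ℝ) ^ l)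
    simpa using this
  obtain ⟨m₂, hm₂⟩ := eventually_atTop.1 (hlim.eventually (gt_mem_nhds hσ))
  filter_upwards [eventually_ge_atTop (l + (m₂ + m₁))] with k hk x hx
  obtain ⟨m, hm, rfl⟩ : ∃ m, m₂ ≤ m ∧ k = l + (m + m₁) := ⟨k - l - m₁, by omega, by omega⟩
  set t := s / (i : ℝ) ^ (l + (m + m₁)) with ht
  have ht1 : (i : ℝ) ^ m * ((i : ℝ) ^ m₁ * t) = s / (i : ℝ) ^ l := by
    rw [ht, pow_add, pow_add]; field_simp
  have htr : |s / (i : ℝ) ^ l| ≤ r := by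
    rw [abs_div, abs_of_pos (by positivity : (0 : ℝ) < i ^ l), div_le_iff₀ (by positivity)]
    linarith
  have hend : (i : ℝ) ^ (l + (m + m₁)) * t = s := by rw [ht]; field_simp
  have hHs : H 0 s = fiberOrbit (modelBase i) (modelFiber v ε) l (s / (i : ℝ) ^ l)
      (fiberOrbit (modelBase i) (modelFiber v ε) m ((i : ℝ) ^ m₁ * t)
        (H (l + m) ((i : ℝ) ^ m₁ * t))) := by
    rw [hiter m l, ht1]
    have := hiter l 0 (s / (i : ℝ) ^ l)
    rw [zero_add] at this
    rw [this]
    congr 1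
    field_simp
  have hm_le : (i : ℝ) ^ m * |(i : ℝ) ^ m₁ * t| ≤ r := by
    rw [← abs_of_pos (show (0 : ℝ) < (i : ℝ) ^ m by positivity), ← abs_mul, ht1]
    exact htr
  have hm₁_le : (i : ℝ) ^ m₁ * |t| ≤ r := by
    rw [← abs_of_pos (show (0 : ℝ) < (i : ℝ) ^ m₁ by positivity), ← abs_mul]
    refine le_trans ?_ hm_le
    exact le_mul_of_one_le_left (abs_nonneg _) (one_le_pow₀ (by linarith))
  have hx₁ : |fiberOrbit (modelBase i) (modelFiber v ε) m₁ t x - 1 / 2| ≤ 1 / 80 := by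
    have h1 := h.fiberOrbit_mem_Icc hε hεL hμ hdrift le_rfl (by linarith) hx m₁ hm₁_le
    rw [min_eq_right (by linarith), max_eq_right (by linarith)] at h1
    rw [abs_le]
    constructor <;> linarith [h1.1, h1.2]
  have hHx : |H (l + m) ((i : ℝ) ^ m₁ * t) - 1 / 2| ≤ 1 / 80 := by
    have h1 := hHlip (l + m) ((i : ℝ) ^ m₁ * t) 0
    rw [hH0, sub_zero] at h1
    have h2 : |(i : ℝ) ^ m₁ * t| ≤ 1 := by
      have h3 : |(i : ℝ) ^ m * ((i : ℝ) ^ m₁ * t)| ≤ 1 := by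
        rw [ht1, abs_div, abs_of_pos (by positivity : (0 : ℝ) < i ^ l),
          div_le_one (by positivity)]
        linarith
      rw [abs_mul, abs_of_pos (show (0 : ℝ) < (i : ℝ) ^ m by positivity)] at h3
      exact (le_mul_of_one_le_left (abs_nonneg _) (one_le_pow₀ (by linarith))).trans h3
    linarith
  rw [fiberOrbit_add, fiberOrbit_add, modelBase_iterate, modelBase_iterate, pow_add, mul_assoc,
    ht1, hHs]
  refine (h.fiberOrbit_abs_upper hε hεL l _ _ _).trans_lt ?_
  refine lt_of_le_of_lt (mul_le_mul_of_nonneg_left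
    (h.fiberOrbit_contract hε hεL hμ hLr hdrift hα' hx₁ hHx m hm_le) (by positivity)) (hm₂ m hm)

/-- Every nonempty open set is met by the images under one fixed iterate of all curves of small
slope. -/
theorem exists_iterate_meets_curves (hε : 0 < ε) (hεL : ε * L ≤ 1 / 1000)
    (hβ : Irrational (2 * (ε * θ)))
    (hT : ∀ w, T (torusMk w) = torusMk (skew (modelBase i) (modelFiber v ε) w))
    {V : Set (UnitAddCircle × UnitAddCircle)} (hV : IsOpen V) (hne : V.Nonempty) :
    ∃ N : ℕ, ∀ C : ℝ → ℝ, (∀ t t', |C t - C t'| ≤ 1 / 100 * |t - t'|) →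
      ∃ s, T^[N] (torusMk (s, C s)) ∈ V := by
  have hi := h.two_le_cast
  have hi0 : (0 : ℝ) < i := by linarith
  have hN := NearModel.model h hε hεL
  -- the unstable curve of the saddle `(0, 1/2)`
  obtain ⟨ℓ, hℓ0, hℓlip, hℓ⟩ := h.exists_leaf hε hεL (fun _ => 0) (fun _ => 1 / 2)
  set H : ℕ → ℝ → ℝ := fun n t => 1 / 2 + ℓ n t with hH
  have hHlip : ∀ n t t', |H n t - H n t'| ≤ 1 / 100 * |t - t'| := by
    intro n t t'
    simp only [hH]
    rw [add_sub_add_left_eq_sub]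
    exact hℓlip n t t'
  have hHs : ∀ n t, H n (i * t) = modelFiber v ε t (H (n + 1) t) := by
    intro n t
    simp only [hH]
    rw [hℓ, zero_add]
    simp only [modelFiber, h.zero_half]
    ring
  obtain ⟨n, s, σ, hσ, hn⟩ := h.exists_iterate_mem_of_curve hε hεL hβ hT hV hne (hHlip 0)
  obtain ⟨ρ, hρ, hρ', k₀, hk₀⟩ := h.exists_away_from_int hε hεL
  have hlim : Tendsto (fun k : ℕ => |s| / (i : ℝ) ^ k) atTop (𝓝 0) :=
    tendsto_const_nhds.div_atTop (tendsto_pow_atTop_atTop_of_one_lt (by linarith))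
  obtain ⟨k, hk, hk'⟩ := ((h.eventually_near_saddle_curve hε hεL (fun n => by simp [hH, hℓ0])
    hHlip hHs (half_pos hρ) (by linarith) s hσ).and
    (hlim.eventually (gt_mem_nhds (half_pos hρ)))).exists
  refine ⟨n + (k + k₀), fun C hC => ?_⟩
  obtain ⟨s₀, J, hJ, haway⟩ := hk₀ C hC
  set s' := s₀ + s / (i : ℝ) ^ (k₀ + k) with hs'
  have hbase : (i : ℝ) ^ k₀ * s' = s / (i : ℝ) ^ k + J := by
    rw [hs', mul_add, hJ, pow_add]; field_simp; ring
  set x := fiberOrbit (modelBase i) (modelFiber v ε) k₀ s' (C s') with hx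
  have hcone := hN.cone_iterate (y := s') (y' := s₀) (hC s' s₀) k₀
  rw [modelBase_iterate, modelBase_iterate, hbase, hJ, add_sub_cancel_right, abs_div,
    abs_of_pos (by positivity : (0 : ℝ) < i ^ k)] at hcone
  have hxaway : ∀ m : ℤ, ρ / 2 ≤ |x - m| := by
    intro m
    have h1 := haway m
    have h2 := abs_sub_le (fiberOrbit (modelBase i) (modelFiber v ε) k₀ s₀ (C s₀)) x m
    rw [abs_sub_comm _ x] at h2
    change |x - _| ≤ _ at hcone
    linarith
  have hmem : x + ((-⌊x⌋ : ℤ) : ℝ) ∈ Set.Icc (ρ / 2) (1 - ρ / 2) := by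
    have h1 := hxaway ⌊x⌋
    have h2 := hxaway (⌊x⌋ + 1)
    have h3 := Int.floor_le x
    have h4 := (Int.lt_floor_add_one x).le
    push_cast at h2 ⊢
    rw [abs_of_nonneg (by linarith)] at h1
    rw [abs_of_nonpos (by linarith)] at h2
    constructor <;> linarith
  refine ⟨s', ?_⟩
  rw [Function.iterate_add_apply, Function.iterate_add_apply, semiconj_iterate hT k₀,
    skew_iterate, modelBase_iterate, hbase, ← hx]
  have h1 := torusMk_add_int (s / (i : ℝ) ^ k) (x + ((-⌊x⌋ : ℤ) : ℝ)) J ⌊x⌋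
  rw [show x + ((-⌊x⌋ : ℤ) : ℝ) + (⌊x⌋ : ℝ) = x by push_cast; ring] at h1
  rw [h1, semiconj_iterate hT k, skew_iterate, modelBase_iterate, mul_div_cancel₀ _ (by positivity)]
  exact hn _ (hk _ hmem)

end ForcingField

/-! ### Circle maps and their lifts -/

lemma coe_signedRep (z : UnitAddCircle) : ((signedRep z : ℝ) : UnitAddCircle) = z :=
  (AddCircle.equivIoc (1 : ℝ) (-1 / 2)).symm_apply_apply z

lemma signedRep_coe {a : ℝ} (ha : a ∈ Set.Ioc (-1 / 2 : ℝ) (1 / 2)) :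
    signedRep (a : UnitAddCircle) = a := by
  have h1 : ((⟨a, by constructor <;> linarith [ha.1, ha.2]⟩ : Set.Ioc (-1 / 2 : ℝ) (-1 / 2 + 1)) :
      ℝ) = a := rfl
  have h2 := (AddCircle.equivIoc (1 : ℝ) (-1 / 2)).apply_symm_apply
    ⟨a, by constructor <;> linarith [ha.1, ha.2]⟩
  exact congrArg Subtype.val h2

/-- The derivative of a circle map is that of any continuous lift. -/
lemma circleDeriv_eq {φ : ℝ → ℝ} {k : UnitAddCircle → UnitAddCircle} (hφ : IsCircleLift φ k)
    (hc : Continuous φ) (t : ℝ) : circleDeriv k t = deriv φ t := by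
  have h1 : (fun u : ℝ => signedRep (k (t + u) - k t)) =ᶠ[𝓝 0] fun u => φ (t + u) - φ t := by
    have h2 : Tendsto (fun u : ℝ => φ (t + u) - φ t) (𝓝 0) (𝓝 0) := by
      have h3 : Continuous fun u : ℝ => φ (t + u) - φ t := by fun_prop
      simpa using h3.tendsto 0
    filter_upwards [h2.eventually (Ioo_mem_nhds (show (-1 / 2 : ℝ) < 0 by norm_num)
      (show (0 : ℝ) < 1 / 2 by norm_num))] with u hu
    rw [← AddCircle.coe_add, ← hφ, ← hφ, ← AddCircle.coe_sub, signedRep_coe ⟨hu.1, hu.2.le⟩]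
  rw [circleDeriv, h1.deriv_eq, deriv_sub_const, deriv_comp_const_add, add_zero]

lemma map_add_int_of_map_add_one {φ : ℝ → ℝ} (h : ∀ x, φ (x + 1) = φ x + 1) (x : ℝ) (m : ℤ) :
    φ (x + m) = φ x + m := by
  have hp : Function.Periodic (fun x => φ x - x) 1 := fun x => by
    simp only [h]; ring
  have := hp.int_mul m x
  simp only [mul_one] at this
  linarith

/-- A circle map with a smooth increasing lift of degree one with positive derivative is a
diffeomorphism. -/
lemma isCircleDiffeo_of_lift {φ : ℝ → ℝ} {k : UnitAddCircle → UnitAddCircle}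
    (hφ : IsCircleLift φ k) (hs : ContDiff ℝ ∞ φ) (h1 : ∀ x, φ (x + 1) = φ x + 1)
    (hmono : StrictMono φ) (hsurj : Function.Surjective φ) (hd : ∀ x, deriv φ x ≠ 0) :
    IsCircleDiffeo k := by
  refine ⟨⟨φ, hφ, hs⟩, ?_⟩
  set e := (hmono.orderIsoOfSurjective φ hsurj).toHomeomorph with he
  have hee : ∀ x, e x = φ x := fun _ => rfl
  have hsymm : ContDiff ℝ ∞ e.symm :=
    e.contDiff_symm_deriv hd (fun x => ((hs.differentiable (by simp)) x).hasDerivAt) hs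
  have hint : ∀ t (m : ℤ), e.symm (t + m) = e.symm t + m := by
    intro t m
    rw [Homeomorph.symm_apply_eq, hee, map_add_int_of_map_add_one h1, ← hee, e.apply_symm_apply]
  have hlift : IsCircleLift e.symm
      (fun z => ((e.symm (signedRep z) : ℝ) : UnitAddCircle)) := by
    intro t
    obtain ⟨m, hm⟩ := coe_unitAddCircle_eq_iff.1 (coe_signedRep (t : UnitAddCircle))
    simp only [hm, hint]
    exact coe_unitAddCircle_eq_iff.2 ⟨-m, by push_cast; ring⟩
  refine ⟨_, ⟨e.symm, hlift, hsymm⟩, fun z => ?_, fun z => ?_⟩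
  · obtain ⟨t, rfl⟩ := QuotientAddGroup.mk_surjective z
    have h2 : k (t : UnitAddCircle) = (φ t : ℝ) := (hφ t).symm
    change ((e.symm (signedRep (k (t : UnitAddCircle))) : ℝ) : UnitAddCircle) = t
    rw [h2]
    exact (hlift (φ t)).symm.trans (by rw [← hee, e.symm_apply_apply])
  · change k ((e.symm (signedRep z) : ℝ) : UnitAddCircle) = z
    rw [← hφ, ← hee, e.apply_symm_apply, coe_signedRep]

/-- A continuous function on `ℝ²` that is periodic in both variables is bounded. -/
lemma exists_bound_of_periodic_prod {E : Type*} [NormedAddCommGroup E] {u : ℝ × ℝ → E}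
    (hu : Continuous u) (hp : ∀ z (m n : ℤ), u (z + ((m : ℝ), (n : ℝ))) = u z) :
    ∃ M : ℝ, ∀ z, ‖u z‖ ≤ M := by
  obtain ⟨M, hM⟩ := ((isCompact_Icc (a := (0 : ℝ)) (b := 1)).prod
    (isCompact_Icc (a := (0 : ℝ)) (b := 1))).exists_bound_of_continuousOn hu.continuousOn
  refine ⟨M, fun z => ?_⟩
  have h1 := hM (z + (((-⌊z.1⌋ : ℤ) : ℝ), ((-⌊z.2⌋ : ℤ) : ℝ))) (by
    simp only [Set.mem_prod, Set.mem_Icc, Prod.fst_add, Prod.snd_add]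
    push_cast
    refine ⟨⟨?_, ?_⟩, ?_, ?_⟩ <;>
      linarith [Int.floor_le z.1, (Int.lt_floor_add_one z.1).le, Int.floor_le z.2,
        (Int.lt_floor_add_one z.2).le])
  rwa [hp] at h1

/-- A continuous real function whose values are integers is constant. -/
lemma eq_of_continuous_of_forall_int {X : Type*} [TopologicalSpace X] [PreconnectedSpace X]
    {u : X → ℝ} (hu : Continuous u) (hint : ∀ x, ∃ m : ℤ, u x = m) (x y : X) : u x = u y := by
  choose m hm using hint
  have hmc : Continuous m := by
    rw [Int.isClosedEmbedding_coe_real.isInducing.continuous_iff]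
    exact hu.congr hm
  rw [hm, hm, PreconnectedSpace.constant ‹_› hmc]

/-! ### The model as a skew product of the torus -/

namespace ForcingField

variable {i : ℤ} {v : ℝ → ℝ → ℝ} {L c θ ε : ℝ} (h : ForcingField i v L c θ)
include h

lemma apply_eq_of_coe_eq {y y' x x' : ℝ} (hy : (y : UnitAddCircle) = y')
    (hx : (x : UnitAddCircle) = x') : v y x = v y' x' := by
  obtain ⟨m, rfl⟩ := coe_unitAddCircle_eq_iff.1 hy
  obtain ⟨n, rfl⟩ := coe_unitAddCircle_eq_iff.1 hx
  rw [h.add_int_left, h.add_int_right]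

lemma fiber_coe (y x : ℝ) : (x : UnitAddCircle) +
    ((ε * v (signedRep (y : UnitAddCircle)) (signedRep (x : UnitAddCircle)) : ℝ) : UnitAddCircle) =
      ((x + ε * v y x : ℝ) : UnitAddCircle) := by
  rw [AddCircle.coe_add, h.apply_eq_of_coe_eq (coe_signedRep _) (coe_signedRep _)]

lemma contDiff_modelFiber (y : ℝ) : ContDiff ℝ ∞ (modelFiber v ε y) := by
  have h1 : ContDiff ℝ ∞ (v y) := h.smooth.comp (contDiff_const.prodMk contDiff_id)
  exact contDiff_id.add (contDiff_const.mul h1)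

lemma differentiable_v (y : ℝ) : Differentiable ℝ (v y) :=
  (h.smooth.comp (contDiff_const.prodMk contDiff_id)).differentiable (by simp)

lemma deriv_modelFiber (y x : ℝ) : deriv (modelFiber v ε y) x = 1 + ε * deriv (v y) x := by
  have h1 := (hasDerivAt_id x).add (((h.differentiable_v y) x).hasDerivAt.const_mul ε)
  exact h1.deriv

lemma abs_deriv_v_le (y x : ℝ) : |deriv (v y) x| ≤ L := by
  have h1 : LipschitzWith L.toNNReal (v y) := LipschitzWith.of_dist_le_mul fun a b => by
    rw [Real.coe_toNNReal _ h.L_pos.le, Real.dist_eq, Real.dist_eq]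
    exact h.lip_right y a b
  have h2 := norm_deriv_le_of_lipschitz (x₀ := x) h1
  rwa [Real.coe_toNNReal _ h.L_pos.le] at h2

lemma deriv_modelFiber_mem (hε : 0 < ε) (hεL : ε * L ≤ 1 / 1000) (y x : ℝ) :
    deriv (modelFiber v ε y) x ∈ Set.Icc (999 / 1000 : ℝ) (1001 / 1000) := by
  have h1 := abs_le.1 (h.abs_deriv_v_le y x)
  rw [h.deriv_modelFiber]
  constructor <;> nlinarith [h1.1, h1.2]

/-- The skew product `(y, x) ↦ (i y, x + ε v(y, x))` of the torus. -/
noncomputable def toForced (hε : 0 < ε) (hεL : ε * L ≤ 1 / 1000) : ForcedCircleDiffeo where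
  base y := i • y
  fiber y x := x + ((ε * v (signedRep y) (signedRep x) : ℝ) : UnitAddCircle)
  smooth := by
    refine ⟨skew (modelBase i) (modelFiber v ε), fun s t => ?_, ?_⟩
    · simp only [skew, modelBase, modelFiber, h.fiber_coe]
      rw [← AddCircle.coe_zsmul, zsmul_eq_mul]
    · exact (contDiff_const.mul contDiff_fst).prodMk
        (contDiff_snd.add (contDiff_const.mul h.smooth))
  expanding := by
    intro y
    obtain ⟨s, rfl⟩ := QuotientAddGroup.mk_surjective y
    have hlift : IsCircleLift (modelBase i) fun y => i • y := fun t => by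
      change _ = i • (t : UnitAddCircle)
      rw [← AddCircle.coe_zsmul, zsmul_eq_mul]
    have hd : deriv (modelBase i) s = i := by simp
    have := circleDeriv_eq hlift (by fun_prop) s
    rw [hd] at this
    have hi := h.two_le_cast
    change 1 < |circleDeriv (fun y => i • y) (s : UnitAddCircle)|
    rw [this, abs_of_pos (by linarith)]
    linarith
  fiber_diffeo := by
    intro y
    obtain ⟨s, rfl⟩ := QuotientAddGroup.mk_surjective y
    have hN := NearModel.model h hε hεL
    refine isCircleDiffeo_of_lift (φ := modelFiber v ε s) (fun t => (h.fiber_coe s t).symm)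
      (h.contDiff_modelFiber s) (fun x => ?_) (hN.fiber_strictMono s) (hN.fiber_surjective s)
      fun x => ?_
    · simp only [modelFiber, h.per_right]; ring
    · have := (h.deriv_modelFiber_mem hε hεL s x).1
      linarith

variable (hε : 0 < ε) (hεL : ε * L ≤ 1 / 1000)

lemma toForced_base_lift : IsCircleLift (modelBase i) (h.toForced hε hεL).base := fun t => by
  change _ = i • (t : UnitAddCircle)
  rw [← AddCircle.coe_zsmul, zsmul_eq_mul]

lemma toForced_fiber_lift (y : ℝ) :
    IsCircleLift (modelFiber v ε y) ((h.toForced hε hεL).fiber y) :=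
  fun t => (h.fiber_coe y t).symm

lemma toForced_map (w : ℝ × ℝ) : (h.toForced hε hεL).map (torusMk w) =
    torusMk (skew (modelBase i) (modelFiber v ε) w) :=
  Prod.ext (h.toForced_base_lift hε hεL w.1).symm (h.toForced_fiber_lift hε hεL w.1 w.2).symm

lemma circleDeriv_toForced_base (y : UnitAddCircle) :
    circleDeriv (h.toForced hε hεL).base y = i := by
  obtain ⟨s, rfl⟩ := QuotientAddGroup.mk_surjective y
  exact (circleDeriv_eq (h.toForced_base_lift hε hεL) (by fun_prop) s).trans (by simp)

lemma circleDeriv_toForced_fiber (y x : ℝ) :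
    circleDeriv ((h.toForced hε hεL).fiber y) x = deriv (modelFiber v ε y) x :=
  circleDeriv_eq (h.toForced_fiber_lift hε hεL y) (h.contDiff_modelFiber y).continuous x

lemma circleDeriv_toForced_fiber_mem (y x : UnitAddCircle) :
    circleDeriv ((h.toForced hε hεL).fiber y) x ∈ Set.Icc (999 / 1000 : ℝ) (1001 / 1000) := by
  obtain ⟨s, rfl⟩ := QuotientAddGroup.mk_surjective y
  obtain ⟨t, rfl⟩ := QuotientAddGroup.mk_surjective x
  exact (h.circleDeriv_toForced_fiber hε hεL s t).symm ▸ h.deriv_modelFiber_mem hε hεL s t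

lemma isPartiallyHyperbolic_toForced : (h.toForced hε hεL).IsPartiallyHyperbolic := by
  intro y x z
  have h1 := h.circleDeriv_toForced_fiber_mem hε hεL y x
  have hi := h.two_le_cast
  rw [h.circleDeriv_toForced_base, abs_of_nonneg (by linarith [h1.1]), abs_of_pos (by linarith)]
  constructor <;> linarith [h1.1, h1.2]

omit hε hεL in
/-- The perturbation and its derivatives up to order `r` are bounded. -/
lemma exists_bound_iteratedFDeriv (r : ℕ) : ∃ M : ℝ, 0 < M ∧ ∀ j ≤ r, ∀ z : ℝ × ℝ,
    ‖iteratedFDeriv ℝ j (fun w : ℝ × ℝ => ((0 : ℝ), v w.1 w.2)) z‖ ≤ M := by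
  have hs : ContDiff ℝ ∞ (fun w : ℝ × ℝ => ((0 : ℝ), v w.1 w.2)) :=
    contDiff_const.prodMk h.smooth
  have hb : ∀ j : ℕ, ∃ M : ℝ, ∀ z : ℝ × ℝ,
      ‖iteratedFDeriv ℝ j (fun w : ℝ × ℝ => ((0 : ℝ), v w.1 w.2)) z‖ ≤ M := by
    intro j
    refine exists_bound_of_periodic_prod
      (hs.continuous_iteratedFDeriv (by exact_mod_cast le_top)) fun z m n => ?_
    rw [← iteratedFDeriv_comp_add_right]
    congr 1
    ext w
    · rfl
    · simp only [Prod.fst_add, Prod.snd_add, h.add_int_left, h.add_int_right]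
  choose M hM using hb
  refine ⟨∑ j ∈ Finset.range (r + 1), |M j| + 1, by positivity, fun j hj z => ?_⟩
  have h1 := Finset.single_le_sum (f := fun j => |M j|) (fun j _ => abs_nonneg _)
    (Finset.mem_range.2 (show j < r + 1 by omega))
  exact (hM j z).trans ((le_abs_self _).trans (by linarith))

lemma ckClose_toForced {r : ℕ} {M ε₀ : ℝ}
    (hM : ∀ j ≤ r, ∀ z : ℝ × ℝ,
      ‖iteratedFDeriv ℝ j (fun w : ℝ × ℝ => ((0 : ℝ), v w.1 w.2)) z‖ ≤ M) (hεM : ε * M < ε₀) :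
    CkClose r ε₀ (h.toForced hε hεL).map (linearSkew i 0) := by
  have hs : ContDiff ℝ ∞ (fun w : ℝ × ℝ => ((0 : ℝ), v w.1 w.2)) :=
    contDiff_const.prodMk h.smooth
  refine ⟨skew (modelBase i) (modelFiber v ε), fun w => (i * w.1, w.2), fun s t => ?_,
    fun s t => ?_, ?_, ?_, fun j hj z => ?_⟩
  · exact (h.toForced_map hε hεL (s, t)).symm
  · simp only [linearSkew, zero_smul, add_zero]
    rw [← AddCircle.coe_zsmul, zsmul_eq_mul]
  · exact (contDiff_const.mul contDiff_fst).prodMk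
      (contDiff_snd.add (contDiff_const.mul (h.smooth.of_le (by exact_mod_cast le_top))))
  · exact (contDiff_const.mul contDiff_fst).prodMk contDiff_snd
  · have h1 : (fun w : ℝ × ℝ => skew (modelBase i) (modelFiber v ε) w - (i * w.1, w.2)) =
        ε • fun w : ℝ × ℝ => ((0 : ℝ), v w.1 w.2) := by
      ext w <;> simp [skew]
    rw [h1, iteratedFDeriv_const_smul_apply (hs.contDiffAt.of_le (by exact_mod_cast le_top)),
      norm_smul, Real.norm_eq_abs, abs_of_pos hε]
    exact (mul_le_mul_of_nonneg_left (hM j hj z) hε.le).trans_lt hεM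

/-- Over the fixed point `0` the fiber map has an attracting and a repelling fixed point and no
others. -/
lemma toForced_fixedPoints : ∃ k : ℕ, 0 < k ∧ ∃ y : UnitAddCircle,
    (h.toForced hε hεL).base^[k] y = y ∧ ∃ a b : UnitAddCircle,
      Function.fixedPoints ((h.toForced hε hεL).fiberIter k y) = {a, b} ∧
        |circleDeriv ((h.toForced hε hεL).fiberIter k y) a| < 1 ∧
          1 < |circleDeriv ((h.toForced hε hεL).fiberIter k y) b| := by
  have hL := h.L_pos
  have hc := h.c_pos
  have hfib : (h.toForced hε hεL).fiberIter 1 ((0 : ℝ) : UnitAddCircle) =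
      (h.toForced hε hεL).fiber ((0 : ℝ) : UnitAddCircle) := rfl
  refine ⟨1, one_pos, ((0 : ℝ) : UnitAddCircle), ?_, ((1 / 2 : ℝ) : UnitAddCircle),
    ((0 : ℝ) : UnitAddCircle), ?_, ?_, ?_⟩
  · rw [Function.iterate_one, ← h.toForced_base_lift hε hεL]
    simp [modelBase]
  · rw [hfib]
    ext x
    obtain ⟨t, rfl⟩ := QuotientAddGroup.mk_surjective x
    have hval : ∀ t : ℝ, (h.toForced hε hεL).fiber ((0 : ℝ) : UnitAddCircle) (t : UnitAddCircle) =
      ((t + ε * v 0 t : ℝ) : UnitAddCircle) := fun t => (h.toForced_fiber_lift hε hεL 0 t).symm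
    change (h.toForced hε hεL).fiber ((0 : ℝ) : UnitAddCircle) (t : UnitAddCircle) = t ↔
      (t : UnitAddCircle) = ((1 / 2 : ℝ) : UnitAddCircle) ∨
        (t : UnitAddCircle) = ((0 : ℝ) : UnitAddCircle)
    constructor
    · intro hfix
      have hfr : (t : UnitAddCircle) = ((Int.fract t : ℝ) : UnitAddCircle) :=
        coe_unitAddCircle_eq_iff.2 ⟨⌊t⌋, (Int.fract_add_floor t).symm⟩
      rw [hfr] at hfix ⊢
      set u := Int.fract t with hu
      rw [hval, coe_unitAddCircle_eq_iff] at hfix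
      obtain ⟨m, hm⟩ := hfix
      have hb := abs_le.1 (h.bound 0 u)
      have h1 : |(m : ℝ)| < 1 := by
        rw [abs_lt]; constructor <;> nlinarith [hb.1, hb.2]
      have hm0 : m = 0 := by
        have : |m| < 1 := by exact_mod_cast h1
        exact Int.abs_lt_one_iff.1 this
      rw [hm0, Int.cast_zero, add_zero] at hm
      have hv0 : v 0 u = 0 := by
        rcases mul_eq_zero.1 (show ε * v 0 u = 0 by linarith) with h2 | h2
        · exact absurd h2 hε.ne'
        · exact h2
      rcases (Int.fract_nonneg t).eq_or_lt with h2 | h2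
      · right; rw [hu, ← h2]
      · left
        rcases lt_trichotomy u (1 / 2) with h3 | h3 | h3
        · exact absurd hv0 (h.zero_pos u h2 h3).ne'
        · rw [h3]
        · exact absurd hv0 (h.zero_neg u h3 (Int.fract_lt_one t)).ne
    · rintro (h1 | h1) <;> rw [h1, hval]
      · rw [h.zero_half, mul_zero, add_zero]
      · rw [h.zero_zero, mul_zero, add_zero]
  · have h1 : deriv (v 0) (1 / 2) ≤ -c := by
      have h2 := ((h.differentiable_v 0) (1 / 2)).hasDerivAt.tendsto_slope.mono_left
        (nhdsWithin_mono _ (fun x (hx : x ∈ Set.Ioi (1 / 2 : ℝ)) => ne_of_gt hx))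
      refine le_of_tendsto h2 ?_
      filter_upwards [Ioo_mem_nhdsGT (show (1 / 2 : ℝ) < 1 / 2 + 1 / 40 by norm_num)] with x hx
      rw [slope_def_field, div_le_iff₀ (by linarith [hx.1])]
      exact h.contract_half _ _ (by norm_num)
        (by rw [abs_le]; constructor <;> linarith [hx.1, hx.2]) hx.1.le
    rw [hfib, h.circleDeriv_toForced_fiber]
    have h3 := (h.deriv_modelFiber_mem hε hεL 0 (1 / 2)).1
    rw [abs_of_nonneg (by linarith), h.deriv_modelFiber]
    nlinarith
  · have h1 : c ≤ deriv (v 0) 0 := by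
      have h2 := ((h.differentiable_v 0) 0).hasDerivAt.tendsto_slope.mono_left
        (nhdsWithin_mono _ (fun x (hx : x ∈ Set.Ioi (0 : ℝ)) => ne_of_gt hx))
      refine ge_of_tendsto h2 ?_
      filter_upwards [Ioo_mem_nhdsGT (show (0 : ℝ) < 1 / 40 by norm_num)] with x hx
      rw [slope_def_field, le_div_iff₀ (by linarith [hx.1])]
      exact h.expand_zero _ _ (by norm_num)
        (by rw [abs_le]; constructor <;> linarith [hx.1, hx.2]) hx.1.le
    rw [hfib, h.circleDeriv_toForced_fiber]
    have h3 := (h.deriv_modelFiber_mem hε hεL 0 0).1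
    rw [abs_of_nonneg (by linarith), h.deriv_modelFiber]
    nlinarith

end ForcingField

/-! ### The natural extension of a skew product -/

section solenoidDist

variable {g : UnitAddCircle → UnitAddCircle}

lemma dist_unitAddCircle_le_one (a b : UnitAddCircle) : dist a b ≤ 1 := by
  have := AddCircle.norm_le_half_period (p := (1 : ℝ)) (x := a - b) one_ne_zero
  rw [dist_eq_norm]
  norm_num at this
  linarith

lemma dist_coe_unitAddCircle_le (a b : ℝ) : dist (a : UnitAddCircle) b ≤ |a - b| := by
  rw [dist_eq_norm, ← AddCircle.coe_sub]
  exact QuotientAddGroup.norm_mk_le_norm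

lemma summable_solenoidDist (y z : Solenoid g) :
    Summable fun n : ℕ => (1 / 2 : ℝ) ^ n * dist (y.1 n) (z.1 n) :=
  Summable.of_nonneg_of_le (fun _ => by positivity)
    (fun _ => mul_le_of_le_one_right (by positivity) (dist_unitAddCircle_le_one _ _))
    summable_geometric_two

lemma solenoidDist_le_of_forall_le {y z : Solenoid g} {r : ℝ}
    (h : ∀ n, dist (y.1 n) (z.1 n) ≤ r) : solenoidDist y z ≤ 2 * r := by
  rw [← tsum_geometric_two, ← tsum_mul_right]
  exact (summable_solenoidDist y z).tsum_le_tsum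
    (fun n => mul_le_mul_of_nonneg_left (h n) (by positivity))
    (summable_geometric_two.mul_right r)

lemma solenoidDist_solenoidMap {y z : Solenoid g} (h : y.1 0 = z.1 0) :
    solenoidDist (solenoidMap g y) (solenoidMap g z) = 1 / 2 * solenoidDist y z := by
  rw [solenoidDist, (summable_solenoidDist _ _).tsum_eq_zero_add, solenoidDist, ← tsum_mul_left]
  have h0 : (solenoidMap g y).1 0 = (solenoidMap g z).1 0 := congrArg g h
  rw [h0, dist_self, mul_zero, zero_add]
  refine tsum_congr fun n => ?_
  change (1 / 2 : ℝ) ^ (n + 1) * dist (y.1 n) (z.1 n) = _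
  rw [pow_succ', mul_assoc]

end solenoidDist

namespace ForcedCircleDiffeo

variable (G : ForcedCircleDiffeo)

/-- The projection `(𝐲, x) ↦ (y₀, x)` of the natural extension to the torus. -/
def proj (q : Solenoid G.base × UnitAddCircle) : UnitAddCircle × UnitAddCircle := (q.1.1 0, q.2)

lemma proj_ext (q : Solenoid G.base × UnitAddCircle) : G.proj (G.ext q) = G.map (G.proj q) := rfl

lemma proj_ext_iterate (n : ℕ) (q : Solenoid G.base × UnitAddCircle) :
    G.proj (G.ext^[n] q) = G.map^[n] (G.proj q) :=
  (show Function.Semiconj G.proj G.ext G.map from G.proj_ext).iterate_right n q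

lemma ext_iterate_coord (n k : ℕ) (q : Solenoid G.base × UnitAddCircle) :
    (G.ext^[n] q).1.1 (k + n) = q.1.1 k := by
  induction n with
  | zero => rfl
  | succ n ih =>
    rw [Function.iterate_succ_apply', ← ih]
    rfl

lemma ext_symm_iterate_coord (n k : ℕ) (q : Solenoid G.base × UnitAddCircle) :
    (G.ext.symm^[n] q).1.1 k = q.1.1 (k + n) := by
  induction n generalizing k with
  | zero => rfl
  | succ n ih =>
    rw [Function.iterate_succ_apply']
    refine Eq.trans (?_ : _ = (G.ext.symm^[n] q).1.1 (k + 1)) ?_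
    · rfl
    · rw [ih, Nat.add_right_comm, Nat.add_assoc]

lemma ext_iterate_symm_iterate (n : ℕ) (q : Solenoid G.base × UnitAddCircle) :
    G.ext^[n] (G.ext.symm^[n] q) = q :=
  (show Function.LeftInverse G.ext G.ext.symm from G.ext.apply_symm_apply).iterate n q

lemma continuous_map : Continuous G.map := by
  obtain ⟨Φ, hΦ, hs⟩ := G.smooth
  rw [(isOpenMap_torusMk.isQuotientMap continuous_torusMk torusMk_surjective).continuous_iff]
  exact (continuous_torusMk.comp hs.continuous).congr fun w => hΦ w.1 w.2

/-- Every nonempty open set of the natural extension contains an iterate of a set of points lying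
over a nonempty open set of the torus: an open set restricts only the fiber coordinate and finitely
many coordinates `y₋ₙ`, all of which are continuous functions of `(y₋ₘ, x)` for large `m`. -/
lemma exists_open_proj {V : Set (Solenoid G.base × UnitAddCircle)} (hV : IsOpen V)
    (hne : V.Nonempty) :
    ∃ (m : ℕ) (V' : Set (UnitAddCircle × UnitAddCircle)), IsOpen V' ∧ V'.Nonempty ∧
      ∀ q, G.proj q ∈ V' → G.ext^[m] q ∈ V := by
  obtain ⟨⟨y₀, x₀⟩, hq₀⟩ := hne
  obtain ⟨u, w, hu, hw, hyu, hxw, huw⟩ := isOpen_prod_iff.1 hV y₀ x₀ hq₀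
  obtain ⟨O, hO, rfl⟩ := isOpen_induced_iff.1 hu
  obtain ⟨I, W, hW, hIW⟩ := isOpen_pi_iff.1 hO y₀.1 hyu
  set m := I.sup id
  have hm : ∀ n ∈ I, n ≤ m := fun n hn => Finset.le_sup (f := id) hn
  have hcoord : ∀ q : Solenoid G.base × UnitAddCircle, ∀ n ∈ I,
      (G.ext^[m] q).1.1 n = (G.map^[m - n] (G.proj q)).1 := by
    intro q n hn
    have h1 := G.ext_iterate_coord n 0 (G.ext^[m - n] q)
    rw [← Function.iterate_add_apply, Nat.add_sub_cancel' (hm n hn), zero_add] at h1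
    rw [h1, ← G.proj_ext_iterate]
    rfl
  have hfib : ∀ q : Solenoid G.base × UnitAddCircle,
      (G.ext^[m] q).2 = (G.map^[m] (G.proj q)).2 := fun q => by
    rw [← G.proj_ext_iterate]
    rfl
  refine ⟨m, (⋂ n ∈ I, {a | (G.map^[m - n] a).1 ∈ W n}) ∩ {a | (G.map^[m] a).2 ∈ w},
    ?_, ⟨G.proj (G.ext.symm^[m] (y₀, x₀)), ?_⟩, fun q hq => ?_⟩
  · refine (isOpen_biInter_finset fun n hn => ?_).inter ?_
    · exact (hW n hn).1.preimage (continuous_fst.comp (G.continuous_map.iterate _))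
    · exact hw.preimage (continuous_snd.comp (G.continuous_map.iterate _))
  · refine ⟨Set.mem_iInter₂.2 fun n hn => ?_, ?_⟩
    · rw [Set.mem_ofPred_eq, ← hcoord _ n hn, G.ext_iterate_symm_iterate]
      exact (hW n hn).2
    · rw [Set.mem_ofPred_eq, ← hfib, G.ext_iterate_symm_iterate]
      exact hxw
  · refine huw ⟨hIW fun n hn => ?_, ?_⟩
    · rw [hcoord q n hn]
      exact Set.mem_iInter₂.1 hq.1 n hn
    · rw [hfib]
      exact hq.2

variable {G}

lemma proj_surjective (hs : Function.Surjective G.map) : Function.Surjective G.proj := by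
  rintro ⟨a, x⟩
  have hb : Function.Surjective G.base := fun a => by
    obtain ⟨q, hq⟩ := hs (a, 0)
    exact ⟨q.1, congrArg Prod.fst hq⟩
  obtain ⟨b, hb⟩ := hb.hasRightInverse
  exact ⟨(⟨fun n => b^[n] a, fun n => by
    change G.base (b^[n + 1] a) = b^[n] a
    rw [Function.iterate_succ_apply', hb]⟩, x), rfl⟩

/-- A skew product for which every nonempty open set has an iterated image equal to the torus is
mixing, and so is its natural extension. -/
lemma isTopMixing_of_image_iterate_eq_univ
    (h : ∀ U : Set (UnitAddCircle × UnitAddCircle), IsOpen U → U.Nonempty →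
      ∃ n, G.map^[n] '' U = Set.univ) (hs : Function.Surjective G.map) :
    IsTopMixing G.map ∧ IsTopMixing G.ext := by
  constructor
  · intro U V hU _ hUne hVne
    obtain ⟨N, hN⟩ := h U hU hUne
    refine ⟨N, fun n hn => ?_⟩
    rw [image_iterate_univ_mono hs hN hn, Set.univ_inter]
    exact hVne
  · intro U V hU hV hUne hVne
    obtain ⟨m, U', hU', hUne', hmU⟩ := G.exists_open_proj hU hUne
    obtain ⟨m', V', -, ⟨b, hb⟩, hmV⟩ := G.exists_open_proj hV hVne
    obtain ⟨N, hN⟩ := h U' hU' hUne'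
    refine ⟨N + m', fun n hn => ?_⟩
    obtain ⟨k, hk⟩ : ∃ k, n + m = m' + k := ⟨n + m - m', by omega⟩
    obtain ⟨a, ha, hab⟩ : b ∈ G.map^[k] '' U' := by
      rw [image_iterate_univ_mono hs hN (show N ≤ k by omega)]
      trivial
    obtain ⟨q, rfl⟩ := proj_surjective hs a
    refine ⟨G.ext^[m' + k] q, ⟨G.ext^[m] q, hmU q ha, ?_⟩, ?_⟩
    · rw [← hk, Function.iterate_add_apply]
    · rw [Function.iterate_add_apply]
      refine hmV _ ?_
      rwa [G.proj_ext_iterate, hab]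

/-! ### Strong stable and strong unstable manifolds -/

lemma extDist_le (p q : Solenoid G.base × UnitAddCircle) : G.extDist p q ≤ 3 := by
  have h1 := solenoidDist_le_of_forall_le fun n => dist_unitAddCircle_le_one (p.1.1 n) (q.1.1 n)
  have h2 := dist_unitAddCircle_le_one p.2 q.2
  rw [extDist]
  linarith

lemma extDist_iterate_of_proj_eq {p q : Solenoid G.base × UnitAddCircle}
    (h : G.proj p = G.proj q) (n : ℕ) :
    G.extDist (G.ext^[n] p) (G.ext^[n] q) = (1 / 2) ^ n * G.extDist p q := by
  induction n with
  | zero => simp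
  | succ n ih =>
    have h1 : G.proj (G.ext^[n] p) = G.proj (G.ext^[n] q) := by
      rw [G.proj_ext_iterate, G.proj_ext_iterate, h]
    have h2 : ∀ P Q : Solenoid G.base × UnitAddCircle, G.proj P = G.proj Q →
        G.extDist P Q = solenoidDist P.1 Q.1 := fun P Q hPQ => by
      rw [extDist, show P.2 = Q.2 from (Prod.mk.inj hPQ).2, dist_self, add_zero]
    rw [h2 _ _ h1] at ih
    rw [h2 _ _ (by rw [G.proj_ext_iterate, G.proj_ext_iterate, h]), Function.iterate_succ_apply',
      Function.iterate_succ_apply', pow_succ', mul_assoc, ← ih]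
    exact solenoidDist_solenoidMap (Prod.mk.inj h1).1

/-- Points whose forward orbits have the same projection from some time on lie in the same strong
stable manifold, the natural extension contracting their distance by the factor `1/2`. -/
lemma mem_strongStable_of_map_iterate_eq (hρ : ∀ y x, 1 / 2 < |circleDeriv (G.fiber y) x|)
    {p q : Solenoid G.base × UnitAddCircle} {n : ℕ}
    (h : G.map^[n] (G.proj p) = G.map^[n] (G.proj q)) : q ∈ G.strongStable p := by
  refine ⟨1 / 2, by norm_num, hρ, 3 * 2 ^ n, fun k => ?_⟩
  have h2 : (2 : ℝ) ^ n * (1 / 2) ^ n = 1 := by rw [← mul_pow]; norm_num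
  rcases le_total k n with hk | hk
  · refine (extDist_le _ _).trans ?_
    have := pow_le_pow_of_le_one (show (0 : ℝ) ≤ 1 / 2 by norm_num) (by norm_num) hk
    have h3 : (2 : ℝ) ^ n * (1 / 2) ^ n ≤ 2 ^ n * (1 / 2) ^ k :=
      mul_le_mul_of_nonneg_left this (by positivity)
    linarith
  · obtain ⟨j, rfl⟩ := Nat.exists_eq_add_of_le' hk
    rw [Function.iterate_add_apply, Function.iterate_add_apply, extDist_iterate_of_proj_eq
      (by rw [G.proj_ext_iterate, G.proj_ext_iterate, h]), pow_add]
    have h3 := mul_le_mul_of_nonneg_left (extDist_le (G.ext^[n] p) (G.ext^[n] q))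
      (show (0 : ℝ) ≤ (1 / 2) ^ j by positivity)
    calc _ ≤ (1 / 2) ^ j * (3 : ℝ) := h3
      _ = 3 * (1 / 2) ^ j * (2 ^ n * (1 / 2) ^ n) := by rw [h2]; ring
      _ = _ := by ring

lemma dense_strongStable (hρ : ∀ y x, 1 / 2 < |circleDeriv (G.fiber y) x|)
    (h : ∀ U : Set (UnitAddCircle × UnitAddCircle), IsOpen U → U.Nonempty →
      ∃ n, G.map^[n] '' U = Set.univ) (hs : Function.Surjective G.map)
    (p : Solenoid G.base × UnitAddCircle) : Dense (G.strongStable p) := by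
  rw [dense_iff_inter_open]
  intro V hV hne
  obtain ⟨m, V', hV', hne', hmV⟩ := G.exists_open_proj hV hne
  obtain ⟨n, hn⟩ := h V' hV' hne'
  obtain ⟨a, ha, han⟩ : G.map^[n] (G.proj (G.ext.symm^[m] p)) ∈ G.map^[n] '' V' := by
    rw [hn]; trivial
  obtain ⟨q, rfl⟩ := proj_surjective hs a
  refine ⟨G.ext^[m] q, hmV q ha, mem_strongStable_of_map_iterate_eq hρ (n := n) ?_⟩
  rw [← G.ext_iterate_symm_iterate m p, G.proj_ext_iterate, G.proj_ext_iterate,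
    ← Function.iterate_add_apply, ← Function.iterate_add_apply, Nat.add_comm,
    Function.iterate_add_apply, Function.iterate_add_apply, han]

lemma ext_mem_strongUnstable {p q : Solenoid G.base × UnitAddCircle}
    (hq : q ∈ G.strongUnstable p) : G.ext q ∈ G.strongUnstable (G.ext p) := by
  obtain ⟨ρ, hρ, hd, C, hC⟩ := hq
  refine ⟨ρ, hρ, hd, max (G.extDist (G.ext p) (G.ext q)) (C / ρ), fun n => ?_⟩
  cases n with
  | zero => simp
  | succ n =>
    rw [Function.iterate_succ_apply, Function.iterate_succ_apply, G.ext.symm_apply_apply,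
      G.ext.symm_apply_apply]
    calc _ ≤ C * ρ ^ n := hC n
      _ = C / ρ * ρ ^ (n + 1) := by rw [pow_succ]; field_simp
      _ ≤ _ := mul_le_mul_of_nonneg_right (le_max_right _ _) (by positivity)

lemma ext_iterate_mem_strongUnstable {p q : Solenoid G.base × UnitAddCircle}
    (hq : q ∈ G.strongUnstable p) (n : ℕ) :
    G.ext^[n] q ∈ G.strongUnstable (G.ext^[n] p) := by
  induction n with
  | zero => exact hq
  | succ n ih =>
    rw [Function.iterate_succ_apply', Function.iterate_succ_apply']
    exact ext_mem_strongUnstable ih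

end ForcedCircleDiffeo

/-! ### Skew products close to the model -/

namespace ForcingField

variable {i : ℤ} {v : ℝ → ℝ → ℝ} {L c θ ε : ℝ} (h : ForcingField i v L c θ)
include h

variable (hε : 0 < ε) (hεL : ε * L ≤ 1 / 1000)

lemma continuous_skew_model : Continuous (skew (modelBase i) (modelFiber v ε)) :=
  (continuous_const.mul continuous_fst).prodMk
    (continuous_snd.add (continuous_const.mul h.smooth.continuous))

/-- A skew product that is `C¹`-close to the model has a lift close to the lift of the model: the
lifts of the model provided by `CkClose` differ from the standard one by a translation. -/
lemma exists_nearModel_of_ckClose {r : ℕ} (hr : 1 ≤ r) {δ : ℝ} (hδ : δ ≤ 1 / 1000)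
    {G : ForcedCircleDiffeo} (hG : CkClose r δ (h.toForced hε hεL).map G.map) :
    ∃ (g : ℝ → ℝ) (f : ℝ → ℝ → ℝ), NearModel i v L c θ ε δ g f ∧
      ∀ w, G.map (torusMk w) = torusMk (skew g f w) := by
  obtain ⟨Φ, Ψ, hΦ, hΨ, hΦs, hΨs, hclose⟩ := hG
  set A := skew (modelBase i) (modelFiber v ε) with hA
  have hAc : Continuous A := h.continuous_skew_model
  have hint : ∀ w, ∃ m n : ℤ, Φ w = ((A w).1 + m, (A w).2 + n) := fun w =>
    torusMk_eq_iff.1 ((hΦ w.1 w.2).trans (h.toForced_map hε hεL w))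
  have hΦc := hΦs.continuous
  have hΨc := hΨs.continuous
  have h1 : ∀ w, (Φ w).1 - (A w).1 = (Φ 0).1 - (A 0).1 := fun w =>
    eq_of_continuous_of_forall_int (u := fun w => (Φ w).1 - (A w).1) (by fun_prop)
      (fun w => by obtain ⟨m, n, hw⟩ := hint w; exact ⟨m, by rw [hw]; simp⟩) w 0
  have h2 : ∀ w, (Φ w).2 - (A w).2 = (Φ 0).2 - (A 0).2 := fun w =>
    eq_of_continuous_of_forall_int (u := fun w => (Φ w).2 - (A w).2) (by fun_prop)
      (fun w => by obtain ⟨m, n, hw⟩ := hint w; exact ⟨n, by rw [hw]; simp⟩) w 0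
  obtain ⟨m, n, h0⟩ := hint 0
  rw [h0] at h1 h2
  simp only [add_sub_cancel_left] at h1 h2
  set D : ℝ × ℝ → ℝ × ℝ := fun w => Φ w - Ψ w with hD
  have hDb : ∀ w, ‖D w‖ ≤ δ := fun w => by
    rw [← norm_iteratedFDeriv_zero (𝕜 := ℝ)]
    exact (hclose 0 (Nat.zero_le _) w).le
  have hDl : ∀ w w', ‖D w - D w'‖ ≤ δ * ‖w - w'‖ := fun w w' =>
    Convex.norm_image_sub_le_of_norm_fderiv_le (𝕜 := ℝ) (s := Set.univ)
      (fun x _ => ((hΦs.sub hΨs).differentiable (by exact_mod_cast (by omega : r ≠ 0))) x)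
      (fun x _ => by rw [← norm_iteratedFDeriv_one]; exact (hclose 1 hr x).le) convex_univ
      trivial trivial
  have hδ0 : 0 ≤ δ := (norm_nonneg _).trans (hDb 0)
  -- the first coordinate of the lift does not depend on the fiber variable
  have hΨ1 : ∀ y x, (Ψ (y, x)).1 = (Ψ (y, 0)).1 := by
    intro y x
    have := eq_of_continuous_of_forall_int (u := fun x => (Ψ (y, x)).1 - (Ψ (y, 0)).1)
      (by fun_prop) (fun x => by
        have h3 : (((Ψ (y, x)).1 : ℝ) : UnitAddCircle) = ((Ψ (y, 0)).1 : ℝ) :=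
          (congrArg Prod.fst (hΨ y x)).trans (congrArg Prod.fst (hΨ y 0)).symm
        obtain ⟨m, hm⟩ := coe_unitAddCircle_eq_iff.1 h3
        exact ⟨m, by rw [hm]; ring⟩) x 0
    simp only [sub_self] at this
    linarith
  have hE1 : ∀ y x, (Ψ (y, 0)).1 - m - i * y = -(D (y, x)).1 := by
    intro y x
    have := h1 (y, x)
    simp only [hA, skew] at this
    rw [hD, ← hΨ1 y x, Prod.fst_sub]
    linarith
  have hE2 : ∀ y x, (Ψ (y, x)).2 - n - (x + ε * v y x) = -(D (y, x)).2 := by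
    intro y x
    have := h2 (y, x)
    simp only [hA, skew] at this
    rw [hD, Prod.snd_sub]
    linarith
  have hD1 : ∀ w w', |-(D w).1 - -(D w').1| ≤ δ * ‖w - w'‖ := fun w w' => by
    rw [neg_sub_neg, abs_sub_comm, ← Prod.fst_sub]
    exact (norm_fst_le _).trans (hDl w w')
  have hD2 : ∀ w w', |-(D w).2 - -(D w').2| ≤ δ * ‖w - w'‖ := fun w w' => by
    rw [neg_sub_neg, abs_sub_comm, ← Prod.snd_sub]
    exact (norm_snd_le _).trans (hDl w w')
  have hn1 : ∀ y y' x : ℝ, ‖((y, x) : ℝ × ℝ) - (y', x)‖ = |y - y'| := fun y y' x => by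
    simp [Prod.norm_def]
  have hn2 : ∀ y x x' : ℝ, ‖((y, x) : ℝ × ℝ) - (y, x')‖ = |x - x'| := fun y x x' => by
    simp [Prod.norm_def]
  refine ⟨fun y => (Ψ (y, 0)).1 - m, fun y x => (Ψ (y, x)).2 - n, ?_, fun w => ?_⟩
  · refine ⟨h, hε, hεL, hδ0, hδ, fun y => ?_, fun y y' => ?_, fun y x => ?_, fun y y' x => ?_,
      fun y x x' => ?_⟩
    · rw [hE1 y 0, abs_neg]
      exact (norm_fst_le _).trans (hDb _)
    · rw [hE1 y 0, hE1 y' 0, ← hn1 y y' 0]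
      exact hD1 _ _
    · rw [hE2, abs_neg]
      exact (norm_snd_le _).trans (hDb _)
    · rw [hE2, hE2, ← hn1 y y' x]
      exact hD2 _ _
    · rw [hE2, hE2, ← hn2 y x x']
      exact hD2 _ _
  · refine (hΨ w.1 w.2).symm.trans (torusMk_eq_iff.2 ⟨m, n, ?_⟩)
    refine Prod.ext ?_ ?_
    · simp [skew, ← hΨ1 w.1 w.2]
    · simp [skew]

/-! ### Mixing and density of the strong manifolds for the model -/

lemma isRobustlyMixing_toForced (hβ : Irrational (2 * (ε * θ))) {N : ℕ} (hN : 24 * L ≤ N * c)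
    (hNε : N * (ε * L) ≤ 1 / 400) (hiN : 4 ≤ (i : ℝ) ^ N) {r : ℕ} (hr : 1 ≤ r) :
    (h.toForced hε hεL).IsRobustlyMixing r := by
  obtain ⟨δ, hδ, hδ1, hmix⟩ := h.exists_robust_image_iterate_eq_univ hε hεL hβ hN hNε hiN
    (h.toForced_map hε hεL)
  refine ⟨δ, hδ, fun G hG => ?_⟩
  obtain ⟨g, f, hgf, hS⟩ := h.exists_nearModel_of_ckClose hε hεL hr hδ1 hG
  refine ForcedCircleDiffeo.isTopMixing_of_image_iterate_eq_univ (hmix g f hgf _ hS) fun q => ?_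
  obtain ⟨⟨z, x⟩, rfl⟩ := torusMk_surjective q
  obtain ⟨y, rfl⟩ := hgf.base_surjective z
  obtain ⟨x, rfl⟩ := hgf.fiber_surjective y x
  exact ⟨torusMk (y, x), hS _⟩

lemma dense_strongStable_toForced (hβ : Irrational (2 * (ε * θ)))
    (p : Solenoid (h.toForced hε hεL).base × UnitAddCircle) :
    Dense ((h.toForced hε hεL).strongStable p) :=
  ForcedCircleDiffeo.dense_strongStable
    (fun y x => (h.isPartiallyHyperbolic_toForced hε hεL y x 0).1)
    (fun _ hU hne => h.exists_image_iterate_eq_univ hε hεL hβ (h.toForced_map hε hεL) hU hne)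
    (h.surjective_of_semiconj hε hεL (h.toForced_map hε hεL)) p

/-- Every strong unstable manifold contains a set projecting onto a nearly horizontal curve. It
consists of the points `((…, Y₁ + t / i, Y₀ + t), X₀ + ℓ₀(t))`, whose `n`-th preimages have the
fiber coordinates `Xₙ + ℓₙ(t / iⁿ)`. -/
lemma exists_curve_strongUnstable {F : ForcedCircleDiffeo} (hF : F = h.toForced hε hεL)
    (p : Solenoid F.base × UnitAddCircle) :
    ∃ C : ℝ → ℝ, (∀ t t', |C t - C t'| ≤ 1 / 100 * |t - t'|) ∧
      ∀ s, ∃ q ∈ F.strongUnstable p, F.proj q = torusMk (s, C s) := by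
  have hi := h.two_le_cast
  have hi0 : (i : ℝ) ≠ 0 := by linarith
  choose Y hY using fun n => QuotientAddGroup.mk_surjective (p.1.1 n)
  choose X hX using fun n => QuotientAddGroup.mk_surjective (F.ext.symm^[n] p).2
  change ∀ n, (Y n : UnitAddCircle) = p.1.1 n at hY
  change ∀ n, (X n : UnitAddCircle) = (F.ext.symm^[n] p).2 at hX
  obtain ⟨ℓ, hℓ0, hℓl, hℓ⟩ := h.exists_leaf hε hεL Y X
  have hbase : ∀ t : ℝ, F.base t = ((i * t : ℝ) : UnitAddCircle) := fun t =>
    hF ▸ (h.toForced_base_lift hε hεL t).symm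
  have hfiber : ∀ y x : ℝ, ((modelFiber v ε y x : ℝ) : UnitAddCircle) = F.fiber y x := fun y x =>
    hF ▸ h.toForced_fiber_lift hε hεL y x
  have hYi : ∀ n, ((i * Y (n + 1) : ℝ) : UnitAddCircle) = Y n := fun n => by
    rw [← hbase, hY, hY, p.1.2]
  have hdiv : ∀ (t : ℝ) (n : ℕ), i * (t / (i : ℝ) ^ (n + 1)) = t / (i : ℝ) ^ n := fun t n => by
    rw [pow_succ]; field_simp
  have hsol : ∀ (t : ℝ) (n : ℕ), F.base ((Y (n + 1) + t / (i : ℝ) ^ (n + 1) : ℝ) : UnitAddCircle) =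
      ((Y n + t / (i : ℝ) ^ n : ℝ) : UnitAddCircle) := fun t n => by
    rw [hbase, mul_add, hdiv, AddCircle.coe_add, hYi, ← AddCircle.coe_add]
  -- the `n`-th preimage of the point with parameter `t`
  let Q : ℝ → ℕ → Solenoid F.base × UnitAddCircle := fun t n =>
    (⟨fun k => ((Y (k + n) + t / (i : ℝ) ^ (k + n) : ℝ) : UnitAddCircle), fun k => by
      simpa only [Nat.add_right_comm] using hsol t (k + n)⟩,
      ((X n + ℓ n (t / (i : ℝ) ^ n) : ℝ) : UnitAddCircle))
  have hXi : ∀ n, ((modelFiber v ε (Y (n + 1)) (X (n + 1)) : ℝ) : UnitAddCircle) = X n := by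
    intro n
    rw [hfiber, hX, hX, hY, Function.iterate_succ_apply']
    have h1 := congrArg Prod.snd (F.ext.apply_symm_apply (F.ext.symm^[n] p))
    have h2 := F.ext_symm_iterate_coord (n + 1) 0 p
    rw [Function.iterate_succ_apply', zero_add] at h2
    rw [← h2]
    exact h1
  have hQ : ∀ t n, F.ext (Q t (n + 1)) = Q t n := by
    intro t n
    refine Prod.ext (Subtype.ext (funext fun k => ?_)) ?_
    · cases k with
      | zero =>
        change F.base ((Y (0 + (n + 1)) + t / (i : ℝ) ^ (0 + (n + 1)) : ℝ) : UnitAddCircle) =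
          ((Y (0 + n) + t / (i : ℝ) ^ (0 + n) : ℝ) : UnitAddCircle)
        rw [zero_add, zero_add, hsol]
      | succ k =>
        change ((Y (k + (n + 1)) + t / (i : ℝ) ^ (k + (n + 1)) : ℝ) : UnitAddCircle) =
          ((Y (k + 1 + n) + t / (i : ℝ) ^ (k + 1 + n) : ℝ) : UnitAddCircle)
        rw [Nat.add_right_comm, Nat.add_assoc]
    · change F.fiber ((Y (0 + (n + 1)) + t / (i : ℝ) ^ (0 + (n + 1)) : ℝ) : UnitAddCircle)
        ((X (n + 1) + ℓ (n + 1) (t / (i : ℝ) ^ (n + 1)) : ℝ) : UnitAddCircle) =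
          ((X n + ℓ n (t / (i : ℝ) ^ n) : ℝ) : UnitAddCircle)
      rw [zero_add, ← hfiber, AddCircle.coe_add (1 : ℝ) (X n), ← hXi, ← AddCircle.coe_add,
        ← hdiv t n, hℓ, add_sub_cancel]
  have hQn : ∀ t n, F.ext.symm^[n] (Q t 0) = Q t n := by
    intro t n
    induction n with
    | zero => rfl
    | succ n ih => rw [Function.iterate_succ_apply', ih, ← hQ, Equiv.symm_apply_apply]
  refine ⟨fun s => X 0 + ℓ 0 (s - Y 0), fun t t' => ?_, fun s => ⟨Q (s - Y 0) 0, ?_, ?_⟩⟩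
  · have := hℓl 0 (t - Y 0) (t' - Y 0)
    simpa using this
  · refine ⟨(i : ℝ)⁻¹, by positivity, fun y x => ?_, 3 * |s - Y 0|, fun n => ?_⟩
    · have h1 := h.circleDeriv_toForced_fiber_mem hε hεL y x
      rw [← hF] at h1
      rw [abs_of_pos (by linarith [h1.1])]
      exact inv_strictAnti₀ (by linarith [h1.1]) (by linarith [h1.2])
    · rw [hQn]
      set t := s - Y 0
      have h1 : ∀ k, |t / (i : ℝ) ^ (k + n)| ≤ |t| * (i : ℝ)⁻¹ ^ n := fun k => by
        rw [abs_div, abs_of_pos (by positivity : (0 : ℝ) < i ^ (k + n)), div_eq_mul_inv, ← inv_pow]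
        exact mul_le_mul_of_nonneg_left (pow_le_pow_of_le_one (by positivity)
          (inv_le_one_of_one_le₀ (by linarith)) (by omega)) (abs_nonneg _)
      have h2 : solenoidDist (F.ext.symm^[n] p).1 (Q t n).1 ≤ 2 * (|t| * (i : ℝ)⁻¹ ^ n) := by
        refine solenoidDist_le_of_forall_le fun k => ?_
        rw [F.ext_symm_iterate_coord, ← hY]
        refine (dist_coe_unitAddCircle_le _ _).trans ?_
        rw [sub_add_cancel_left, abs_neg]
        exact h1 k
      have h3 : dist (F.ext.symm^[n] p).2 (Q t n).2 ≤ |t| * (i : ℝ)⁻¹ ^ n := by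
        rw [← hX]
        refine (dist_coe_unitAddCircle_le _ _).trans ?_
        have h4 := hℓl n (t / (i : ℝ) ^ n) 0
        have h5 := h1 0
        rw [zero_add] at h5
        rw [hℓ0, sub_zero, sub_zero] at h4
        rw [sub_add_cancel_left, abs_neg]
        have := abs_nonneg (t / (i : ℝ) ^ n)
        linarith
      rw [ForcedCircleDiffeo.extDist]
      linarith
  · simp [Q, ForcedCircleDiffeo.proj, torusMk]

lemma dense_strongUnstable_toForced (hβ : Irrational (2 * (ε * θ))) {F : ForcedCircleDiffeo}
    (hF : F = h.toForced hε hεL) (p : Solenoid F.base × UnitAddCircle) :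
    Dense (F.strongUnstable p) := by
  rw [dense_iff_inter_open]
  intro V hV hne
  obtain ⟨m, V', hV', hne', hmV⟩ := F.exists_open_proj hV hne
  obtain ⟨N, hN⟩ := h.exists_iterate_meets_curves hε hεL hβ (T := F.map)
    (fun w => hF ▸ h.toForced_map hε hεL w) hV' hne'
  obtain ⟨C, hC, hCq⟩ := h.exists_curve_strongUnstable hε hεL hF (F.ext.symm^[m + N] p)
  obtain ⟨s, hs⟩ := hN C hC
  obtain ⟨q, hq, hqs⟩ := hCq s
  -- iterating `m + N` times maps the strong unstable manifold of the preimage to that of `p`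
  refine ⟨F.ext^[m + N] q, ?_, ?_⟩
  · rw [Function.iterate_add_apply]
    refine hmV _ ?_
    rwa [F.proj_ext_iterate, hqs]
  · have := ForcedCircleDiffeo.ext_iterate_mem_strongUnstable hq (m + N)
    rwa [F.ext_iterate_symm_iterate] at this

end ForcingField

/-! ### Choice of the parameters -/

theorem mainTheorem2 (i : ℤ) (hi : 1 < i) (r : ℕ) (hr : 2 ≤ r) (ε : ℝ) (hε : 0 < ε) :
    ∃ F : ForcedCircleDiffeo,
      CkClose r ε F.map (linearSkew i 0) ∧
      F.IsRobustlyMixing r ∧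
      (∃ k : ℕ, 0 < k ∧ ∃ y : UnitAddCircle, F.base^[k] y = y ∧
        ∃ a b : UnitAddCircle, Function.fixedPoints (F.fiberIter k y) = {a, b} ∧
          |circleDeriv (F.fiberIter k y) a| < 1 ∧ 1 < |circleDeriv (F.fiberIter k y) b|) ∧
      F.IsPartiallyHyperbolic ∧
      ∀ p : Solenoid F.base × UnitAddCircle,
        Dense (F.strongStable p) ∧ Dense (F.strongUnstable p) := by
  obtain ⟨v, L, c, θ, h⟩ := exists_forcingField hi
  obtain ⟨M, hM0, hM⟩ := h.exists_bound_iteratedFDeriv r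
  have hL := h.L_pos
  have hc := h.c_pos
  have hθ := h.θ_pos
  have hi' := h.two_le_cast
  obtain ⟨N₀, hN₀⟩ := exists_nat_ge (24 * L / c)
  rw [div_le_iff₀ hc] at hN₀
  set N := N₀ + 2
  have hN : 24 * L ≤ N * c := by push_cast [N]; nlinarith
  have hiN : 4 ≤ (i : ℝ) ^ N := by
    calc (4 : ℝ) = 2 ^ 2 := by norm_num
      _ ≤ (i : ℝ) ^ 2 := by gcongr
      _ ≤ _ := pow_le_pow_right₀ (by linarith) (by omega)
  -- the bounds on `ε'` come from the smallness required of `ε' L`, `N ε' L` and `ε' M`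
  set η := min (min (1 / (1000 * L)) (1 / (400 * (N * L)))) (ε / M) with hη
  have hη0 : 0 < η := by positivity
  -- `ε'` is such that the second iterate over the orbit of period two is an irrational rotation
  obtain ⟨β, hβ, hβ0, hβη⟩ := exists_irrational_btwn (show (0 : ℝ) < 2 * θ * η by positivity)
  set ε' := β / (2 * θ) with hε'
  have hε'0 : 0 < ε' := by positivity
  have hlt : ε' < η := by rw [hε', div_lt_iff₀ (by positivity)]; linarith
  have h1 : ε' < 1 / (1000 * L) := hlt.trans_le ((min_le_left _ _).trans (min_le_left _ _))
  have h2 : ε' < 1 / (400 * (N * L)) := hlt.trans_le ((min_le_left _ _).trans (min_le_right _ _))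
  have h3 : ε' < ε / M := hlt.trans_le (min_le_right _ _)
  rw [lt_div_iff₀ (by positivity)] at h1 h2 h3
  have hirr : Irrational (2 * (ε' * θ)) := by
    rwa [show 2 * (ε' * θ) = β by rw [hε']; field_simp]
  have hεL : ε' * L ≤ 1 / 1000 := by linarith
  refine ⟨h.toForced hε'0 hεL, h.ckClose_toForced hε'0 hεL hM h3,
    h.isRobustlyMixing_toForced hε'0 hεL hirr hN (by linarith) hiN (by omega),
    h.toForced_fixedPoints hε'0 hεL, h.isPartiallyHyperbolic_toForced hε'0 hεL,
    fun p => ⟨h.dense_strongStable_toForced hε'0 hεL hirr p,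
      h.dense_strongUnstable_toForced hε'0 hεL hirr rfl p⟩⟩
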